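/- Let $d\ge 1$, $1\le p<\infty$, and let $q\in(1,\infty]$ be given by $\frac1p+\frac1q=1$. Let $w\in L^1_{\mathrm{loc}}(\mathbb R^d)$ with $w\ge 0$ a.e., and put $\mu(dx):=w\,dx$ and $\varphi:=w^{1/p}$. Assume (Diff): $\varphi\in W^{1,p}_{\mathrm{loc}}(dx)$ and $\beta:=p\,\dfrac{\nabla\varphi}{\varphi}\in L^q_{\mathrm{loc}}(\mu;\mathbb R^d)$, where $\beta:=0$ on $\{\varphi=0\}$. If $p=1$, assume in addition that $\nabla\varphi\in L^\infty_{\mathrm{loc}}(dx;\mathbb R^d)$. Let $V^{1,p}(\mu)$ be the set of all $\mu$-classes $f\in L^p(\mu)$ for which there is a gradient $\nabla^\mu f=(\partial_1^\mu f,\dots,\partial_d^\mu f)\in L^p(\mu;\mathbb R^d)$ with $$\int \partial_i^\mu f\,\eta\,d\mu=-\int f\,\partial_i\eta\,d\mu-\int f\,\eta\,\beta_i\,d\mu\qquad\text{for all } i\in\{1,\dots,d\},\ \eta\in C_0^\infty(\mathbb R^d),$$ where $C_0^\infty(\mathbb R^d)$ denotes the smooth functions with compact support. Equip it with the norm $\|f\|_{1,p,\mu}=\big(\|\nabla^\mu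 f\|_{L^p(\mu;\mathbb R^d)}^p+\|f\|_{L^p(\mu)}^p\big)^{1/p}$. Let $H^{1,p}(\mu)$ be the completion of $X:=\{u\in C^\infty(\mathbb R^d): u\in L^p(\mu),\ \nabla u\in L^p(\mu;\mathbb R^d)\}$ with respect to the pre-norm $\big(\|\nabla u\|_{L^p(\mu;\mathbb R^d)}^p+\|u\|_{L^p(\mu)}^p\big)^{1/p}$. Then the gradient $\nabla^\mu f$ of each $f\in V^{1,p}(\mu)$ is unique; $C_0^\infty(\mathbb R^d)$ is contained in $V^{1,p}(\mu)$, with $\nabla^\mu u=\nabla u$ $\mu$-a.e. for $u\in C_0^\infty(\mathbb R^d)$, and is dense in $V^{1,p}(\mu)$; and $$H^{1,p}(\mu)=V^{1,p}(\mu),$$ that is, the map that sends $u\in X$ to its $\mu$-class, with gradient the $\mu$-class of $\nabla u$, extends to a linear isometric bijection of $H^{1,p}(\mu)$ onto $V^{1,p}(\mu)$. -/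

import Mathlib

open MeasureTheory Set Filter Topology
open scoped ENNReal NNReal ContDiff Gradient

noncomputable section

namespace WeightedSobolev

/-- Euclidean space `ℝ^d`, with the Euclidean norm. -/
abbrev Eucl (d : ℕ) : Type := EuclideanSpace ℝ (Fin d)

/-- `η ∈ C_0^∞(ℝ^d)`: infinitely differentiable with compact support. -/
def IsTest {d : ℕ} (η : Eucl d → ℝ) : Prop :=
  ContDiff ℝ ∞ η ∧ HasCompactSupport η

/-- The classical partial derivative `∂_i η`. -/
def partialD {d : ℕ} (i : Fin d) (η : Eucl d → ℝ) (x : Eucl d) : ℝ :=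
  fderiv ℝ η x (EuclideanSpace.single i 1)

/-- `f ∈ L^p_loc(ν)`: `f` is `p`-integrable (essentially bounded if `p = ∞`) on every compact set. -/
def MemLpLoc {d : ℕ} {F : Type*} [NormedAddCommGroup F] (f : Eucl d → F) (p : ℝ≥0∞)
    (ν : Measure (Eucl d)) : Prop :=
  ∀ K : Set (Eucl d), IsCompact K → MemLp f p (ν.restrict K)

/-- `g` is the weak gradient of `f` with respect to Lebesgue measure. -/
def IsWeakGradient {d : ℕ} (f : Eucl d → ℝ) (g : Eucl d → Eucl d) : Prop :=
  ∀ (i : Fin d) (η : Eucl d → ℝ), IsTest η →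
    ∫ x, g x i * η x = - ∫ x, f x * partialD i η x

/-- `f ∈ W^{1,p}_loc(dx)`, with weak gradient `g`. -/
def MemW1pLoc {d : ℕ} (p : ℝ≥0∞) (f : Eucl d → ℝ) (g : Eucl d → Eucl d) : Prop :=
  MemLpLoc f p volume ∧ MemLpLoc g p volume ∧ IsWeakGradient f g

/-- The measure `μ(dx) = w dx`. -/
def weightMeasure {d : ℕ} (w : Eucl d → ℝ) : Measure (Eucl d) :=
  volume.withDensity fun x => ENNReal.ofReal (w x)

/-- `φ = w^{1/p}`. -/
def phi {d : ℕ} (p : ℝ≥0∞) (w : Eucl d → ℝ) (x : Eucl d) : ℝ :=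
  w x ^ (1 / p.toReal)

/-- The logarithmic derivative `β = p ∇φ / φ`, where `gφ` is the weak gradient of `φ`.
Division by zero gives zero, so that `β = 0` on `{φ = 0}`. -/
def logGrad {d : ℕ} (p : ℝ≥0∞) (w : Eucl d → ℝ) (gφ : Eucl d → Eucl d) (x : Eucl d) : Eucl d :=
  (p.toReal / phi p w x) • gφ x

/-- Condition (Diff), with `gφ` the weak gradient of `φ = w^{1/p}`:
`φ ∈ W^{1,p}_loc(dx)` and `β = p ∇φ / φ ∈ L^q_loc(μ; ℝ^d)`, where `1/p + 1/q = 1`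
(`q = ∞` if `p = 1`). -/
structure CondDiff {d : ℕ} (p : ℝ≥0∞) (w : Eucl d → ℝ) (gφ : Eucl d → Eucl d) : Prop where
  phi_mem : MemW1pLoc p (phi p w) gφ
  logGrad_mem : MemLpLoc (logGrad p w gφ) (ENNReal.conjExponent p) (weightMeasure w)

/-- Pairs (function, gradient) in `L^p(μ) × L^p(μ; ℝ^d)`, with the Sobolev norm
`‖(f, g)‖ = (‖f‖_{L^p(μ)}^p + ‖g‖_{L^p(μ; ℝ^d)}^p)^{1/p}`. -/
abbrev SobPair {d : ℕ} (p : ℝ≥0∞) (μ : Measure (Eucl d)) : Type :=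
  WithLp p (Lp ℝ p μ × Lp (Eucl d) p μ)

/-- The space `V^{1,p}(μ)`, each `f` listed together with its gradient `∇^μ f`: all pairs
`(f, g)` of `μ`-classes `f ∈ L^p(μ)`, `g ∈ L^p(μ; ℝ^d)` that satisfy the formula of integration
by parts `∫ g_i η dμ = - ∫ f ∂_i η dμ - ∫ f η β_i dμ` for all `i` and all `η ∈ C_0^∞(ℝ^d)`. -/
def V1p {d : ℕ} (p : ℝ≥0∞) (μ : Measure (Eucl d)) (β : Eucl d → Eucl d) : Set (SobPair p μ) :=
  {F | ∀ (i : Fin d) (η : Eucl d → ℝ), IsTest η →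
    ∫ x, F.snd x i * η x ∂μ =
      - (∫ x, F.fst x * partialD i η x ∂μ) - ∫ x, F.fst x * η x * β x i ∂μ}

theorem gradient_add_of_smooth {d : ℕ} {u v : Eucl d → ℝ} (hu : ContDiff ℝ ∞ u)
    (hv : ContDiff ℝ ∞ v) : ∇ (u + v) = ∇ u + ∇ v := by
  funext x
  have h1 := (hu.differentiable (by simp)) x
  have h2 := (hv.differentiable (by simp)) x
  simp [gradient, fderiv_add h1 h2]

theorem gradient_smul_of_smooth {d : ℕ} {u : Eucl d → ℝ} (c : ℝ) (hu : ContDiff ℝ ∞ u) :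
    ∇ (c • u) = c • ∇ u := by
  funext x
  have h1 := (hu.differentiable (by simp)) x
  simp [gradient, fderiv_const_smul h1 c]

/-- The vector space of all `u ∈ C^∞(ℝ^d)` with `u ∈ L^p(μ)` and `∇u ∈ L^p(μ; ℝ^d)`. -/
def smoothSubmodule {d : ℕ} (p : ℝ≥0∞) (μ : Measure (Eucl d)) : Submodule ℝ (Eucl d → ℝ) where
  carrier := {u | ContDiff ℝ ∞ u ∧ MemLp u p μ ∧ MemLp (∇ u) p μ}
  zero_mem' := by
    refine ⟨contDiff_const, MemLp.zero', ?_⟩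
    have : ∇ (0 : Eucl d → ℝ) = 0 := by
      funext x
      simp [gradient]
    rw [this]
    exact MemLp.zero'
  add_mem' := by
    rintro u v ⟨hu, hu1, hu2⟩ ⟨hv, hv1, hv2⟩
    refine ⟨hu.add hv, hu1.add hv1, ?_⟩
    rw [gradient_add_of_smooth hu hv]
    exact hu2.add hv2
  smul_mem' := by
    rintro c u ⟨hu, hu1, hu2⟩
    refine ⟨contDiff_const.smul hu, hu1.const_smul c, ?_⟩
    rw [gradient_smul_of_smooth c hu]
    exact hu2.const_smul c

/-- The space `X` of smooth functions of finite Sobolev norm, as a type of its own: its topology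
is that of the Sobolev norm (below), not that of pointwise convergence. -/
def X {d : ℕ} (p : ℝ≥0∞) (μ : Measure (Eucl d)) : Type := smoothSubmodule p μ

instance {d : ℕ} (p : ℝ≥0∞) (μ : Measure (Eucl d)) : AddCommGroup (X p μ) :=
  inferInstanceAs (AddCommGroup (smoothSubmodule p μ))

instance {d : ℕ} (p : ℝ≥0∞) (μ : Measure (Eucl d)) : Module ℝ (X p μ) :=
  inferInstanceAs (Module ℝ (smoothSubmodule p μ))

/-- The function underlying an element of `X`. -/
def X.fn {d : ℕ} {p : ℝ≥0∞} {μ : Measure (Eucl d)} (u : X p μ) : Eucl d → ℝ := u.1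

/-- The map `u ↦ ([u], [∇u])` that sends a smooth function to the `μ`-classes of the function
and of its classical gradient. -/
def X.toPair {d : ℕ} {p : ℝ≥0∞} [Fact (1 ≤ p)] {μ : Measure (Eucl d)} :
    X p μ →ₗ[ℝ] SobPair p μ where
  toFun u := WithLp.toLp p (u.2.2.1.toLp u.1, u.2.2.2.toLp (∇ u.1))
  map_add' u v := by
    refine congrArg (WithLp.toLp p) (Prod.ext ?_ ?_)
    · exact MemLp.toLp_add u.2.2.1 v.2.2.1
    · refine (MemLp.toLp_congr (u + v).2.2.2 (u.2.2.2.add v.2.2.2) ?_).trans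
        (MemLp.toLp_add u.2.2.2 v.2.2.2)
      exact Eventually.of_forall (congrFun (gradient_add_of_smooth u.2.1 v.2.1))
  map_smul' c u := by
    refine congrArg (WithLp.toLp p) (Prod.ext ?_ ?_)
    · exact MemLp.toLp_const_smul c u.2.2.1
    · refine (MemLp.toLp_congr (c • u).2.2.2 (u.2.2.2.const_smul c) ?_).trans
        (MemLp.toLp_const_smul c u.2.2.2)
      exact Eventually.of_forall (congrFun (gradient_smul_of_smooth c u.2.1))

/-- The Sobolev pre-norm `‖u‖ = (‖u‖_{L^p(μ)}^p + ‖∇u‖_{L^p(μ; ℝ^d)}^p)^{1/p}` on `X`. -/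
instance {d : ℕ} (p : ℝ≥0∞) [Fact (1 ≤ p)] (μ : Measure (Eucl d)) :
    SeminormedAddCommGroup (X p μ) :=
  SeminormedAddCommGroup.induced (X p μ) (SobPair p μ) X.toPair

instance {d : ℕ} (p : ℝ≥0∞) [Fact (1 ≤ p)] (μ : Measure (Eucl d)) : NormedSpace ℝ (X p μ) :=
  NormedSpace.induced ℝ (X p μ) (SobPair p μ) X.toPair

/-- The space `H^{1,p}(μ)`: the abstract completion of `X` in the Sobolev pre-norm. -/
abbrev H1p {d : ℕ} (p : ℝ≥0∞) [Fact (1 ≤ p)] (μ : Measure (Eucl d)) : Type :=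
  UniformSpace.Completion (X p μ)

end WeightedSobolev

end

open WeightedSobolev

/-!
The inclusion of smooth functions in `V` and the closedness of `V` are soft: `(Diff)` gives
`φ^p = w ∈ W^{1,1}_loc` with `∇w = w β` (`IsWeight.isWeakGradient_weight`), which is the formula of
integration by parts for smooth functions, and every term of that formula is continuous for the
Sobolev norm because `η β ∈ L^q(μ)` for test functions `η`. As `X` embeds isometrically, everything
is reduced to the density of test functions in `V`; then the range of the extension to the
completion is a closed set between the closure of the test functions and `V`.

Density is proved by mollifying `f ∈ V`, although `μ` is not translation invariant. Multiplying by
`φ` turns `L^p(μ)` into the unweighted space `L^p(dx)`.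

* *Truncation.* Let `T` be a smooth bounded function. The chain rule suggests
  `∇(T(f) φ) = T'(f) φ ∇^μ f + T(f) ∇φ`, but `f` need not be locally integrable for Lebesgue
  measure, so it has no weak gradient there. What `f ∈ V` says is that the product `w f` is weakly
  differentiable, with gradient `w (∇^μ f + f β)`. Hence `f` is approximated by the quotients
  `w f / (w + δ)`, and `φ` by `w (w + δ)^{1/p - 1}`: the ordinary chain rule applies to the pair
  `(w f, w)`, and all terms are dominated as `δ → 0`
  (`HasWeakDeriv.trunc_div`, `IsWeight.isWeakGradient_trunc_mul_phi`). As truncations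
  and cutoffs converge in the Sobolev norm, `f` may be taken bounded with compact support.
* *Commutator estimate.* For such `f`, both `φ` and `f φ` are in `W^{1,p}` near the support of `f`,
  and `φ ∇(ρ_ε ⋆ f) - ρ_ε ⋆ ∇(f φ)` is the integral of `f(x - z) (φ(x) - φ(x - z)) ∇ρ_ε(z)` in `z`.
  Since `f` is bounded and the difference quotients of `φ` converge in `L^p`, this tends to
  `- f ∇φ`: subtracting `f(x) ⟨∇φ(x), z⟩ ∇ρ_ε(z)`, whose integral is `- f ∇φ`, leaves a remainder
  that the scaling-invariant bound on `∫ ‖∇ρ_ε(z)‖ ‖z‖ dz` makes small. Therefore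
  `φ ∇(ρ_ε ⋆ f) → ∇(f φ) - f ∇φ = φ ∇^μ f` in `L^p(dx)`, which is convergence of the gradients in
  `L^p(μ)` (`IsMollifier.eLpNorm_smul_gradient_mollify_sub_le`,
  `IsWeight.exists_test_approx_of_bounded`, `IsWeight.exists_test_approx`).

The argument is the same for all `1 ≤ p < ∞`. All estimates are quantitative: errors are bounded by
the moduli of continuity in `L^p` of translations, at the scale of the mollifier.
-/

noncomputable section

namespace WeightedSobolev

open scoped Convolution

/-! ### A weighted Minkowski inequality and translations in `L^p` -/

/-- A weighted Minkowski inequality: if `r` is bounded pointwise by the integral of `k(·, z)`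
against `a(z) dν(z)`, then its `L^p` norm is at most the total mass of `a dν` times the supremum
of the norms of the functions `k(·, z)`. -/
theorem eLpNorm_le_of_enorm_le_lintegral {α β F : Type*} [MeasurableSpace α] [MeasurableSpace β]
    [NormedAddCommGroup F] {μ : Measure α} {ν : Measure β} [SFinite μ] [SFinite ν] {p : ℝ≥0∞}
    (hp1 : 1 ≤ p) (hp : p ≠ ⊤) {a : β → ℝ≥0∞} (ha : Measurable a) (ha' : ∫⁻ z, a z ∂ν ≠ ⊤)
    {k : α → β → ℝ≥0∞} (hk : Measurable (Function.uncurry k)) {r : α → F}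
    (hr : ∀ᵐ x ∂μ, ‖r x‖ₑ ≤ ∫⁻ z, a z * k x z ∂ν) {S : ℝ≥0∞}
    (hS : ∀ᵐ z ∂ν, a z ≠ 0 → eLpNorm (fun x => k x z) p μ ≤ S) :
    eLpNorm r p μ ≤ (∫⁻ z, a z ∂ν) * S := by
  have hP1 : 1 ≤ p.toReal := by
    rw [← ENNReal.toReal_one]; exact ENNReal.toReal_mono hp hp1
  have hP0 : 0 < p.toReal := by linarith
  have hp0 : p ≠ 0 := (zero_lt_one.trans_le hp1).ne'
  set P := p.toReal with hPdef
  set A := ∫⁻ z, a z ∂ν with hA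
  have hS' : ∀ᵐ z ∂ν, a z * ∫⁻ x, k x z ^ P ∂μ ≤ a z * S ^ P := by
    filter_upwards [hS] with z hz'
    by_cases hz : a z = 0
    · simp [hz]
    · gcongr
      have := hz' hz
      rw [eLpNorm_eq_lintegral_rpow_enorm_toReal hp0 hp, one_div,
        ENNReal.rpow_inv_le_iff hP0] at this
      simpa using this
  rw [eLpNorm_eq_lintegral_rpow_enorm_toReal hp0 hp, one_div, ENNReal.rpow_inv_le_iff hP0,
    ← hPdef, ENNReal.mul_rpow_of_nonneg _ _ hP0.le]
  have key : ∀ x, (∫⁻ z, a z * k x z ∂ν) ^ P ≤ A ^ (P - 1) * ∫⁻ z, a z * k x z ^ P ∂ν := by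
    intro x
    have hkx : Measurable (k x) := hk.comp measurable_prodMk_left
    have h := eLpNorm'_le_eLpNorm'_mul_rpow_measure_univ (f := k x) (μ := ν.withDensity a)
      zero_lt_one hP1 hkx.aestronglyMeasurable
    simp only [eLpNorm', ENNReal.rpow_one, enorm_eq_self, one_div, div_one] at h
    rw [lintegral_withDensity_eq_lintegral_mul _ ha hkx,
      lintegral_withDensity_eq_lintegral_mul _ ha (hkx.pow_const P),
      withDensity_apply _ MeasurableSet.univ, setLIntegral_univ] at h
    calc (∫⁻ z, a z * k x z ∂ν) ^ P
        ≤ ((∫⁻ z, a z * k x z ^ P ∂ν) ^ P⁻¹ * A ^ (1 - P⁻¹)) ^ P := by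
          gcongr
          exact h
      _ = A ^ (P - 1) * ∫⁻ z, a z * k x z ^ P ∂ν := by
          rw [ENNReal.mul_rpow_of_nonneg _ _ hP0.le, ← ENNReal.rpow_mul, ← ENNReal.rpow_mul,
            inv_mul_cancel₀ hP0.ne', ENNReal.rpow_one, mul_comm, sub_mul, inv_mul_cancel₀ hP0.ne',
            one_mul]
  calc ∫⁻ x, ‖r x‖ₑ ^ P ∂μ ≤ ∫⁻ x, A ^ (P - 1) * ∫⁻ z, a z * k x z ^ P ∂ν ∂μ := by
        refine lintegral_mono_ae ?_
        filter_upwards [hr] with x hx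
        exact (ENNReal.rpow_le_rpow hx hP0.le).trans (key x)
    _ = A ^ (P - 1) * ∫⁻ x, ∫⁻ z, a z * k x z ^ P ∂ν ∂μ :=
        lintegral_const_mul' _ _ (ENNReal.rpow_ne_top_of_nonneg (by linarith) ha')
    _ = A ^ (P - 1) * ∫⁻ z, ∫⁻ x, a z * k x z ^ P ∂μ ∂ν := by
        rw [lintegral_lintegral_swap]
        exact ((ha.comp measurable_snd).mul (hk.pow_const P)).aemeasurable
    _ = A ^ (P - 1) * ∫⁻ z, a z * ∫⁻ x, k x z ^ P ∂μ ∂ν := by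
        congr 1
        refine lintegral_congr fun z => ?_
        exact lintegral_const_mul _ ((hk.comp measurable_prodMk_right).pow_const P)
    _ ≤ A ^ (P - 1) * ∫⁻ z, a z * S ^ P ∂ν := by
        gcongr _ * ?_
        exact lintegral_mono_ae hS'
    _ = A ^ (P - 1) * (A * S ^ P) := by rw [lintegral_mul_const _ ha]
    _ = A ^ P * S ^ P := by
        rcases eq_or_ne A 0 with h0 | h0
        · simp [h0, ENNReal.zero_rpow_of_pos hP0]
        · nth_rewrite 2 [← ENNReal.rpow_one A]
          rw [← mul_assoc, ← ENNReal.rpow_add _ _ h0 ha', sub_add_cancel]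

section Translation

variable {d : ℕ} {F : Type*} [NormedAddCommGroup F] {p : ℝ≥0∞}

/-- Translations act continuously on `L^p` for `p < ∞`. -/
theorem eventually_eLpNorm_translate_sub_le (hp1 : 1 ≤ p) (hp : p ≠ ⊤) {u : Eucl d → F}
    (hu : MemLp u p volume) {S : ℝ≥0∞} (hS : S ≠ 0) :
    ∀ᶠ z in 𝓝 (0 : Eucl d), eLpNorm (fun x => u (x - z) - u x) p volume ≤ S := by
  have : Fact (1 ≤ p) := ⟨hp1⟩
  have hmp : ∀ z : Eucl d, MeasurePreserving (fun x : Eucl d => x - z) volume volume :=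
    fun z => measurePreserving_sub_right volume z
  let g : Eucl d → C(Eucl d, Eucl d) := fun z => ⟨fun x => x - z, by fun_prop⟩
  have hg : Continuous g := by
    refine ContinuousMap.continuous_of_continuous_uncurry _ ?_
    change Continuous fun q : Eucl d × Eucl d => q.2 - q.1
    fun_prop
  have hcont : Continuous fun z => Lp.compMeasurePreserving (g z) (hmp z) (hu.toLp u) :=
    (continuous_const (y := hu.toLp u)).compMeasurePreservingLp hg hmp hp
  have h1 := hcont.tendsto 0
  rw [EMetric.tendsto_nhds] at h1
  filter_upwards [h1 S (pos_iff_ne_zero.2 hS)] with z hz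
  refine le_of_eq_of_le ?_ hz.le
  rw [Lp.toLp_compMeasurePreserving, Lp.toLp_compMeasurePreserving, Lp.edist_toLp_toLp]
  congr 1
  funext x
  simp [g]

theorem exists_forall_eLpNorm_translate_sub_le (hp1 : 1 ≤ p) (hp : p ≠ ⊤) {u : Eucl d → F}
    (hu : MemLp u p volume) {S : ℝ≥0∞} (hS : S ≠ 0) :
    ∃ δ : ℝ, 0 < δ ∧ ∀ z : Eucl d, ‖z‖ ≤ δ →
      eLpNorm (fun x => u (x - z) - u x) p volume ≤ S := by
  obtain ⟨δ, hδ, h⟩ := Metric.eventually_nhds_iff_ball.1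
    (eventually_eLpNorm_translate_sub_le hp1 hp hu hS)
  refine ⟨δ / 2, by positivity, fun z hz => h z ?_⟩
  rw [mem_ball_zero_iff]
  linarith

end Translation

/-! ### Mollifiers -/

/-- `ρ` is a mollifier of radius `ε`: a nonnegative smooth function of integral one that vanishes
outside the closed `ε`-ball. The constant `C` bounds the scaling-invariant quantity
`∫ ‖∇ρ(z)‖ ‖z‖ dz`. -/
structure IsMollifier {d : ℕ} (ε : ℝ) (C : ℝ≥0∞) (ρ : Eucl d → ℝ) : Prop where
  isTest : IsTest ρ
  nonneg : ∀ z, 0 ≤ ρ z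
  tsupport_subset : tsupport ρ ⊆ Metric.closedBall 0 ε
  integral_eq_one : ∫ z, ρ z = 1
  lintegral_fderiv_le : ∫⁻ z, ‖fderiv ℝ ρ z‖ₑ * ‖z‖ₑ ≤ C

/-- Rescalings of one bump function are mollifiers of all radii with a common constant `C`. -/
theorem exists_isMollifier (d : ℕ) :
    ∃ C : ℝ≥0∞, C ≠ ⊤ ∧ ∀ ε : ℝ, 0 < ε → ∃ ρ : Eucl d → ℝ, IsMollifier ε C ρ := by
  let b : ContDiffBump (0 : Eucl d) := ⟨1 / 2, 1, by norm_num, by norm_num⟩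
  let ρ : Eucl d → ℝ := b.normed volume
  have hρ : ContDiff ℝ ∞ ρ := b.contDiff_normed
  have hρc : HasCompactSupport ρ := b.hasCompactSupport_normed
  refine ⟨ENNReal.ofReal (∫ z, ‖fderiv ℝ ρ z‖ * ‖z‖), ENNReal.ofReal_ne_top, fun ε hε => ?_⟩
  have hd : 0 < ε ^ d := by positivity
  let σ : Eucl d → ℝ := fun z => (ε ^ d)⁻¹ * ρ (ε⁻¹ • z)
  have hσ : ContDiff ℝ ∞ σ := contDiff_const.mul (hρ.comp (contDiff_const_smul _))
  have hsupp : tsupport σ ⊆ Metric.closedBall 0 ε := by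
    refine closure_minimal (fun z hz => ?_) Metric.isClosed_closedBall
    have : ε⁻¹ • z ∈ Function.support ρ := by
      intro h0
      exact hz (by simp [σ, h0])
    rw [b.support_normed_eq, mem_ball_zero_iff, norm_smul, norm_inv,
      Real.norm_of_nonneg hε.le] at this
    rw [mem_closedBall_zero_iff]
    have h1 : ε⁻¹ * ‖z‖ < 1 := this
    rw [inv_mul_lt_iff₀ hε] at h1
    linarith
  have hσc : HasCompactSupport σ :=
    (isCompact_closedBall (0 : Eucl d) ε).of_isClosed_subset (isClosed_tsupport _) hsupp
  refine ⟨σ, ⟨hσ, hσc⟩, fun z => mul_nonneg (by positivity) (b.nonneg_normed _), hsupp, ?_, ?_⟩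
  · simp only [σ]
    rw [integral_const_mul, Measure.integral_comp_inv_smul, b.integral_normed]
    simp [abs_of_pos hd, hd.ne']
  · refine le_of_eq ?_
    have hfd : ∀ z, ‖fderiv ℝ σ z‖ * ‖z‖
        = (ε ^ d)⁻¹ * (fun y => ‖fderiv ℝ ρ y‖ * ‖y‖) (ε⁻¹ • z) := by
      intro z
      have h1 : fderiv ℝ σ z = (ε ^ d)⁻¹ • (ε⁻¹ • fderiv ℝ ρ (ε⁻¹ • z)) := by
        have h2 : DifferentiableAt ℝ (fun z => ρ (ε⁻¹ • z)) z :=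
          ((hρ.comp (contDiff_const_smul ε⁻¹)).differentiable (by simp)) z
        simp only [σ]
        rw [fderiv_const_mul h2, fderiv_comp_smul]
      rw [h1]
      simp only [norm_smul, norm_inv, norm_pow, Real.norm_of_nonneg hε.le]
      ring
    have hint : Integrable fun z => ‖fderiv ℝ σ z‖ * ‖z‖ := by
      refine Continuous.integrable_of_hasCompactSupport ?_ ?_
      · exact (hσ.continuous_fderiv (by simp)).norm.mul continuous_norm
      · exact (hσc.fderiv ℝ).norm.mul_right
    have h3 : ∫ z, ‖fderiv ℝ σ z‖ * ‖z‖ = ∫ z, ‖fderiv ℝ ρ z‖ * ‖z‖ := by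
      simp_rw [hfd]
      rw [integral_const_mul, Measure.integral_comp_inv_smul volume
        (fun y => ‖fderiv ℝ ρ y‖ * ‖y‖)]
      simp [abs_of_pos hd, hd.ne']
    rw [← h3, ofReal_integral_eq_lintegral_ofReal hint
      (Eventually.of_forall fun z => by positivity)]
    refine lintegral_congr fun z => ?_
    rw [ENNReal.ofReal_mul (norm_nonneg _), ofReal_norm, ofReal_norm]

theorem locallyIntegrable_comp_sub_left {d : ℕ} {F : Type*} [NormedAddCommGroup F]
    {u : Eucl d → F} (hu : LocallyIntegrable u volume)
    (x : Eucl d) : LocallyIntegrable (fun z => u (x - z)) volume := by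
  rw [locallyIntegrable_iff] at hu ⊢
  intro K hK
  have h := hu ((fun z => x - z) '' K) (hK.image (by fun_prop))
  have hmp : MeasurePreserving (fun z : Eucl d => x - z) volume volume :=
    Measure.measurePreserving_sub_left volume x
  have he : MeasurableEmbedding (fun z : Eucl d => x - z) :=
    (MeasurableEquiv.subLeft x).measurableEmbedding
  rw [hmp.integrableOn_image he] at h
  exact h

section Mollify

variable {d : ℕ} {F : Type*} [NormedAddCommGroup F] [NormedSpace ℝ F]

/-- The mollification `ρ ⋆ u`, that is `x ↦ ∫ ρ(z) u(x - z) dz`. -/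
abbrev mollify (ρ : Eucl d → ℝ) (u : Eucl d → F) : Eucl d → F :=
  ρ ⋆[ContinuousLinearMap.lsmul ℝ ℝ, volume] u

theorem mollify_apply (ρ : Eucl d → ℝ) (u : Eucl d → F) (x : Eucl d) :
    mollify ρ u x = ∫ z, ρ z • u (x - z) := rfl

theorem IsMollifier.lintegral_enorm {ε : ℝ} {C : ℝ≥0∞} {ρ : Eucl d → ℝ} (hρ : IsMollifier ε C ρ) :
    ∫⁻ z, ‖ρ z‖ₑ = 1 := by
  have hint : Integrable ρ := hρ.isTest.1.continuous.integrable_of_hasCompactSupport hρ.isTest.2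
  rw [← ENNReal.ofReal_one, ← hρ.integral_eq_one,
    ofReal_integral_eq_lintegral_ofReal hint (Eventually.of_forall hρ.nonneg)]
  refine lintegral_congr fun z => ?_
  rw [← ofReal_norm, Real.norm_of_nonneg (hρ.nonneg z)]

theorem IsMollifier.integrable_smul {ε : ℝ} {C : ℝ≥0∞} {ρ : Eucl d → ℝ} (hρ : IsMollifier ε C ρ)
    {u : Eucl d → F} (hu : LocallyIntegrable u volume) (x : Eucl d) :
    Integrable fun z => ρ z • u (x - z) :=
  (locallyIntegrable_comp_sub_left hu x).integrable_smul_left_of_hasCompactSupport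
    hρ.isTest.1.continuous hρ.isTest.2

theorem IsMollifier.norm_le {ε : ℝ} {C : ℝ≥0∞} {ρ : Eucl d → ℝ} (hρ : IsMollifier ε C ρ)
    {z : Eucl d} (hz : ρ z ≠ 0) : ‖z‖ ≤ ε :=
  mem_closedBall_zero_iff.1 (hρ.tsupport_subset (subset_tsupport _ hz))

variable [CompleteSpace F]

theorem IsMollifier.mollify_sub {ε : ℝ} {C : ℝ≥0∞} {ρ : Eucl d → ℝ} (hρ : IsMollifier ε C ρ)
    {u : Eucl d → F} (hu : LocallyIntegrable u volume) (x : Eucl d) :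
    mollify ρ u x - u x = ∫ z, ρ z • (u (x - z) - u x) := by
  have hint : Integrable ρ := hρ.isTest.1.continuous.integrable_of_hasCompactSupport hρ.isTest.2
  simp_rw [smul_sub]
  rw [integral_sub (hρ.integrable_smul hu x) (hint.smul_const _), integral_smul_const,
    hρ.integral_eq_one, one_smul, mollify_apply]

/-- Mollification by a mollifier of radius `ε` moves `u` in `L^p` by at most the modulus of
continuity of translations of `u` at scale `ε`. -/
theorem IsMollifier.eLpNorm_mollify_sub_le [MeasurableSpace F] [BorelSpace F]
    [SecondCountableTopology F] {p : ℝ≥0∞} (hp1 : 1 ≤ p) (hp : p ≠ ⊤) {ε : ℝ} {C : ℝ≥0∞}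
    {ρ : Eucl d → ℝ} (hρ : IsMollifier ε C ρ) {u : Eucl d → F} (hu : MemLp u p volume)
    (hum : Measurable u) {S : ℝ≥0∞}
    (hS : ∀ z : Eucl d, ‖z‖ ≤ ε → eLpNorm (fun x => u (x - z) - u x) p volume ≤ S) :
    eLpNorm (fun x => mollify ρ u x - u x) p volume ≤ S := by
  have hloc : LocallyIntegrable u volume := hu.locallyIntegrable hp1
  have h := eLpNorm_le_of_enorm_le_lintegral (μ := (volume : Measure (Eucl d)))
    (ν := (volume : Measure (Eucl d))) hp1 hp (a := fun z => ‖ρ z‖ₑ)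
    (k := fun x z => ‖u (x - z) - u x‖ₑ) (r := fun x => mollify ρ u x - u x) (S := S)
    (by have := hρ.isTest.1.continuous.measurable; fun_prop)
    (by rw [hρ.lintegral_enorm]; simp) (by simp only [Function.uncurry_def]; fun_prop)
    (Eventually.of_forall fun x => ?_) (Eventually.of_forall fun z hz => ?_)
  · rwa [hρ.lintegral_enorm, one_mul] at h
  · rw [hρ.mollify_sub hloc x]
    refine (enorm_integral_le_lintegral_enorm _).trans (le_of_eq ?_)
    simp_rw [enorm_smul]
  · rw [eLpNorm_enorm]
    exact hS z (hρ.norm_le (by simpa using hz))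

end Mollify

/-! ### Weak directional derivatives -/

section WeakDeriv

variable {d : ℕ} {E : Type*} [NormedAddCommGroup E] [NormedSpace ℝ E]

/-- `v` is the weak derivative of `u` in the direction `e`, with respect to Lebesgue measure. -/
def HasWeakDeriv (e : Eucl d) (u v : Eucl d → E) : Prop :=
  ∀ η : Eucl d → ℝ, IsTest η → ∫ x, η x • v x = - ∫ x, fderiv ℝ η x e • u x

theorem IsTest.continuous_fderiv_apply {η : Eucl d → ℝ} (hη : IsTest η) (e : Eucl d) :
    Continuous fun x => fderiv ℝ η x e :=
  (hη.1.continuous_fderiv (by simp)).clm_apply continuous_const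

theorem IsTest.hasCompactSupport_fderiv_apply {η : Eucl d → ℝ} (hη : IsTest η) (e : Eucl d) :
    HasCompactSupport fun x => fderiv ℝ η x e :=
  hη.2.fderiv_apply ℝ e

theorem IsTest.mul_left {η χ : Eucl d → ℝ} (hη : IsTest η) (hχ : ContDiff ℝ ∞ χ) :
    IsTest fun x => χ x * η x :=
  ⟨hχ.mul hη.1, hη.2.mul_left⟩

theorem IsTest.integrable_smul {η : Eucl d → ℝ} (hη : IsTest η) {u : Eucl d → E}
    (hu : LocallyIntegrable u volume) : Integrable fun x => η x • u x :=
  hu.integrable_smul_left_of_hasCompactSupport hη.1.continuous hη.2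

theorem IsTest.integrable_fderiv_smul {η : Eucl d → ℝ} (hη : IsTest η) (e : Eucl d)
    {u : Eucl d → E} (hu : LocallyIntegrable u volume) :
    Integrable fun x => fderiv ℝ η x e • u x :=
  hu.integrable_smul_left_of_hasCompactSupport (hη.continuous_fderiv_apply e)
    (hη.hasCompactSupport_fderiv_apply e)

theorem HasWeakDeriv.congr_ae {e : Eucl d} {u v u' v' : Eucl d → E} (h : HasWeakDeriv e u v)
    (hu : u =ᵐ[volume] u') (hv : v =ᵐ[volume] v') : HasWeakDeriv e u' v' := by
  intro η hη
  have h1 : ∫ x, η x • v' x = ∫ x, η x • v x :=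
    integral_congr_ae (hv.mono fun x hx => by simp only [hx])
  have h2 : ∫ x, fderiv ℝ η x e • u' x = ∫ x, fderiv ℝ η x e • u x :=
    integral_congr_ae (hu.mono fun x hx => by simp only [hx])
  rw [h1, h2, h η hη]

theorem HasWeakDeriv.smooth_smul {e : Eucl d} {u v : Eucl d → E} {χ : Eucl d → ℝ}
    (hχ : ContDiff ℝ ∞ χ) (hu : LocallyIntegrable u volume) (hv : LocallyIntegrable v volume)
    (h : HasWeakDeriv e u v) :
    HasWeakDeriv e (fun x => χ x • u x) (fun x => χ x • v x + fderiv ℝ χ x e • u x) := by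
  intro η hη
  have hχη := hη.mul_left hχ
  have h1 := h _ hχη
  have hχc : Continuous fun x => fderiv ℝ χ x e :=
    (hχ.continuous_fderiv (by simp)).clm_apply continuous_const
  have hfd : ∀ x, fderiv ℝ (fun x => χ x * η x) x e
      = χ x * fderiv ℝ η x e + η x * fderiv ℝ χ x e := by
    intro x
    rw [fderiv_fun_mul ((hχ.differentiable (by simp)) x) ((hη.1.differentiable (by simp)) x)]
    simp
  have i1 : Integrable fun x => (χ x * fderiv ℝ η x e) • u x :=
    hu.integrable_smul_left_of_hasCompactSupport
      (hχ.continuous.mul (hη.continuous_fderiv_apply e))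
      (hη.hasCompactSupport_fderiv_apply e).mul_left
  have i2 : Integrable fun x => (η x * fderiv ℝ χ x e) • u x :=
    hu.integrable_smul_left_of_hasCompactSupport (hη.1.continuous.mul hχc) hη.2.mul_right
  have i3 : Integrable fun x => (χ x * η x) • v x := hχη.integrable_smul hv
  calc ∫ x, η x • (χ x • v x + fderiv ℝ χ x e • u x)
      = ∫ x, ((χ x * η x) • v x + (η x * fderiv ℝ χ x e) • u x) := by
        refine integral_congr_ae (Eventually.of_forall fun x => ?_)
        simp only [smul_add, smul_smul, mul_comm (χ x)]
    _ = -∫ x, fderiv ℝ η x e • χ x • u x := by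
        rw [integral_add i3 i2, h1]
        simp_rw [hfd, add_smul]
        rw [integral_add i1 i2]
        simp_rw [smul_smul, mul_comm (fderiv ℝ η _ e)]
        abel

/-- Weak derivatives pass to dominated almost everywhere limits. -/
theorem HasWeakDeriv.of_tendsto {e : Eucl d} {u v : Eucl d → E} {un vn : ℕ → Eucl d → E}
    {U V : Eucl d → ℝ} (hU : LocallyIntegrable U volume) (hV : LocallyIntegrable V volume)
    (hum : ∀ n, AEStronglyMeasurable (un n) volume)
    (hvm : ∀ n, AEStronglyMeasurable (vn n) volume)
    (hub : ∀ n, ∀ᵐ x, ‖un n x‖ ≤ U x) (hvb : ∀ n, ∀ᵐ x, ‖vn n x‖ ≤ V x)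
    (hul : ∀ᵐ x, Tendsto (fun n => un n x) atTop (𝓝 (u x)))
    (hvl : ∀ᵐ x, Tendsto (fun n => vn n x) atTop (𝓝 (v x)))
    (h : ∀ n, HasWeakDeriv e (un n) (vn n)) : HasWeakDeriv e u v := by
  intro η hη
  have hηc := hη.continuous_fderiv_apply e
  have h1 : Tendsto (fun n => ∫ x, η x • vn n x) atTop (𝓝 (∫ x, η x • v x)) := by
    refine tendsto_integral_of_dominated_convergence (fun x => ‖η x • V x‖)
      (fun n => hη.1.continuous.aestronglyMeasurable.smul (hvm n))
      (hη.integrable_smul hV).norm (fun n => ?_) ?_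
    · filter_upwards [hvb n] with x hx
      rw [norm_smul, norm_smul]
      gcongr
      exact hx.trans (le_abs_self _)
    · filter_upwards [hvl] with x hx using hx.const_smul _
  have h2 : Tendsto (fun n => ∫ x, fderiv ℝ η x e • un n x) atTop
      (𝓝 (∫ x, fderiv ℝ η x e • u x)) := by
    refine tendsto_integral_of_dominated_convergence (fun x => ‖fderiv ℝ η x e • U x‖)
      (fun n => hηc.aestronglyMeasurable.smul (hum n))
      (hη.integrable_fderiv_smul e hU).norm (fun n => ?_) ?_
    · filter_upwards [hub n] with x hx
      rw [norm_smul, norm_smul]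
      gcongr
      exact hx.trans (le_abs_self _)
    · filter_upwards [hul] with x hx using hx.const_smul _
  refine tendsto_nhds_unique h1 ?_
  simp_rw [fun n => h n η hη]
  exact h2.neg

theorem IsTest.contDiff_mollify {ρ : Eucl d → ℝ} (hρ : IsTest ρ) {u : Eucl d → E}
    (hu : LocallyIntegrable u volume) : ContDiff ℝ ∞ (mollify ρ u) :=
  hρ.2.contDiff_convolution_left _ hρ.1 hu

theorem IsTest.fderiv_mollify_apply {ρ : Eucl d → ℝ} (hρ : IsTest ρ) {u : Eucl d → E}
    (hu : LocallyIntegrable u volume) (x e : Eucl d) :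
    fderiv ℝ (mollify ρ u) x e = ∫ z, fderiv ℝ ρ z e • u (x - z) := by
  have h1 := (hρ.2.hasFDerivAt_convolution_left (ContinuousLinearMap.lsmul ℝ ℝ)
    (hρ.1.of_le (by simp)) hu x).fderiv
  rw [h1, convolution_def]
  have hint := ((hρ.2.fderiv ℝ).convolutionExists_left
    ((ContinuousLinearMap.lsmul ℝ ℝ : ℝ →L[ℝ] E →L[ℝ] E).precompL (Eucl d))
    (hρ.1.continuous_fderiv (by simp)) hu x)
  rw [ContinuousLinearMap.integral_apply hint]
  rfl

/-- The derivative of a mollification is the mollification of the weak derivative. -/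
theorem HasWeakDeriv.fderiv_mollify {ρ : Eucl d → ℝ} (hρ : IsTest ρ) {e : Eucl d}
    {u v : Eucl d → E} (hu : LocallyIntegrable u volume) (h : HasWeakDeriv e u v) (x : Eucl d) :
    fderiv ℝ (mollify ρ u) x e = mollify ρ v x := by
  rw [hρ.fderiv_mollify_apply hu, mollify_apply,
    ← integral_sub_left_eq_self (fun z => fderiv ℝ ρ z e • u (x - z)) volume x,
    ← integral_sub_left_eq_self (fun z => ρ z • v (x - z)) volume x]
  simp only [sub_sub_cancel]
  have htest : IsTest fun y => ρ (x - y) := by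
    refine ⟨hρ.1.comp (contDiff_const.sub contDiff_id), ?_⟩
    exact hρ.2.comp_homeomorph (Homeomorph.subLeft x)
  have hfd : ∀ y, fderiv ℝ (fun y => ρ (x - y)) y e = - fderiv ℝ ρ (x - y) e := by
    intro y
    have h1 : HasFDerivAt ρ (fderiv ℝ ρ (x - y)) (x - y) :=
      ((hρ.1.differentiable (by simp)) _).hasFDerivAt
    have h2 : HasFDerivAt (fun y => x - y) (-ContinuousLinearMap.id ℝ (Eucl d)) y :=
      (hasFDerivAt_id y).const_sub x
    have h3 := (h1.comp y h2).fderiv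
    change fderiv ℝ (ρ ∘ fun y => x - y) y e = _
    rw [h3]
    simp
  rw [h _ htest]
  simp_rw [hfd, neg_smul]
  rw [integral_neg, neg_neg]

end WeakDeriv

/-! ### The chain rule for weak derivatives -/

theorem tendsto_integral_norm_sub_of_eLpNorm {d : ℕ} {E : Type*} [NormedAddCommGroup E]
    {un : ℕ → Eucl d → E} {u : Eucl d → E}
    (hun : ∀ n, Integrable (un n)) (hu : Integrable u)
    (h : Tendsto (fun n => eLpNorm (un n - u) 1 volume) atTop (𝓝 0)) :
    Tendsto (fun n => ∫ x, ‖un n x - u x‖) atTop (𝓝 0) := by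
  have h1 := (ENNReal.tendsto_toReal ENNReal.zero_ne_top).comp h
  rw [ENNReal.toReal_zero] at h1
  refine h1.congr fun n => ?_
  rw [Function.comp_apply, eLpNorm_one_eq_lintegral_enorm]
  exact (integral_norm_eq_lintegral_enorm ((hun n).sub hu).aestronglyMeasurable).symm

section Chain

variable {d : ℕ} {E : Type*} [NormedAddCommGroup E] [NormedSpace ℝ E] [CompleteSpace E]

/-- Mollification is averaging, so it preserves closed convex constraints. -/
theorem IsMollifier.mollify_mem {ε : ℝ} {C : ℝ≥0∞} {ρ : Eucl d → ℝ} (hρ : IsMollifier ε C ρ)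
    {s : Set E} (hs : Convex ℝ s) (hsc : IsClosed s) {u : Eucl d → E}
    (hu : LocallyIntegrable u volume) (hus : ∀ᵐ x, u x ∈ s) (x : Eucl d) :
    mollify ρ u x ∈ s := by
  have hm : Measurable fun z => ENNReal.ofReal (ρ z) :=
    hρ.isTest.1.continuous.measurable.ennreal_ofReal
  have hint : Integrable ρ := hρ.isTest.1.continuous.integrable_of_hasCompactSupport hρ.isTest.2
  have hprob : IsProbabilityMeasure
      ((volume : Measure (Eucl d)).withDensity fun z => ENNReal.ofReal (ρ z)) := by
    refine ⟨?_⟩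
    rw [withDensity_apply _ MeasurableSet.univ, setLIntegral_univ,
      ← ofReal_integral_eq_lintegral_ofReal hint (Eventually.of_forall hρ.nonneg),
      hρ.integral_eq_one, ENNReal.ofReal_one]
  have hus' : ∀ᵐ z, u (x - z) ∈ s :=
    (Measure.measurePreserving_sub_left volume x).quasiMeasurePreserving.ae hus
  have h1 := hs.integral_mem (μ := (volume : Measure (Eucl d)).withDensity
    fun z => ENNReal.ofReal (ρ z)) hsc (f := fun z => u (x - z))
    ((withDensity_absolutelyContinuous _ _).ae_le hus') ?_
  · rw [integral_withDensity_eq_integral_toReal_smul hm (by simp)] at h1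
    rw [mollify_apply]
    simpa only [ENNReal.toReal_ofReal (hρ.nonneg _)] using h1
  · rw [integrable_withDensity_iff_integrable_smul' hm (by simp)]
    simpa only [ENNReal.toReal_ofReal (hρ.nonneg _)] using hρ.integrable_smul hu x

variable [MeasurableSpace E] [BorelSpace E] [SecondCountableTopology E]

/-- One sequence of mollifiers that works for two integrable functions at once. -/
theorem exists_mollifier_seq {u v : Eucl d → E} (hu : Integrable u) (hv : Integrable v)
    (hum : Measurable u) (hvm : Measurable v) :
    ∃ (ε : ℕ → ℝ) (C : ℝ≥0∞) (ρ : ℕ → Eucl d → ℝ), (∀ n, IsMollifier (ε n) C (ρ n)) ∧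
      Tendsto (fun n => eLpNorm (mollify (ρ n) u - u) 1 volume) atTop (𝓝 0) ∧
      Tendsto (fun n => eLpNorm (mollify (ρ n) v - v) 1 volume) atTop (𝓝 0) := by
  obtain ⟨C, -, hC⟩ := exists_isMollifier d
  have hS : ∀ n : ℕ, ((n : ℝ≥0∞) + 1)⁻¹ ≠ 0 := by
    intro n
    simp
  have hu1 := memLp_one_iff_integrable.2 hu
  have hv1 := memLp_one_iff_integrable.2 hv
  choose δ hδ hδu using fun n => exists_forall_eLpNorm_translate_sub_le le_rfl (by simp) hu1 (hS n)
  choose δ' hδ' hδv using fun n =>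
    exists_forall_eLpNorm_translate_sub_le le_rfl (by simp) hv1 (hS n)
  choose ρ hρ using fun n => hC (min (δ n) (δ' n)) (lt_min (hδ n) (hδ' n))
  have hlim : Tendsto (fun n : ℕ => ((n : ℝ≥0∞) + 1)⁻¹) atTop (𝓝 0) := by
    have := ENNReal.tendsto_inv_nat_nhds_zero.comp (tendsto_add_atTop_nat 1)
    refine this.congr fun n => ?_
    simp
  refine ⟨_, C, ρ, hρ, ?_, ?_⟩
  · refine tendsto_of_tendsto_of_tendsto_of_le_of_le tendsto_const_nhds hlim (fun n => zero_le)
      fun n => ?_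
    exact (hρ n).eLpNorm_mollify_sub_le le_rfl (by simp) hu1 hum
      fun z hz => hδu n z (hz.trans (min_le_left _ _))
  · refine tendsto_of_tendsto_of_tendsto_of_le_of_le tendsto_const_nhds hlim (fun n => zero_le)
      fun n => ?_
    exact (hρ n).eLpNorm_mollify_sub_le le_rfl (by simp) hv1 hvm
      fun z hz => hδv n z (hz.trans (min_le_right _ _))

/-- The chain rule for integrable functions: pass to the limit in the classical chain rule for the
mollifications of `u`. -/
theorem HasWeakDeriv.comp_of_integrable {s : Set E} (hs : Convex ℝ s) (hsc : IsClosed s)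
    {H : E → ℝ} {H' : E → E →L[ℝ] ℝ} (hH : ∀ y ∈ s, HasFDerivAt H (H' y) y)
    (hH'c : ContinuousOn H' s) {B : ℝ} (hB : ∀ y ∈ s, ‖H' y‖ ≤ B) {e : Eucl d}
    {u v : Eucl d → E} (hu : Integrable u) (hv : Integrable v) (hum : Measurable u)
    (hvm : Measurable v) (hus : ∀ x, u x ∈ s) (h0 : (0 : E) ∈ s)
    (h : HasWeakDeriv e u v) :
    HasWeakDeriv e (fun x => H (u x)) (fun x => H' (u x) (v x)) := by
  intro η hη
  have hB0 : 0 ≤ B := (norm_nonneg _).trans (hB _ (hus 0))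
  obtain ⟨ε, C, ρ', hρ', hu', hv'⟩ := exists_mollifier_seq hu hv hum hvm
  obtain ⟨φ, hφ, hae⟩ := (tendstoInMeasure_of_tendsto_eLpNorm one_ne_zero
    (fun n => ((hρ' n).isTest.contDiff_mollify
      hu.locallyIntegrable).continuous.aestronglyMeasurable)
    hum.aestronglyMeasurable hu').exists_seq_tendsto_ae
  set ρ := fun n => ρ' (φ n) with hρdef
  have hρ : ∀ n, IsMollifier (ε (φ n)) C (ρ n) := fun n => hρ' (φ n)
  replace hu' := hu'.comp hφ.tendsto_atTop
  replace hv' := hv'.comp hφ.tendsto_atTop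
  set un := fun n => mollify (ρ n) u with hun
  set vn := fun n => mollify (ρ n) v with hvn
  have huc : ∀ n, ContDiff ℝ ∞ (un n) := fun n =>
    (hρ n).isTest.contDiff_mollify hu.locallyIntegrable
  have hvc : ∀ n, ContDiff ℝ ∞ (vn n) := fun n =>
    (hρ n).isTest.contDiff_mollify hv.locallyIntegrable
  have huns : ∀ n x, un n x ∈ s := fun n x =>
    (hρ n).mollify_mem hs hsc hu.locallyIntegrable (Eventually.of_forall hus) x
  have hHc : ContinuousOn H s := fun y hy => (hH y hy).continuousAt.continuousWithinAt
  have hHu : ∀ n, Continuous fun x => H (un n x) := fun n =>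
    hHc.comp_continuous (huc n).continuous (huns n)
  have hH'u : ∀ n, Continuous fun x => H' (un n x) := fun n =>
    hH'c.comp_continuous (huc n).continuous (huns n)
  have hηe := hη.continuous_fderiv_apply e
  have hηe' := hη.hasCompactSupport_fderiv_apply e
  -- classical integration by parts for the mollified functions
  have hparts : ∀ n, ∫ x, η x • H' (un n x) (vn n x) = - ∫ x, fderiv ℝ η x e • H (un n x) := by
    intro n
    have hd : ∀ x, HasFDerivAt (fun x => H (un n x)) ((H' (un n x)).comp (fderiv ℝ (un n) x)) x :=
      fun x => (hH _ (huns n x)).comp x (((huc n).differentiable (by simp)) x).hasFDerivAt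
    have he : ∀ x, fderiv ℝ (un n) x e = vn n x := fun x =>
      h.fderiv_mollify (hρ n).isTest hu.locallyIntegrable x
    have := integral_bilinear_hasFDerivAt_right_eq_neg_left_of_integrable
      (μ := (volume : Measure (Eucl d))) (v := e) (B := ContinuousLinearMap.lsmul ℝ ℝ)
      (f := η) (f' := fderiv ℝ η) (g := fun x => H (un n x))
      (g' := fun x => (H' (un n x)).comp (fderiv ℝ (un n) x)) ?_ ?_ ?_
      (fun x _ => ((hη.1.differentiable (by simp)) x).hasFDerivAt) (fun x _ => hd x)
    · simpa [he] using this
    · exact (hηe.smul (hHu n)).integrable_of_hasCompactSupport hηe'.smul_right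
    · simp only [ContinuousLinearMap.lsmul_apply, ContinuousLinearMap.comp_apply, he]
      exact (hη.1.continuous.smul ((hH'u n).clm_apply
        (hvc n).continuous)).integrable_of_hasCompactSupport hη.2.smul_right
    · exact (hη.1.continuous.smul (hHu n)).integrable_of_hasCompactSupport hη.2.smul_right
  obtain ⟨M, hM⟩ := hη.1.continuous.bounded_above_of_compact_support hη.2
  obtain ⟨M', hM'⟩ := hηe.bounded_above_of_compact_support hηe'
  have hM0 : 0 ≤ M := (norm_nonneg _).trans (hM 0)
  have hM0' : 0 ≤ M' := (norm_nonneg _).trans (hM' 0)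
  have hLip : ∀ y ∈ s, ∀ y' ∈ s, ‖H y' - H y‖ ≤ B * ‖y' - y‖ := fun y hy y' hy' =>
    hs.norm_image_sub_le_of_norm_hasFDerivWithin_le
      (fun z hz => (hH z hz).hasFDerivWithinAt) hB hy hy'
  have huni : ∀ n, Integrable (un n) := fun n =>
    ((hρ n).isTest.1.continuous.integrable_of_hasCompactSupport
      (hρ n).isTest.2).integrable_convolution _ hu
  have hvni : ∀ n, Integrable (vn n) := fun n =>
    ((hρ n).isTest.1.continuous.integrable_of_hasCompactSupport
      (hρ n).isTest.2).integrable_convolution _ hv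
  have hu1 := tendsto_integral_norm_sub_of_eLpNorm huni hu hu'
  have hv1 := tendsto_integral_norm_sub_of_eLpNorm hvni hv hv'
  have hHm : AEStronglyMeasurable (fun x => H (u x)) volume := by
    refine aestronglyMeasurable_of_tendsto_ae atTop (fun n => (hHu n).aestronglyMeasurable) ?_
    filter_upwards [hae] with x hx
    exact ((hH _ (hus x)).continuousAt.tendsto).comp hx
  have hlimG : ∀ᵐ x, Tendsto (fun n => H' (un n x) (v x)) atTop (𝓝 (H' (u x) (v x))) := by
    filter_upwards [hae] with x hx
    have h1 : Tendsto (fun n => un n x) atTop (𝓝[s] (u x)) :=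
      tendsto_nhdsWithin_iff.2 ⟨hx, Eventually.of_forall fun n => huns n x⟩
    exact ((ContinuousLinearMap.apply ℝ ℝ (v x)).continuous.tendsto _).comp
      ((hH'c _ (hus x)).tendsto.comp h1)
  have hGm : ∀ n, AEStronglyMeasurable (fun x => H' (un n x) (v x)) volume := fun n =>
    (ContinuousLinearMap.id ℝ (E →L[ℝ] ℝ)).aestronglyMeasurable_comp₂
      (hH'u n).aestronglyMeasurable hvm.aestronglyMeasurable
  have hG : ∀ y ∈ s, ∀ x, ∀ a : E, ‖η x • H' y a‖ ≤ M * B * ‖a‖ := by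
    intro y hy x a
    rw [norm_smul, mul_assoc]
    exact mul_le_mul (hM x) ((H' y).le_of_opNorm_le (hB _ hy) _) (norm_nonneg _) hM0
  have hGi : ∀ n, Integrable fun x => η x • H' (un n x) (v x) := fun n =>
    Integrable.mono' (hv.norm.const_mul (M * B))
      (hη.1.continuous.aestronglyMeasurable.smul (hGm n))
      (Eventually.of_forall fun x => hG _ (huns n x) x _)
  have hGi' : ∀ n, Integrable fun x => η x • H' (un n x) (vn n x) := fun n =>
    (hη.1.continuous.smul ((hH'u n).clm_apply
        (hvc n).continuous)).integrable_of_hasCompactSupport hη.2.smul_right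
  have hleft : Tendsto (fun n => ∫ x, η x • H' (un n x) (vn n x)) atTop
      (𝓝 (∫ x, η x • H' (u x) (v x))) := by
    have h1 : Tendsto (fun n => ∫ x, η x • H' (un n x) (v x)) atTop
        (𝓝 (∫ x, η x • H' (u x) (v x))) := by
      refine tendsto_integral_of_dominated_convergence (fun x => M * B * ‖v x‖)
        (fun n => (hGi n).aestronglyMeasurable) (hv.norm.const_mul _)
        (fun n => Eventually.of_forall fun x => hG _ (huns n x) x _) ?_
      filter_upwards [hlimG] with x hx using hx.const_smul _
    have h2 : Tendsto (fun n => (∫ x, η x • H' (un n x) (vn n x)) - ∫ x, η x • H' (un n x) (v x))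
        atTop (𝓝 0) := by
      refine squeeze_zero_norm (a := fun n => M * B * ∫ x, ‖vn n x - v x‖) (fun n => ?_) ?_
      · rw [← integral_sub (hGi' n) (hGi n), ← integral_const_mul]
        refine norm_integral_le_of_norm_le (((hvni n).sub hv).norm.const_mul _)
          (Eventually.of_forall fun x => ?_)
        rw [← smul_sub, ← map_sub]
        exact hG _ (huns n x) x _
      · simpa using hv1.const_mul (M * B)
    simpa using h2.add h1
  have hHb : ∀ x, ‖H (u x)‖ ≤ ‖H 0‖ + B * ‖u x‖ := fun x => by
    have h1 := hLip 0 h0 (u x) (hus x)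
    rw [sub_zero] at h1
    linarith [norm_le_norm_add_norm_sub' (H (u x)) (H 0)]
  have hHi : Integrable fun x => fderiv ℝ η x e • H (u x) := by
    have i1 : Integrable fun x => fderiv ℝ η x e * ‖H 0‖ :=
      (hηe.integrable_of_hasCompactSupport hηe').mul_const _
    refine Integrable.mono' (i1.norm.add (hu.norm.const_mul (M' * B)))
      (hηe.aestronglyMeasurable.smul hHm) (Eventually.of_forall fun x => ?_)
    rw [norm_smul, Pi.add_apply, norm_mul, norm_norm]
    calc ‖fderiv ℝ η x e‖ * ‖H (u x)‖ ≤ ‖fderiv ℝ η x e‖ * (‖H 0‖ + B * ‖u x‖) := by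
          gcongr; exact hHb x
      _ = ‖fderiv ℝ η x e‖ * ‖H 0‖ + ‖fderiv ℝ η x e‖ * (B * ‖u x‖) := by ring
      _ ≤ ‖fderiv ℝ η x e‖ * ‖H 0‖ + M' * (B * ‖u x‖) := by gcongr; exact hM' x
      _ = _ := by ring
  have hHi' : ∀ n, Integrable fun x => fderiv ℝ η x e • H (un n x) := fun n =>
    (hηe.smul (hHu n)).integrable_of_hasCompactSupport hηe'.smul_right
  have hright : Tendsto (fun n => ∫ x, fderiv ℝ η x e • H (un n x)) atTop
      (𝓝 (∫ x, fderiv ℝ η x e • H (u x))) := by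
    rw [tendsto_iff_norm_sub_tendsto_zero]
    refine squeeze_zero (fun n => norm_nonneg _)
      (g := fun n => M' * B * ∫ x, ‖un n x - u x‖) (fun n => ?_) ?_
    · rw [← integral_sub (hHi' n) hHi, ← integral_const_mul]
      refine norm_integral_le_of_norm_le (((huni n).sub hu).norm.const_mul _)
        (Eventually.of_forall fun x => ?_)
      rw [← smul_sub, norm_smul, mul_assoc]
      exact mul_le_mul (hM' x) (hLip _ (hus x) _ (huns n x)) (norm_nonneg _) hM0'
    · simpa using hu1.const_mul (M' * B)
  refine tendsto_nhds_unique hleft ?_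
  simp_rw [hparts]
  exact hright.neg

/-- A smooth compactly supported function with values in `[0, 1]` that is one on a given ball. -/
theorem exists_cutoff (d : ℕ) {R : ℝ} (hR : 0 < R) :
    ∃ χ : Eucl d → ℝ, IsTest χ ∧ (∀ x, 0 ≤ χ x) ∧ (∀ x, χ x ≤ 1) ∧
      (∀ x ∈ Metric.ball (0 : Eucl d) R, χ x = 1) ∧
      (∀ x ∈ Metric.ball (0 : Eucl d) R, fderiv ℝ χ x = 0) := by
  let b : ContDiffBump (0 : Eucl d) := ⟨R, R + 1, hR, by linarith⟩
  have h1 : ∀ x ∈ Metric.ball (0 : Eucl d) R, b x = 1 := fun x hx =>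
    b.one_of_mem_closedBall (Metric.ball_subset_closedBall hx)
  refine ⟨b, ⟨b.contDiff, b.hasCompactSupport⟩, fun x => b.nonneg, fun x => b.le_one, h1,
    fun x hx => ?_⟩
  have h2 : (b : Eucl d → ℝ) =ᶠ[𝓝 x] fun _ => 1 := by
    filter_upwards [Metric.isOpen_ball.mem_nhds hx] with y hy using h1 y hy
  rw [h2.fderiv_eq]
  simp

/-- **Chain rule** for weak derivatives: `H` is differentiable at the points of a closed convex set
that contains the values of `u`, with a bounded and continuous derivative there. -/
theorem HasWeakDeriv.comp {s : Set E} (hs : Convex ℝ s) (hsc : IsClosed s) (h0 : (0 : E) ∈ s)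
    {H : E → ℝ} {H' : E → E →L[ℝ] ℝ} (hH : ∀ y ∈ s, HasFDerivAt H (H' y) y)
    (hH'c : ContinuousOn H' s) {B : ℝ} (hB : ∀ y ∈ s, ‖H' y‖ ≤ B) {e : Eucl d}
    {u v : Eucl d → E} (hu : LocallyIntegrable u volume) (hv : LocallyIntegrable v volume)
    (hum : Measurable u) (hvm : Measurable v) (hus : ∀ x, u x ∈ s) (h : HasWeakDeriv e u v) :
    HasWeakDeriv e (fun x => H (u x)) (fun x => H' (u x) (v x)) := by
  intro η hη
  obtain ⟨R, hR, hηR⟩ : ∃ R : ℝ, 0 < R ∧ tsupport η ⊆ Metric.ball 0 R := by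
    obtain ⟨R, hR, h⟩ := hη.2.isCompact.isBounded.subset_ball_lt 0 0
    exact ⟨R, hR, h⟩
  obtain ⟨χ, hχ, hχ0, hχ1, hχR, hχR'⟩ := exists_cutoff d hR
  have hχe := hχ.continuous_fderiv_apply e
  have h1 := (h.smooth_smul hχ.1 hu hv).comp_of_integrable hs hsc hH hH'c hB
    (hχ.integrable_smul hu) ((hχ.integrable_smul hv).add (hχ.integrable_fderiv_smul e hu))
    (hχ.1.continuous.measurable.smul hum)
    ((hχ.1.continuous.measurable.smul hvm).add (hχe.measurable.smul hum))
    (fun x => hs.smul_mem_of_zero_mem h0 (hus x) ⟨hχ0 x, hχ1 x⟩) h0 η hη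
  have e1 : ∀ x, η x • H' (χ x • u x) (χ x • v x + fderiv ℝ χ x e • u x)
      = η x • H' (u x) (v x) := by
    intro x
    by_cases hx : x ∈ tsupport η
    · simp [hχR x (hηR hx), hχR' x (hηR hx)]
    · simp [image_eq_zero_of_notMem_tsupport hx]
  have e2 : ∀ x, fderiv ℝ η x e • H (χ x • u x) = fderiv ℝ η x e • H (u x) := by
    intro x
    by_cases hx : x ∈ tsupport η
    · simp [hχR x (hηR hx)]
    · have : fderiv ℝ η x = 0 := by
        by_contra hne
        exact hx (support_fderiv_subset ℝ hne)
      simp [this]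
  simpa only [Pi.add_apply, e1, e2] using h1

end Chain

/-! ### Difference quotients of Sobolev functions and the commutator estimate -/

section Commutator

variable {d : ℕ}

theorem isWeakGradient_iff {f : Eucl d → ℝ} {g : Eucl d → Eucl d} :
    IsWeakGradient f g ↔
      ∀ i, HasWeakDeriv (EuclideanSpace.single i (1 : ℝ)) f (fun x => g x i) := by
  simp only [IsWeakGradient, HasWeakDeriv, partialD, smul_eq_mul, mul_comm]

theorem gradient_apply (u : Eucl d → ℝ) (x : Eucl d) (i : Fin d) :
    ∇ u x i = fderiv ℝ u x (EuclideanSpace.single i 1) := by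
  have h : inner ℝ (∇ u x) (EuclideanSpace.single i (1 : ℝ)) =
      fderiv ℝ u x (EuclideanSpace.single i 1) := by
    simp [gradient]
  rw [← h, EuclideanSpace.inner_single_right]
  simp

theorem enorm_gradient (u : Eucl d → ℝ) (x : Eucl d) : ‖∇ u x‖ₑ = ‖fderiv ℝ u x‖ₑ := by
  rw [← ofReal_norm, ← ofReal_norm]
  simp [gradient]

theorem integral_apply {X : Type*} [MeasurableSpace X] {μ : Measure X} {F : X → Eucl d}
    (hF : Integrable F μ) (i : Fin d) : (∫ x, F x ∂μ) i = ∫ x, F x i ∂μ :=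
  ((EuclideanSpace.proj i : Eucl d →L[ℝ] ℝ).integral_comp_comm hF).symm

theorem locallyIntegrable_apply {ν : Measure (Eucl d)} {G : Eucl d → Eucl d}
    (hG : LocallyIntegrable G ν) (i : Fin d) : LocallyIntegrable (fun x => G x i) ν := by
  intro x
  obtain ⟨s, hs, h⟩ := hG x
  exact ⟨s, hs, (EuclideanSpace.proj i : Eucl d →L[ℝ] ℝ).integrable_comp h⟩

theorem IsTest.continuous_gradient {ρ : Eucl d → ℝ} (hρ : IsTest ρ) : Continuous (∇ ρ) :=
  (InnerProductSpace.toDual ℝ (Eucl d)).symm.continuous.comp (hρ.1.continuous_fderiv (by simp))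

theorem IsTest.hasCompactSupport_gradient {ρ : Eucl d → ℝ} (hρ : IsTest ρ) :
    HasCompactSupport (∇ ρ) :=
  (hρ.2.fderiv ℝ).comp_left (g := (InnerProductSpace.toDual ℝ (Eucl d)).symm) (by simp)

theorem IsTest.integrable_smul_gradient {ρ : Eucl d → ℝ} (hρ : IsTest ρ) {u : Eucl d → ℝ}
    (hu : LocallyIntegrable u volume) : Integrable fun z => u z • ∇ ρ z :=
  hu.integrable_smul_right_of_hasCompactSupport hρ.continuous_gradient
    hρ.hasCompactSupport_gradient

theorem IsTest.gradient_mollify_eq_integral {ρ : Eucl d → ℝ} (hρ : IsTest ρ) {u : Eucl d → ℝ}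
    (hu : LocallyIntegrable u volume) (x : Eucl d) :
    ∇ (mollify ρ u) x = ∫ z, u (x - z) • ∇ ρ z := by
  ext i
  rw [gradient_apply, hρ.fderiv_mollify_apply hu,
    integral_apply (hρ.integrable_smul_gradient (locallyIntegrable_comp_sub_left hu x))]
  refine integral_congr_ae (Eventually.of_forall fun z => ?_)
  simp [gradient_apply, mul_comm]

theorem IsWeakGradient.gradient_mollify {ρ : Eucl d → ℝ} (hρ : IsTest ρ) {u : Eucl d → ℝ}
    {G : Eucl d → Eucl d} (h : IsWeakGradient u G) (hu : LocallyIntegrable u volume)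
    (hG : LocallyIntegrable G volume) (x : Eucl d) :
    ∇ (mollify ρ u) x = mollify ρ G x := by
  ext i
  rw [gradient_apply, (isWeakGradient_iff.1 h i).fderiv_mollify hρ hu, mollify_apply,
    mollify_apply, integral_apply]
  · rfl
  · exact hρ.integrable_smul (locallyIntegrable_comp_sub_left hG x)

/-- Integration by parts: the first moments of `∇ρ`. -/
theorem IsTest.integral_inner_smul_gradient {ρ : Eucl d → ℝ} (hρ : IsTest ρ) (a : Eucl d) :
    ∫ z, inner ℝ a z • ∇ ρ z = -((∫ z, ρ z) • a) := by
  have hc : Continuous fun z : Eucl d => inner ℝ a z := by fun_prop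
  have hd : ∀ z, HasFDerivAt (fun z : Eucl d => inner ℝ a z) (innerSL ℝ a) z := fun z =>
    (innerSL ℝ a).hasFDerivAt
  ext i
  rw [integral_apply (hρ.integrable_smul_gradient hc.locallyIntegrable)]
  have h := integral_mul_fderiv_eq_neg_fderiv_mul_of_integrable
    (μ := (volume : Measure (Eucl d))) (f := fun z : Eucl d => inner ℝ a z) (g := ρ)
    (v := EuclideanSpace.single i (1 : ℝ)) ?_ ?_ ?_
    (fun z _ => (hd z).differentiableAt) (fun z _ => (hρ.1.differentiable (by simp)) z)
  · simp only [PiLp.smul_apply, gradient_apply, smul_eq_mul, PiLp.neg_apply]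
    rw [h]
    have h2 : ∀ z, fderiv ℝ (fun z : Eucl d => inner ℝ a z) z (EuclideanSpace.single i 1)
        = a i := by
      intro z
      rw [(hd z).fderiv, innerSL_apply_apply, EuclideanSpace.inner_single_right]
      simp
    simp_rw [h2]
    rw [integral_const_mul, mul_comm]
  · refine Continuous.integrable_of_hasCompactSupport ?_ hρ.2.mul_left
    simp_rw [fun z => (hd z).fderiv]
    exact continuous_const.mul hρ.1.continuous
  · exact (hc.mul (hρ.continuous_fderiv_apply _)).integrable_of_hasCompactSupport
      (hρ.hasCompactSupport_fderiv_apply _).mul_left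
  · exact (hc.mul hρ.1.continuous).integrable_of_hasCompactSupport hρ.2.mul_left

variable {p : ℝ≥0∞}

theorem eLpNorm_comp_sub {F : Type*} [NormedAddCommGroup F] {u : Eucl d → F}
    (hu : AEStronglyMeasurable u volume) (z : Eucl d) :
    eLpNorm (fun x => u (x - z)) p volume = eLpNorm u p volume :=
  eLpNorm_comp_measurePreserving hu (measurePreserving_sub_right volume z)

theorem enorm_real_inner_le (a b : Eucl d) : ‖(inner ℝ a b : ℝ)‖ₑ ≤ ‖a‖ₑ * ‖b‖ₑ := by
  rw [← ofReal_norm, ← ofReal_norm, ← ofReal_norm, ← ENNReal.ofReal_mul (norm_nonneg _)]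
  exact ENNReal.ofReal_le_ofReal (norm_inner_le_norm _ _)

theorem eLpNorm_inner_le (G : Eucl d → Eucl d) (h : Eucl d) :
    eLpNorm (fun x => inner ℝ (G x) h) p volume ≤ ‖h‖ₑ * eLpNorm G p volume := by
  have h1 : eLpNorm (fun x => inner ℝ (G x) h) p volume ≤ eLpNorm (fun x => ‖h‖ • G x) p volume :=
    eLpNorm_mono fun x => by
      rw [norm_smul, norm_norm, mul_comm]
      exact norm_inner_le_norm _ _
  refine h1.trans_eq ?_
  rw [show (fun x => ‖h‖ • G x) = ‖h‖ • G from rfl, eLpNorm_const_smul, enorm_norm]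

/-- The first order Taylor formula in `L^p`, with integral remainder. -/
theorem eLpNorm_sub_sub_inner_le_of_contDiff (hp1 : 1 ≤ p) (hp : p ≠ ⊤) {v : Eucl d → ℝ}
    (hv : ContDiff ℝ 1 v) {h : Eucl d} {S : ℝ≥0∞}
    (hS : ∀ z : Eucl d, ‖z‖ ≤ ‖h‖ → eLpNorm (fun x => ∇ v (x - z) - ∇ v x) p volume ≤ S) :
    eLpNorm (fun x => v x - v (x - h) - inner ℝ (∇ v x) h) p volume ≤ ‖h‖ₑ * S := by
  have hgc : Continuous (∇ v) := (InnerProductSpace.toDual ℝ (Eucl d)).symm.continuous.comp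
    (hv.continuous_fderiv (by simp))
  have key : ∀ x, v x - v (x - h) - inner ℝ (∇ v x) h
      = ∫ t in Set.Ioc (0 : ℝ) 1, inner ℝ (∇ v (x - t • h) - ∇ v x) h := by
    intro x
    have hder : ∀ t : ℝ, HasDerivAt (fun t : ℝ => v (x - t • h))
        (-inner ℝ (∇ v (x - t • h)) h) t := by
      intro t
      have h1 : HasFDerivAt v (fderiv ℝ v (x - t • h)) (x - t • h) :=
        ((hv.differentiable (by simp)) _).hasFDerivAt
      have h2 : HasDerivAt (fun t : ℝ => x - t • h) (-h) t := by
        simpa using ((hasDerivAt_id t).smul_const h).const_sub x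
      convert! h1.comp_hasDerivAt t h2 using 1
      simp [gradient]
    have hcont : Continuous fun t : ℝ => inner ℝ (∇ v (x - t • h)) h := by fun_prop
    have hFTC := intervalIntegral.integral_eq_sub_of_hasDerivAt (a := (0 : ℝ)) (b := 1)
      (fun t _ => hder t) (hcont.neg.intervalIntegrable _ _)
    rw [← intervalIntegral.integral_of_le zero_le_one]
    simp_rw [inner_sub_left]
    rw [intervalIntegral.integral_sub (hcont.intervalIntegrable _ _) (by simp)]
    rw [intervalIntegral.integral_neg] at hFTC
    simp only [one_smul, zero_smul, sub_zero] at hFTC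
    simp only [intervalIntegral.integral_const, sub_zero, one_smul]
    linarith
  have := eLpNorm_le_of_enorm_le_lintegral (μ := (volume : Measure (Eucl d)))
    (ν := volume.restrict (Set.Ioc (0 : ℝ) 1)) hp1 hp (a := fun _ => ‖h‖ₑ)
    (k := fun x t => ‖∇ v (x - t • h) - ∇ v x‖ₑ)
    (r := fun x => v x - v (x - h) - inner ℝ (∇ v x) h) (S := S) measurable_const (by simp)
    (by
      refine Continuous.measurable ?_
      simp only [Function.uncurry_def]
      fun_prop)
    (Eventually.of_forall fun x => ?_) ?_
  · simpa using this
  · rw [key x]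
    refine (enorm_integral_le_lintegral_enorm _).trans (lintegral_mono fun t => ?_)
    rw [mul_comm]
    exact enorm_real_inner_le _ _
  · filter_upwards [ae_restrict_mem measurableSet_Ioc] with t ht _
    rw [eLpNorm_enorm]
    refine hS _ ?_
    rw [norm_smul, Real.norm_of_nonneg ht.1.le]
    exact mul_le_of_le_one_left (norm_nonneg _) ht.2

/-- Difference quotients of a Sobolev function converge to the derivative in `L^p`: the error is
bounded by the modulus of continuity of translations of the weak gradient. -/
theorem IsWeakGradient.eLpNorm_sub_sub_inner_le (hp1 : 1 ≤ p) (hp : p ≠ ⊤) {u : Eucl d → ℝ}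
    {G : Eucl d → Eucl d} (hug : IsWeakGradient u G) (hu : MemLp u p volume)
    (hG : MemLp G p volume) (hum : Measurable u) (hGm : Measurable G) {h : Eucl d} {S : ℝ≥0∞}
    (hS : ∀ z : Eucl d, ‖z‖ ≤ ‖h‖ → eLpNorm (fun x => G (x - z) - G x) p volume ≤ S) :
    eLpNorm (fun x => u x - u (x - h) - inner ℝ (G x) h) p volume ≤ ‖h‖ₑ * S := by
  obtain ⟨C, -, hC⟩ := exists_isMollifier d
  have hul := hu.locallyIntegrable hp1
  have hGl := hG.locallyIntegrable hp1
  -- apply the smooth case to a mollification of `u` with error `s`, then let `s → 0`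
  have key : ∀ s : ℝ≥0∞, s ≠ 0 →
      eLpNorm (fun x => u x - u (x - h) - inner ℝ (G x) h) p volume
        ≤ ‖h‖ₑ * (s + S + s) + (s + s + ‖h‖ₑ * s) := by
    intro s hs
    obtain ⟨δ, hδ, hδu⟩ := exists_forall_eLpNorm_translate_sub_le hp1 hp hu hs
    obtain ⟨δ', hδ', hδG⟩ := exists_forall_eLpNorm_translate_sub_le hp1 hp hG hs
    obtain ⟨ρ, hρ⟩ := hC (min δ δ') (lt_min hδ hδ')
    set v := mollify ρ u with hv
    have hvc : ContDiff ℝ ∞ v := hρ.isTest.contDiff_mollify hul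
    have hgv : ∇ v = mollify ρ G := funext fun x => hug.gradient_mollify hρ.isTest hul hGl x
    have hgc : Continuous (mollify ρ G) := (hρ.isTest.contDiff_mollify hGl).continuous
    have h1 : eLpNorm (fun x => v x - u x) p volume ≤ s :=
      hρ.eLpNorm_mollify_sub_le hp1 hp hu hum fun z hz => hδu z (hz.trans (min_le_left _ _))
    have h2 : eLpNorm (fun x => mollify ρ G x - G x) p volume ≤ s :=
      hρ.eLpNorm_mollify_sub_le hp1 hp hG hGm fun z hz => hδG z (hz.trans (min_le_right _ _))
    have hgm := hgc.measurable
    have hvm := hvc.continuous.measurable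
    have h3 : eLpNorm (fun x => v x - v (x - h) - inner ℝ (∇ v x) h) p volume
        ≤ ‖h‖ₑ * (s + S + s) := by
      refine eLpNorm_sub_sub_inner_le_of_contDiff hp1 hp (hvc.of_le (by simp)) fun z hz => ?_
      rw [hgv]
      have e1 : (fun x => mollify ρ G (x - z) - mollify ρ G x)
          = ((fun x => mollify ρ G (x - z) - G (x - z)) + fun x => G (x - z) - G x)
            - fun x => mollify ρ G x - G x := by
        funext x
        simp only [Pi.add_apply, Pi.sub_apply]
        abel
      have m1 : Measurable fun x => mollify ρ G x - G x := hgm.sub hGm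
      have m2 : Measurable fun x => G (x - z) - G x := by fun_prop
      have m3 : Measurable fun x => mollify ρ G (x - z) - G (x - z) :=
        m1.comp (measurable_id.sub_const z)
      rw [e1]
      refine (eLpNorm_sub_le (m3.add m2).aestronglyMeasurable m1.aestronglyMeasurable hp1).trans ?_
      refine add_le_add ((eLpNorm_add_le m3.aestronglyMeasurable m2.aestronglyMeasurable hp1).trans
        (add_le_add ?_ (hS z hz))) h2
      exact (eLpNorm_comp_sub m1.aestronglyMeasurable z).trans_le h2
    have e2 : (fun x => u x - u (x - h) - inner ℝ (G x) h)
        = (fun x => v x - v (x - h) - inner ℝ (∇ v x) h)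
          + (((fun x => v (x - h) - u (x - h)) - fun x => v x - u x)
            + fun x => inner ℝ (mollify ρ G x - G x) h) := by
      funext x
      simp only [Pi.add_apply, Pi.sub_apply, hgv, inner_sub_left]
      ring
    have m1 : Measurable fun x => v x - u x := hvm.sub hum
    have m2 : Measurable fun x => v (x - h) - u (x - h) := m1.comp (measurable_id.sub_const h)
    have m3 : Measurable fun x => (inner ℝ (mollify ρ G x - G x) h : ℝ) :=
      (hgm.sub hGm).inner_const
    have m4 : Measurable fun x => v x - v (x - h) - (inner ℝ (∇ v x) h : ℝ) := by
      rw [hgv]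
      exact (hvm.sub (hvm.comp (measurable_id.sub_const h))).sub hgm.inner_const
    rw [e2]
    refine (eLpNorm_add_le m4.aestronglyMeasurable ((m2.sub m1).add m3).aestronglyMeasurable
      hp1).trans (add_le_add h3 ?_)
    refine (eLpNorm_add_le (m2.sub m1).aestronglyMeasurable m3.aestronglyMeasurable
      hp1).trans (add_le_add ?_ ?_)
    · refine (eLpNorm_sub_le m2.aestronglyMeasurable m1.aestronglyMeasurable hp1).trans
        (add_le_add ?_ h1)
      exact (eLpNorm_comp_sub m1.aestronglyMeasurable h).trans_le h1
    · exact (eLpNorm_inner_le _ h).trans (mul_le_mul_right h2 _)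
  have hlim : Tendsto (fun s : ℝ≥0∞ => ‖h‖ₑ * (s + S + s) + (s + s + ‖h‖ₑ * s)) (𝓝[≠] 0)
      (𝓝 (‖h‖ₑ * (0 + S + 0) + (0 + 0 + ‖h‖ₑ * 0))) := by
    refine Tendsto.mono_left (Continuous.tendsto ?_ 0) nhdsWithin_le_nhds
    have hm : Continuous fun s : ℝ≥0∞ => ‖h‖ₑ * s := ENNReal.continuous_const_mul enorm_ne_top
    exact (hm.comp ((continuous_id.add continuous_const).add continuous_id)).add
      ((continuous_id.add continuous_id).add hm)
  simp only [zero_add, add_zero, mul_zero] at hlim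
  exact ge_of_tendsto hlim (eventually_mem_nhdsWithin.mono fun s hs => key s hs)

theorem eLpNorm_bdd_smul_le {F : Type*} [NormedAddCommGroup F] [NormedSpace ℝ F]
    {f : Eucl d → ℝ} {M : ℝ≥0} (hf : ∀ x, ‖f x‖ ≤ M) (u : Eucl d → F) :
    eLpNorm (fun x => f x • u x) p volume ≤ M * eLpNorm u p volume := by
  refine (eLpNorm_le_nnreal_smul_eLpNorm_of_ae_le_mul (c := M)
    (Eventually.of_forall fun x => ?_) p).trans_eq rfl
  rw [nnnorm_smul]
  gcongr
  exact hf x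

/-- The commutator estimate behind the density of test functions: for a bounded function `f`, a
Sobolev function `Ψ` with gradient `G`, and the gradient `A` of `f Ψ`, the weighted gradient
`Ψ ∇(ρ ⋆ f)` is close to `A - f G`. All moduli of continuity are taken at the scale of `ρ`. -/
theorem IsMollifier.eLpNorm_smul_gradient_mollify_sub_le (hp1 : 1 ≤ p) (hp : p ≠ ⊤) {ε : ℝ}
    {C : ℝ≥0∞} (hC : C ≠ ⊤) {ρ : Eucl d → ℝ} (hρ : IsMollifier ε C ρ) {f Ψ : Eucl d → ℝ}
    {G A : Eucl d → Eucl d} (hfm : Measurable f) (hΨm : Measurable Ψ) (hGm : Measurable G)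
    (hAm : Measurable A) {M : ℝ≥0} (hf : ∀ x, ‖f x‖ ≤ M) (hΨ : MemLp Ψ p volume)
    (hG : MemLp G p volume) (hA : MemLp A p volume) (hΨG : IsWeakGradient Ψ G)
    (hfA : IsWeakGradient (fun x => f x * Ψ x) A) {S : ℝ≥0∞}
    (hSG : ∀ z : Eucl d, ‖z‖ ≤ ε → eLpNorm (fun x => G (x - z) - G x) p volume ≤ S)
    (hSA : ∀ z : Eucl d, ‖z‖ ≤ ε → eLpNorm (fun x => A (x - z) - A x) p volume ≤ S)
    (hSfG : ∀ z : Eucl d, ‖z‖ ≤ ε →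
      eLpNorm (fun x => f (x - z) • G (x - z) - f x • G x) p volume ≤ S) :
    eLpNorm (fun x => Ψ x • ∇ (mollify ρ f) x - (A x - f x • G x)) p volume
      ≤ S + C * (M * S + (S + M * S)) := by
  have hAl := hA.locallyIntegrable hp1
  have hΨl := hΨ.locallyIntegrable hp1
  have hfl : LocallyIntegrable f volume :=
    (memLp_top_of_bound hfm.aestronglyMeasurable M (Eventually.of_forall hf)).locallyIntegrable
      le_top
  have hfΨ : MemLp (fun x => f x * Ψ x) p volume :=
    hΨ.mul (memLp_top_of_bound hfm.aestronglyMeasurable M (Eventually.of_forall hf))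
  have hfΨl := hfΨ.locallyIntegrable hp1
  set k : Eucl d → Eucl d → ℝ := fun x z =>
    f (x - z) * (Ψ x - Ψ (x - z)) - f x * inner ℝ (G x) z with hk
  have hρg := hρ.isTest.continuous_gradient
  -- the mollified weak gradient of `f Ψ`, with the derivative on the kernel
  have hA' : ∀ x, mollify ρ A x = ∫ z, (f (x - z) * Ψ (x - z)) • ∇ ρ z := fun x => by
    rw [← hfA.gradient_mollify hρ.isTest hfΨl hAl, hρ.isTest.gradient_mollify_eq_integral hfΨl]
  have hrep : ∀ x, Ψ x • ∇ (mollify ρ f) x - (A x - f x • G x)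
      = (mollify ρ A x - A x) + ∫ z, k x z • ∇ ρ z := by
    intro x
    have i1 : Integrable fun z => f (x - z) • ∇ ρ z :=
      hρ.isTest.integrable_smul_gradient (locallyIntegrable_comp_sub_left hfl x)
    have i2 : Integrable fun z => (f (x - z) * Ψ (x - z)) • ∇ ρ z :=
      hρ.isTest.integrable_smul_gradient (locallyIntegrable_comp_sub_left hfΨl x)
    have i3 : Integrable fun z => inner ℝ (G x) z • ∇ ρ z :=
      hρ.isTest.integrable_smul_gradient
        (Continuous.locallyIntegrable (by fun_prop))
    have e1 : ∀ z, k x z • ∇ ρ z = (Ψ x • (f (x - z) • ∇ ρ z)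
        - (f (x - z) * Ψ (x - z)) • ∇ ρ z) - f x • (inner ℝ (G x) z • ∇ ρ z) := by
      intro z
      simp only [hk, smul_smul, ← sub_smul]
      congr 1
      ring
    have i4 : Integrable fun z => Ψ x • (f (x - z) • ∇ ρ z) := Integrable.smul (Ψ x) i1
    have i5 : Integrable fun z => Ψ x • (f (x - z) • ∇ ρ z)
      - (f (x - z) * Ψ (x - z)) • ∇ ρ z := i4.sub i2
    have i6 : Integrable fun z => f x • (inner ℝ (G x) z • ∇ ρ z) := Integrable.smul (f x) i3
    simp_rw [e1]
    rw [integral_sub i5 i6, integral_sub i4 i2, integral_smul,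
      integral_smul, ← hA', ← hρ.isTest.gradient_mollify_eq_integral hfl,
      hρ.isTest.integral_inner_smul_gradient, hρ.integral_eq_one, one_smul, smul_neg]
    abel
  -- `k(·, z)` is of order `o(‖z‖)` in `L^p`, which compensates the growth of `∇ρ`
  have hkm : Measurable (Function.uncurry k) := by
    simp only [hk, Function.uncurry_def]
    fun_prop
  have hkS : ∀ z : Eucl d, ‖z‖ ≤ ε →
      eLpNorm (fun x => k x z) p volume ≤ ‖z‖ₑ * (M * S + (S + M * S)) := by
    intro z hz
    have e1 : (fun x => k x z) = (fun x => f (x - z) • (Ψ x - Ψ (x - z) - inner ℝ (G x) z))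
        + fun x => inner ℝ ((f (x - z) • G (x - z) - f x • G x)
          - f (x - z) • (G (x - z) - G x)) z := by
      funext x
      simp only [hk, Pi.add_apply, inner_sub_left, inner_smul_left, smul_eq_mul,
        RCLike.conj_to_real]
      ring
    have m1 : Measurable fun x => f (x - z) • (Ψ x - Ψ (x - z) - (inner ℝ (G x) z : ℝ)) := by
      fun_prop
    have m2 : Measurable fun x => (f (x - z) • G (x - z) - f x • G x) := by fun_prop
    have m3 : Measurable fun x => f (x - z) • (G (x - z) - G x) := by fun_prop
    rw [e1, mul_add]
    refine (eLpNorm_add_le m1.aestronglyMeasurable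
      (m2.sub m3).inner_const.aestronglyMeasurable hp1).trans (add_le_add ?_ ?_)
    · refine (eLpNorm_bdd_smul_le (fun x => hf (x - z)) _).trans ?_
      rw [mul_left_comm]
      gcongr
      exact hΨG.eLpNorm_sub_sub_inner_le hp1 hp hΨ hG hΨm hGm fun y hy => hSG y (hy.trans hz)
    · refine (eLpNorm_inner_le _ z).trans ?_
      gcongr
      refine (eLpNorm_sub_le m2.aestronglyMeasurable m3.aestronglyMeasurable hp1).trans
        (add_le_add (hSfG z hz) ((eLpNorm_bdd_smul_le (fun x => hf (x - z)) _).trans ?_))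
      gcongr
      exact hSG z hz
  have hR : eLpNorm (fun x => ∫ z, k x z • ∇ ρ z) p volume ≤ C * (M * S + (S + M * S)) := by
    have hCle : ∫⁻ z, ‖∇ ρ z‖ₑ * ‖z‖ₑ ≤ C := by
      simpa only [enorm_gradient] using hρ.lintegral_fderiv_le
    -- the factor `‖z‖` is moved from `k` to the weight; at `z = 0` both sides vanish
    have h := eLpNorm_le_of_enorm_le_lintegral (μ := (volume : Measure (Eucl d)))
      (ν := (volume : Measure (Eucl d))) hp1 hp (a := fun z => ‖∇ ρ z‖ₑ * ‖z‖ₑ)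
      (k := fun x z => ‖‖z‖⁻¹ • k x z‖ₑ) (r := fun x => ∫ z, k x z • ∇ ρ z)
      (S := M * S + (S + M * S))
      (by have := hρg.measurable; fun_prop) (ne_top_of_le_ne_top hC hCle)
      (by
        simp only [Function.uncurry_def] at hkm ⊢
        exact ((measurable_snd.norm.inv).smul hkm).enorm)
      (Eventually.of_forall fun x => ?_) (Eventually.of_forall fun z hz => ?_)
    · exact h.trans (mul_le_mul_left hCle _)
    · refine (enorm_integral_le_lintegral_enorm _).trans (lintegral_mono fun z => ?_)
      rcases eq_or_ne z 0 with rfl | hz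
      · simp [hk]
      · have hz' : ‖z‖ₑ ≠ 0 := by simpa using hz
        rw [enorm_smul, enorm_smul, mul_comm ‖∇ ρ z‖ₑ, mul_comm ‖k x z‖ₑ, mul_right_comm,
          ← mul_assoc, enorm_inv (by simpa using hz), enorm_norm,
          ENNReal.mul_inv_cancel hz' enorm_ne_top, one_mul, mul_comm]
    · have hz0 : ‖z‖ₑ ≠ 0 := right_ne_zero_of_mul hz
      have hzε : ‖z‖ ≤ ε := by
        refine mem_closedBall_zero_iff.1 (hρ.tsupport_subset ?_)
        refine support_fderiv_subset ℝ (f := ρ) ?_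
        have h1 := left_ne_zero_of_mul hz
        exact fun h0 => h1 (by simp [gradient, h0])
      rw [eLpNorm_enorm, show (fun x => ‖z‖⁻¹ • k x z) = ‖z‖⁻¹ • fun x => k x z from rfl,
        eLpNorm_const_smul, enorm_inv (by simpa using hz0), enorm_norm,
        ENNReal.inv_mul_le_iff hz0 enorm_ne_top]
      exact hkS z hzε
  simp_rw [hrep]
  refine (eLpNorm_add_le (f := fun x => mollify ρ A x - A x) (g := fun x => ∫ z, k x z • ∇ ρ z)
    ?_ ?_ hp1).trans (add_le_add (hρ.eLpNorm_mollify_sub_le hp1 hp hA hAm hSA) hR)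
  · exact ((hρ.isTest.contDiff_mollify hAl).continuous.measurable.sub hAm).aestronglyMeasurable
  · refine AEStronglyMeasurable.integral_prod_right' (f := fun q : Eucl d × Eucl d =>
      k q.1 q.2 • ∇ ρ q.2) ?_
    exact (hkm.smul (hρg.measurable.comp measurable_snd)).aestronglyMeasurable

/-- The estimate for the functions themselves that goes with the commutator estimate. -/
theorem IsMollifier.eLpNorm_mul_mollify_sub_le (hp1 : 1 ≤ p) (hp : p ≠ ⊤) {ε : ℝ}
    {C : ℝ≥0∞} {ρ : Eucl d → ℝ} (hρ : IsMollifier ε C ρ) {f Ψ : Eucl d → ℝ}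
    (hfm : Measurable f) (hΨm : Measurable Ψ) {M : ℝ≥0} (hf : ∀ x, ‖f x‖ ≤ M) {S : ℝ≥0∞}
    (hSΨ : ∀ z : Eucl d, ‖z‖ ≤ ε → eLpNorm (fun x => Ψ (x - z) - Ψ x) p volume ≤ S)
    (hSfΨ : ∀ z : Eucl d, ‖z‖ ≤ ε →
      eLpNorm (fun x => f (x - z) * Ψ (x - z) - f x * Ψ x) p volume ≤ S) :
    eLpNorm (fun x => Ψ x * (mollify ρ f x - f x)) p volume ≤ S + M * S := by
  have hfl : LocallyIntegrable f volume :=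
    (memLp_top_of_bound hfm.aestronglyMeasurable M (Eventually.of_forall hf)).locallyIntegrable
      le_top
  have h := eLpNorm_le_of_enorm_le_lintegral (μ := (volume : Measure (Eucl d)))
    (ν := (volume : Measure (Eucl d))) hp1 hp (a := fun z => ‖ρ z‖ₑ)
    (k := fun x z => ‖(f (x - z) - f x) * Ψ x‖ₑ) (r := fun x => Ψ x * (mollify ρ f x - f x))
    (S := S + M * S)
    (by have := hρ.isTest.1.continuous.measurable; fun_prop)
    (by rw [hρ.lintegral_enorm]; simp) (by simp only [Function.uncurry_def]; fun_prop)
    (Eventually.of_forall fun x => ?_) (Eventually.of_forall fun z hz => ?_)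
  · rwa [hρ.lintegral_enorm, one_mul] at h
  · rw [hρ.mollify_sub hfl x, ← integral_const_mul]
    refine (enorm_integral_le_lintegral_enorm _).trans (lintegral_mono fun z => ?_)
    rw [smul_eq_mul, mul_left_comm, mul_comm (Ψ x), enorm_mul]
  · rw [eLpNorm_enorm]
    have hz' := hρ.norm_le (by simpa using hz)
    have e1 : (fun x => (f (x - z) - f x) * Ψ x)
        = (fun x => f (x - z) * Ψ (x - z) - f x * Ψ x)
          - fun x => f (x - z) • (Ψ (x - z) - Ψ x) := by
      funext x
      simp only [Pi.sub_apply, smul_eq_mul]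
      ring
    have m1 : Measurable fun x => f (x - z) * Ψ (x - z) - f x * Ψ x := by fun_prop
    have m2 : Measurable fun x => f (x - z) • (Ψ (x - z) - Ψ x) := by fun_prop
    rw [e1]
    refine (eLpNorm_sub_le m1.aestronglyMeasurable m2.aestronglyMeasurable hp1).trans
      (add_le_add (hSfΨ z hz') ((eLpNorm_bdd_smul_le (fun x => hf (x - z)) _).trans ?_))
    gcongr
    exact hSΨ z hz'

end Commutator

/-! ### The weight and its logarithmic derivative -/

section Scalar

variable {d : ℕ}

theorem locallyIntegrable_norm {F : Type*} [NormedAddCommGroup F] {v : Eucl d → F}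
    (hv : LocallyIntegrable v volume) : LocallyIntegrable (fun x => ‖v x‖) volume := fun x =>
  let ⟨s, hs, h⟩ := hv x
  ⟨s, hs, h.norm⟩

/-- The chain rule for a nonnegative function. -/
theorem HasWeakDeriv.comp_nonneg {H h : ℝ → ℝ} (hH : ∀ b, 0 ≤ b → HasDerivAt H (h b) b)
    (hc : ContinuousOn h (Ici 0)) {B : ℝ} (hB : ∀ b, 0 ≤ b → |h b| ≤ B) {e : Eucl d}
    {u v : Eucl d → ℝ} (hu : LocallyIntegrable u volume) (hv : LocallyIntegrable v volume)
    (hum : Measurable u) (hvm : Measurable v) (hu0 : ∀ x, 0 ≤ u x) (huv : HasWeakDeriv e u v) :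
    HasWeakDeriv e (fun x => H (u x)) (fun x => h (u x) * v x) := by
  have := huv.comp (s := Ici (0 : ℝ)) (convex_Ici 0) isClosed_Ici (mem_Ici.2 le_rfl) (H := H)
    (H' := fun b => h b • ContinuousLinearMap.id ℝ ℝ) (B := B) (fun b hb => ?_)
    (hc.smul continuousOn_const) (fun b hb => ?_) hu hv hum hvm hu0
  · simpa using this
  · refine (hH b hb).hasFDerivAt.congr_fderiv ?_
    ext
    simp
  · rw [norm_smul, ContinuousLinearMap.norm_id, mul_one]
    exact hB b hb

theorem hasDerivAt_div_one_add {δ b : ℝ} (hδ : 0 < δ) (hb : 0 ≤ b) :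
    HasDerivAt (fun b : ℝ => b / (1 + δ * b)) (((1 + δ * b) ^ 2)⁻¹) b := by
  have h1 : 1 + δ * b ≠ 0 := by positivity
  have h2 : HasDerivAt (fun b : ℝ => 1 + δ * b) δ b := by
    simpa using ((hasDerivAt_id b).const_mul δ).const_add 1
  refine ((hasDerivAt_id b).div h2 h1).congr_deriv ?_
  simp only [id]
  field_simp
  ring

theorem tendsto_nat_add_one_inv : Tendsto (fun n : ℕ => ((n : ℝ) + 1)⁻¹) atTop (𝓝 0) := by
  simpa using tendsto_one_div_add_atTop_nhds_zero_nat (𝕜 := ℝ)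

/-- The weak derivative of a nonnegative function vanishes where the function does. -/
theorem HasWeakDeriv.ae_eq_zero_of_eq_zero {e : Eucl d} {u v : Eucl d → ℝ}
    (hu : LocallyIntegrable u volume) (hv : LocallyIntegrable v volume) (hum : Measurable u)
    (hvm : Measurable v) (hu0 : ∀ x, 0 ≤ u x) (huv : HasWeakDeriv e u v) :
    ∀ᵐ x, u x = 0 → v x = 0 := by
  have hlim : HasWeakDeriv e (fun _ => (0 : ℝ)) (fun x => if u x = 0 then v x else 0) := by
    -- the functions `u / (1 + n u)` tend to zero, and their derivatives to `1_{u = 0} v`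
    refine HasWeakDeriv.of_tendsto (un := fun (n : ℕ) x => u x / (1 + ((n : ℝ) + 1) * u x))
      (vn := fun (n : ℕ) x => ((1 + ((n : ℝ) + 1) * u x) ^ 2)⁻¹ * v x)
      (U := u) (V := fun x => ‖v x‖) hu (locallyIntegrable_norm hv)
      (fun n => Measurable.aestronglyMeasurable (by fun_prop))
      (fun n => Measurable.aestronglyMeasurable (by fun_prop))
      (fun n => Eventually.of_forall fun x => ?_) (fun n => Eventually.of_forall fun x => ?_)
      (Eventually.of_forall fun x => ?_)
      (Eventually.of_forall fun x => ?_) (fun n => ?_)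
    · have := hu0 x
      rw [Real.norm_of_nonneg (by positivity)]
      exact div_le_self this (by nlinarith [mul_nonneg n.cast_add_one_pos.le this])
    · have := hu0 x
      rw [norm_mul, norm_inv, Real.norm_of_nonneg (by positivity)]
      refine mul_le_of_le_one_left (norm_nonneg _) (inv_le_one_of_one_le₀ (one_le_pow₀ ?_))
      nlinarith [mul_nonneg n.cast_add_one_pos.le this]
    · rcases (hu0 x).eq_or_lt with h0 | h0
      · simp [← h0]
      · have h1 : Tendsto (fun n : ℕ => ((n : ℝ) + 1) * u x) atTop atTop :=
          (tendsto_natCast_atTop_atTop.atTop_add tendsto_const_nhds).atTop_mul_const h0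
        exact (tendsto_atTop_add_const_left _ 1 h1).const_div_atTop _
    · by_cases h0 : u x = 0
      · simp [h0]
      · have h0' : 0 < u x := lt_of_le_of_ne (hu0 x) (Ne.symm h0)
        have h1 : Tendsto (fun n : ℕ => ((n : ℝ) + 1) * u x) atTop atTop :=
          (tendsto_natCast_atTop_atTop.atTop_add tendsto_const_nhds).atTop_mul_const h0'
        have h2 := ((tendsto_pow_atTop two_ne_zero).comp
          (tendsto_atTop_add_const_left _ 1 h1)).inv_tendsto_atTop.mul_const (v x)
        simpa [h0] using h2
    · have hn : (0 : ℝ) < (n : ℝ) + 1 := n.cast_add_one_pos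
      refine huv.comp_nonneg (H := fun b => b / (1 + ((n : ℝ) + 1) * b))
        (h := fun b => ((1 + ((n : ℝ) + 1) * b) ^ 2)⁻¹)
        (fun b hb => hasDerivAt_div_one_add hn hb) (ContinuousOn.inv₀ (by fun_prop) ?_) (B := 1)
        (fun b hb => ?_) hu hv hum hvm hu0
      · intro b hb
        have : 0 ≤ b := hb
        positivity
      · rw [abs_of_nonneg (by positivity)]
        exact inv_le_one_of_one_le₀ (one_le_pow₀ (by nlinarith [mul_nonneg hn.le hb]))
  have hm : MeasurableSet {x | u x = 0} := hum (measurableSet_singleton 0)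
  have hloc : LocallyIntegrable (fun x => if u x = 0 then v x else 0) volume := by
    have : (fun x => if u x = 0 then v x else 0) = {x | u x = 0}.indicator v := by
      funext x
      simp [Set.indicator_apply]
    rw [this]
    exact hv.indicator hm
  have h0 := ae_eq_zero_of_integral_contDiff_smul_eq_zero hloc fun η h1 h2 => by
    rw [hlim η ⟨h1, h2⟩]
    simp
  filter_upwards [h0] with x hx hux
  simpa [hux] using hx

end Scalar

theorem MemLpLoc.locallyIntegrable {d : ℕ} {F : Type*} [NormedAddCommGroup F] {f : Eucl d → F}
    {q : ℝ≥0∞} {ν : Measure (Eucl d)} [IsLocallyFiniteMeasure ν] (hf : MemLpLoc f q ν)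
    (hq : 1 ≤ q) : LocallyIntegrable f ν := by
  rw [locallyIntegrable_iff]
  intro K hK
  have : IsFiniteMeasure (ν.restrict K) := ⟨by simpa using hK.measure_lt_top⟩
  exact (hf K hK).integrable hq

/-- The hypotheses of the theorem for representatives that are measurable and, in the case of the
weight, nonnegative everywhere. -/
structure IsWeight {d : ℕ} (p : ℝ≥0∞) (w : Eucl d → ℝ) (gφ : Eucl d → Eucl d) : Prop where
  one_le : 1 ≤ p
  ne_top : p ≠ ⊤
  measurable : Measurable w
  nonneg : ∀ x, 0 ≤ w x
  locallyIntegrable : LocallyIntegrable w volume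
  measurable_grad : Measurable gφ
  diff : CondDiff p w gφ

namespace IsWeight

variable {d : ℕ} {p : ℝ≥0∞} {w : Eucl d → ℝ} {gφ : Eucl d → Eucl d}

theorem one_le_toReal (hw : IsWeight p w gφ) : 1 ≤ p.toReal := by
  rw [← ENNReal.toReal_one]
  exact ENNReal.toReal_mono hw.ne_top hw.one_le

theorem toReal_pos (hw : IsWeight p w gφ) : 0 < p.toReal := zero_lt_one.trans_le hw.one_le_toReal

theorem phi_nonneg (hw : IsWeight p w gφ) (x : Eucl d) : 0 ≤ phi p w x :=
  Real.rpow_nonneg (hw.nonneg x) _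

theorem measurable_phi (hw : IsWeight p w gφ) : Measurable (phi p w) :=
  hw.measurable.pow_const _

theorem measurable_logGrad (hw : IsWeight p w gφ) : Measurable (logGrad p w gφ) :=
  (measurable_const.div hw.measurable_phi).smul hw.measurable_grad

theorem phi_rpow (hw : IsWeight p w gφ) (x : Eucl d) : phi p w x ^ p.toReal = w x := by
  rw [phi, ← Real.rpow_mul (hw.nonneg x), one_div_mul_cancel hw.toReal_pos.ne', Real.rpow_one]

theorem phi_eq_zero_iff (hw : IsWeight p w gφ) (x : Eucl d) : phi p w x = 0 ↔ w x = 0 := by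
  rw [phi, Real.rpow_eq_zero (hw.nonneg x) (one_div_pos.2 hw.toReal_pos).ne']

theorem locallyIntegrable_phi (hw : IsWeight p w gφ) : LocallyIntegrable (phi p w) volume :=
  hw.diff.phi_mem.1.locallyIntegrable hw.one_le

theorem locallyIntegrable_grad (hw : IsWeight p w gφ) : LocallyIntegrable gφ volume :=
  hw.diff.phi_mem.2.1.locallyIntegrable hw.one_le

end IsWeight

/-- The weak gradient of `φ`, set to zero on `{w = 0}`. It is a version of the weak gradient
(`IsWeight.grad_ae_eq_posGrad`) for which `φ β = p ∇φ` holds everywhere. -/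
def posGrad {d : ℕ} (w : Eucl d → ℝ) (gφ : Eucl d → Eucl d) (x : Eucl d) : Eucl d :=
  if w x = 0 then 0 else gφ x

namespace IsWeight

variable {d : ℕ} {p : ℝ≥0∞} {w : Eucl d → ℝ} {gφ : Eucl d → Eucl d}

theorem measurable_posGrad (hw : IsWeight p w gφ) : Measurable (posGrad w gφ) :=
  Measurable.ite (hw.measurable (measurableSet_singleton 0)) measurable_const hw.measurable_grad

theorem phi_smul_logGrad (hw : IsWeight p w gφ) (x : Eucl d) :
    phi p w x • logGrad p w gφ x = p.toReal • posGrad w gφ x := by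
  by_cases h : w x = 0
  · simp [posGrad, h, (hw.phi_eq_zero_iff x).2 h]
  · have hφ : phi p w x ≠ 0 := fun h' => h ((hw.phi_eq_zero_iff x).1 h')
    rw [logGrad, posGrad, if_neg h, smul_smul, mul_div_cancel₀ _ hφ]

theorem weight_smul_logGrad (hw : IsWeight p w gφ) (x : Eucl d) :
    w x • logGrad p w gφ x = (p.toReal * phi p w x ^ (p.toReal - 1)) • posGrad w gφ x := by
  by_cases h : w x = 0
  · simp [posGrad, h]
  · have hφ : phi p w x ≠ 0 := fun h' => h ((hw.phi_eq_zero_iff x).1 h')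
    have h1 : w x = phi p w x ^ (p.toReal - 1) * phi p w x := by
      conv_rhs => rw [← Real.rpow_add_one hφ, sub_add_cancel, hw.phi_rpow]
    nth_rewrite 1 [h1]
    rw [mul_smul, hw.phi_smul_logGrad, smul_smul, mul_comm]

theorem grad_ae_eq_posGrad (hw : IsWeight p w gφ) : gφ =ᵐ[volume] posGrad w gφ := by
  have h : ∀ i, ∀ᵐ x, phi p w x = 0 → gφ x i = 0 := fun i =>
    (isWeakGradient_iff.1 hw.diff.phi_mem.2.2 i).ae_eq_zero_of_eq_zero hw.locallyIntegrable_phi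
      (locallyIntegrable_apply hw.locallyIntegrable_grad i) hw.measurable_phi
      (by have := hw.measurable_grad; fun_prop) hw.phi_nonneg
  filter_upwards [ae_all_iff.2 h] with x hx
  rw [posGrad]
  split_ifs with h0
  · ext i
    exact hx i ((hw.phi_eq_zero_iff x).2 h0)
  · rfl

theorem isWeakGradient_posGrad (hw : IsWeight p w gφ) :
    IsWeakGradient (phi p w) (posGrad w gφ) := by
  rw [isWeakGradient_iff]
  exact fun i => (isWeakGradient_iff.1 hw.diff.phi_mem.2.2 i).congr_ae EventuallyEq.rfl
    (hw.grad_ae_eq_posGrad.mono fun x hx => by simp only [hx])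

theorem memLpLoc_posGrad (hw : IsWeight p w gφ) : MemLpLoc (posGrad w gφ) p volume := fun K hK =>
  (hw.diff.phi_mem.2.1 K hK).ae_eq (ae_restrict_of_ae hw.grad_ae_eq_posGrad)

theorem locallyIntegrable_posGrad (hw : IsWeight p w gφ) :
    LocallyIntegrable (posGrad w gφ) volume := by
  rw [locallyIntegrable_iff]
  intro K hK
  exact (hw.locallyIntegrable_grad.integrableOn_isCompact hK).congr
    (ae_restrict_of_ae hw.grad_ae_eq_posGrad)

/-! ### Integration against the weighted measure -/

theorem isLocallyFiniteMeasure (hw : IsWeight p w gφ) :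
    IsLocallyFiniteMeasure (weightMeasure w) := by
  refine ⟨fun x => ?_⟩
  obtain ⟨K, hK, hxK⟩ := exists_compact_mem_nhds x
  refine ⟨K, hxK, ?_⟩
  rw [weightMeasure, withDensity_apply _ hK.measurableSet,
    ← ofReal_integral_eq_lintegral_ofReal (hw.locallyIntegrable.integrableOn_isCompact hK)
      (Eventually.of_forall hw.nonneg)]
  exact ENNReal.ofReal_lt_top

theorem integral_weightMeasure (hw : IsWeight p w gφ) {F : Type*} [NormedAddCommGroup F]
    [NormedSpace ℝ F] (h : Eucl d → F) : ∫ x, h x ∂(weightMeasure w) = ∫ x, w x • h x := by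
  rw [weightMeasure, integral_withDensity_eq_integral_toReal_smul hw.measurable.ennreal_ofReal
    (by simp)]
  simp only [ENNReal.toReal_ofReal (hw.nonneg _)]

theorem integrable_weightMeasure_iff (hw : IsWeight p w gφ) {F : Type*} [NormedAddCommGroup F]
    [NormedSpace ℝ F] {h : Eucl d → F} {s : Set (Eucl d)} (hs : MeasurableSet s) :
    IntegrableOn h s (weightMeasure w) ↔ IntegrableOn (fun x => w x • h x) s volume := by
  rw [IntegrableOn, weightMeasure, restrict_withDensity hs,
    integrable_withDensity_iff_integrable_smul' hw.measurable.ennreal_ofReal (by simp)]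
  simp only [ENNReal.toReal_ofReal (hw.nonneg _)]
  rfl

theorem locallyIntegrable_weight_smul (hw : IsWeight p w gφ) {F : Type*} [NormedAddCommGroup F]
    [NormedSpace ℝ F] {h : Eucl d → F} (hh : LocallyIntegrable h (weightMeasure w)) :
    LocallyIntegrable (fun x => w x • h x) volume := by
  rw [locallyIntegrable_iff]
  intro K hK
  exact (hw.integrable_weightMeasure_iff hK.measurableSet).1 (hh.integrableOn_isCompact hK)

/-- Multiplication by `φ` is an isometry of `L^p(μ)` into `L^p(dx)`. -/
theorem eLpNorm_weightMeasure (hw : IsWeight p w gφ) {F : Type*} [NormedAddCommGroup F]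
    [NormedSpace ℝ F] [MeasurableSpace F] [BorelSpace F] {h : Eucl d → F} (hh : Measurable h) :
    eLpNorm h p (weightMeasure w) = eLpNorm (fun x => phi p w x • h x) p volume := by
  have hp0 : p ≠ 0 := (zero_lt_one.trans_le hw.one_le).ne'
  rw [eLpNorm_eq_lintegral_rpow_enorm_toReal hp0 hw.ne_top,
    eLpNorm_eq_lintegral_rpow_enorm_toReal hp0 hw.ne_top, weightMeasure,
    lintegral_withDensity_eq_lintegral_mul _ hw.measurable.ennreal_ofReal
      (hh.enorm.pow_const p.toReal)]
  congr 1
  refine lintegral_congr fun x => ?_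
  rw [Pi.mul_apply, enorm_smul, ENNReal.mul_rpow_of_nonneg _ _ hw.toReal_pos.le,
    Real.enorm_eq_ofReal (hw.phi_nonneg x), ENNReal.ofReal_rpow_of_nonneg (hw.phi_nonneg x)
      hw.toReal_pos.le, hw.phi_rpow]

theorem memLp_weightMeasure_iff (hw : IsWeight p w gφ) {F : Type*} [NormedAddCommGroup F]
    [NormedSpace ℝ F] [MeasurableSpace F] [BorelSpace F] [SecondCountableTopology F]
    {h : Eucl d → F} (hh : Measurable h) :
    MemLp h p (weightMeasure w) ↔ MemLp (fun x => phi p w x • h x) p volume := by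
  rw [MemLp, MemLp, hw.eLpNorm_weightMeasure hh]
  exact and_congr (iff_of_true hh.aestronglyMeasurable
    (hw.measurable_phi.smul hh).aestronglyMeasurable) Iff.rfl

theorem locallyIntegrable_logGrad (hw : IsWeight p w gφ) :
    LocallyIntegrable (logGrad p w gφ) (weightMeasure w) := by
  have := hw.isLocallyFiniteMeasure
  refine hw.diff.logGrad_mem.locallyIntegrable ?_
  rw [ENNReal.conjExponent]
  exact le_self_add

/-- The weight `w = φ ^ p` is weakly differentiable, with gradient `p φ ^ (p - 1) ∇φ = w β`. -/
theorem isWeakGradient_weight (hw : IsWeight p w gφ) :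
    IsWeakGradient w (fun x => w x • logGrad p w gφ x) := by
  rw [isWeakGradient_iff]
  intro i
  have hφ := isWeakGradient_iff.1 hw.isWeakGradient_posGrad i
  have hP := hw.one_le_toReal
  have hP0 := hw.toReal_pos
  have hmφ := hw.measurable_phi
  have hmg : Measurable fun x => posGrad w gφ x i := by
    have := hw.measurable_posGrad
    fun_prop
  have hV := locallyIntegrable_norm (locallyIntegrable_apply
    (hw.locallyIntegrable_weight_smul hw.locallyIntegrable_logGrad) i)
  have hval : ∀ x, (w x • logGrad p w gφ x) i
      = p.toReal * phi p w x ^ (p.toReal - 1) * posGrad w gφ x i := by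
    intro x
    rw [hw.weight_smul_logGrad]
    rfl
  have hle : ∀ δ b : ℝ, 0 ≤ δ → 0 ≤ b → 0 ≤ b / (1 + δ * b) ∧ b / (1 + δ * b) ≤ b :=
    fun δ b hδ hb => ⟨by positivity, div_le_self hb (by nlinarith [mul_nonneg hδ hb])⟩
  have hlim : ∀ x, Tendsto (fun n : ℕ => 1 + ((n : ℝ) + 1)⁻¹ * phi p w x) atTop (𝓝 1) := by
    intro x
    simpa using (tendsto_nat_add_one_inv.mul_const (phi p w x)).const_add 1
  have hlim' : ∀ x, Tendsto (fun n : ℕ => phi p w x / (1 + ((n : ℝ) + 1)⁻¹ * phi p w x)) atTop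
      (𝓝 (phi p w x)) := by
    intro x
    have h := (tendsto_const_nhds (x := phi p w x) (f := (atTop : Filter ℕ))).div (hlim x)
      one_ne_zero
    rwa [div_one] at h
  have hmu : ∀ n : ℕ, Measurable fun x =>
      (phi p w x / (1 + ((n : ℝ) + 1)⁻¹ * phi p w x)) ^ p.toReal := fun n =>
    (hmφ.div ((hmφ.const_mul _).const_add _)).pow_const _
  have hmv : ∀ n : ℕ, Measurable fun x => ((1 + ((n : ℝ) + 1)⁻¹ * phi p w x) ^ 2)⁻¹ * p.toReal *
      (phi p w x / (1 + ((n : ℝ) + 1)⁻¹ * phi p w x)) ^ (p.toReal - 1) * posGrad w gφ x i :=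
    fun n => ((((((hmφ.const_mul _).const_add _).pow_const 2).inv).mul_const _).mul
      ((hmφ.div ((hmφ.const_mul _).const_add _)).pow_const _)).mul hmg
  -- `φ ↦ φ ^ p` is approximated by functions of `φ / (1 + δ φ)`, whose derivatives are bounded
  refine HasWeakDeriv.of_tendsto
    (un := fun (n : ℕ) x => (phi p w x / (1 + ((n : ℝ) + 1)⁻¹ * phi p w x)) ^ p.toReal)
    (vn := fun (n : ℕ) x => ((1 + ((n : ℝ) + 1)⁻¹ * phi p w x) ^ 2)⁻¹ * p.toReal *
      (phi p w x / (1 + ((n : ℝ) + 1)⁻¹ * phi p w x)) ^ (p.toReal - 1) * posGrad w gφ x i)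
    hw.locallyIntegrable hV (fun n => (hmu n).aestronglyMeasurable)
    (fun n => (hmv n).aestronglyMeasurable)
    (fun n => Eventually.of_forall fun x => ?_) (fun n => Eventually.of_forall fun x => ?_)
    (Eventually.of_forall fun x => ?_) (Eventually.of_forall fun x => ?_) (fun n => ?_)
  · have hn : (0 : ℝ) ≤ ((n : ℝ) + 1)⁻¹ := by positivity
    obtain ⟨h1, h2⟩ := hle _ _ hn (hw.phi_nonneg x)
    rw [Real.norm_of_nonneg (Real.rpow_nonneg h1 _)]
    exact (Real.rpow_le_rpow h1 h2 hP0.le).trans_eq (hw.phi_rpow x)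
  · have hn : (0 : ℝ) ≤ ((n : ℝ) + 1)⁻¹ := by positivity
    have hφ0 := hw.phi_nonneg x
    obtain ⟨h1, h2⟩ := hle _ _ hn hφ0
    rw [hval, norm_mul, norm_mul (p.toReal * phi p w x ^ (p.toReal - 1))]
    refine mul_le_mul_of_nonneg_right ?_ (norm_nonneg (posGrad w gφ x i))
    rw [Real.norm_of_nonneg (by positivity), Real.norm_of_nonneg (by positivity)]
    refine mul_le_mul ?_ (Real.rpow_le_rpow h1 h2 (by linarith)) (by positivity) hP0.le
    refine mul_le_of_le_one_left hP0.le (inv_le_one_of_one_le₀ (one_le_pow₀ ?_))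
    nlinarith [mul_nonneg hn hφ0]
  · have := (hlim' x).rpow_const (p := p.toReal) (Or.inr hP0.le)
    rwa [hw.phi_rpow] at this
  · rw [hval]
    refine Tendsto.mul_const _ ?_
    have h1 := (((hlim x).pow 2).inv₀ (by norm_num)).mul_const p.toReal
    have h2 := (hlim' x).rpow_const (p := p.toReal - 1) (Or.inr (by linarith))
    simpa using h1.mul h2
  · have hn : (0 : ℝ) < ((n : ℝ) + 1)⁻¹ := by positivity
    refine hφ.comp_nonneg (H := fun b => (b / (1 + ((n : ℝ) + 1)⁻¹ * b)) ^ p.toReal)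
      (h := fun b => ((1 + ((n : ℝ) + 1)⁻¹ * b) ^ 2)⁻¹ * p.toReal *
        (b / (1 + ((n : ℝ) + 1)⁻¹ * b)) ^ (p.toReal - 1))
      (B := p.toReal * ((n : ℝ) + 1) ^ (p.toReal - 1))
      (fun b hb => (hasDerivAt_div_one_add hn hb).rpow_const (Or.inr hP)) ?_ (fun b hb => ?_)
      hw.locallyIntegrable_phi (locallyIntegrable_apply hw.locallyIntegrable_posGrad i) hmφ hmg
      hw.phi_nonneg
    · have hne : ∀ b ∈ Ici (0 : ℝ), 1 + ((n : ℝ) + 1)⁻¹ * b ≠ 0 := by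
        intro b hb
        have : 0 ≤ b := hb
        positivity
      refine ContinuousOn.mul (ContinuousOn.mul (ContinuousOn.inv₀ (by fun_prop)
        fun b hb => pow_ne_zero _ (hne b hb)) continuousOn_const) ?_
      exact ((continuousOn_id.div (by fun_prop) hne).rpow_const
        fun b _ => Or.inr (by linarith))
    · have h1 : b / (1 + ((n : ℝ) + 1)⁻¹ * b) ≤ (n : ℝ) + 1 := by
        rw [div_le_iff₀ (by positivity), mul_add, mul_inv_cancel_left₀ (by positivity)]
        have : (0 : ℝ) ≤ (n : ℝ) + 1 := by positivity
        linarith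
      rw [abs_of_nonneg (by positivity)]
      refine mul_le_mul ?_ (Real.rpow_le_rpow (by positivity) h1 (by linarith)) (by positivity)
        hP0.le
      refine mul_le_of_le_one_left hP0.le (inv_le_one_of_one_le₀ (one_le_pow₀ ?_))
      nlinarith [mul_nonneg hn.le hb]

end IsWeight

/-! ### A smooth truncation -/

/-- The function `s / (1 + c s ^ 2)`; it is bounded for `c > 0` and tends to `s` as `c → 0`. -/
def trunc (c s : ℝ) : ℝ := s / (1 + c * s ^ 2)

/-- The derivative of `trunc c`. -/
def truncDeriv (c s : ℝ) : ℝ := (1 - c * s ^ 2) / (1 + c * s ^ 2) ^ 2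

section Trunc

variable {c : ℝ}

theorem hasDerivAt_trunc (hc : 0 < c) (s : ℝ) : HasDerivAt (trunc c) (truncDeriv c s) s := by
  have h1 : 1 + c * s ^ 2 ≠ 0 := by positivity
  have h2 : HasDerivAt (fun s : ℝ => 1 + c * s ^ 2) (c * (2 * s)) s := by
    simpa using ((hasDerivAt_pow 2 s).const_mul c).const_add 1
  refine ((hasDerivAt_id s).div h2 h1).congr_deriv ?_
  simp only [id, truncDeriv]
  field_simp
  ring

theorem continuous_trunc (hc : 0 < c) : Continuous (trunc c) := by
  unfold trunc
  exact continuous_id.div (by fun_prop) fun s => by positivity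

theorem continuous_truncDeriv (hc : 0 < c) : Continuous (truncDeriv c) := by
  unfold truncDeriv
  exact Continuous.div (by fun_prop) (by fun_prop) fun s => by positivity

theorem trunc_eq (s : ℝ) : trunc c s = s * (1 + c * s ^ 2)⁻¹ := div_eq_mul_inv _ _

theorem abs_trunc_le_abs (hc : 0 < c) (s : ℝ) : |trunc c s| ≤ |s| := by
  rw [trunc, abs_div, abs_of_pos (by positivity : 0 < 1 + c * s ^ 2)]
  exact div_le_self (abs_nonneg _) (by nlinarith [sq_nonneg s])

theorem abs_trunc_le_inv (hc : 0 < c) (hc1 : c ≤ 1) (s : ℝ) : |trunc c s| ≤ c⁻¹ := by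
  rw [trunc, abs_div, abs_of_pos (by positivity : 0 < 1 + c * s ^ 2), div_le_iff₀ (by positivity),
    le_inv_mul_iff₀ hc, ← sq_abs s]
  nlinarith [sq_nonneg (|s| - 1), abs_nonneg s]

theorem abs_truncDeriv_le (hc : 0 < c) (s : ℝ) : |truncDeriv c s| ≤ (1 + c * s ^ 2)⁻¹ := by
  have h : 0 < 1 + c * s ^ 2 := by positivity
  rw [truncDeriv, abs_div, abs_of_pos (by positivity : 0 < (1 + c * s ^ 2) ^ 2),
    div_le_iff₀ (by positivity), sq (1 + c * s ^ 2), inv_mul_cancel_left₀ h.ne', abs_le]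
  constructor <;> nlinarith [mul_nonneg hc.le (sq_nonneg s)]

theorem abs_truncDeriv_le_one (hc : 0 < c) (s : ℝ) : |truncDeriv c s| ≤ 1 :=
  (abs_truncDeriv_le hc s).trans
    (inv_le_one_of_one_le₀ (by nlinarith [mul_nonneg hc.le (sq_nonneg s)]))

theorem abs_mul_truncDeriv_le (hc : 0 < c) (hc1 : c ≤ 1) (s : ℝ) :
    |s * truncDeriv c s| ≤ c⁻¹ := by
  refine le_trans ?_ (abs_trunc_le_inv hc hc1 s)
  rw [abs_mul, trunc_eq, abs_mul, abs_of_pos (by positivity : 0 < (1 + c * s ^ 2)⁻¹)]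
  exact mul_le_mul_of_nonneg_left (abs_truncDeriv_le hc s) (abs_nonneg _)

theorem tendsto_trunc {cn : ℕ → ℝ} (hcn : Tendsto cn atTop (𝓝 0)) (s : ℝ) :
    Tendsto (fun n => trunc (cn n) s) atTop (𝓝 s) := by
  have h1 : Tendsto (fun n => 1 + cn n * s ^ 2) atTop (𝓝 1) := by
    simpa using (hcn.mul_const (s ^ 2)).const_add 1
  simpa [trunc_eq] using (h1.inv₀ one_ne_zero).const_mul s

theorem tendsto_truncDeriv {cn : ℕ → ℝ} (hcn : Tendsto cn atTop (𝓝 0)) (s : ℝ) :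
    Tendsto (fun n => truncDeriv (cn n) s) atTop (𝓝 1) := by
  have h1 : Tendsto (fun n => 1 + cn n * s ^ 2) atTop (𝓝 1) := by
    simpa using (hcn.mul_const (s ^ 2)).const_add 1
  have h2 : Tendsto (fun n => 1 - cn n * s ^ 2) atTop (𝓝 1) := by
    simpa using (hcn.mul_const (s ^ 2)).const_sub 1
  have h3 := h2.mul ((h1.pow 2).inv₀ (by norm_num))
  simpa [truncDeriv, div_eq_mul_inv] using h3

end Trunc

/-! ### Truncation of weighted Sobolev functions -/

section Quotient

variable {d : ℕ}

theorem HasWeakDeriv.prodMk {e : Eucl d} {u v u' v' : Eucl d → ℝ}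
    (hu : LocallyIntegrable u volume) (hv : LocallyIntegrable v volume)
    (hu' : LocallyIntegrable u' volume) (hv' : LocallyIntegrable v' volume)
    (h : HasWeakDeriv e u v) (h' : HasWeakDeriv e u' v') :
    HasWeakDeriv e (fun x => (u x, u' x)) (fun x => (v x, v' x)) := by
  intro η hη
  have e1 := integral_pair (hη.integrable_smul hv) (hη.integrable_smul hv')
  have e2 := integral_pair (hη.integrable_fderiv_smul e hu) (hη.integrable_fderiv_smul e hu')
  simp only [Prod.smul_mk]
  rw [e1, e2, h η hη, h' η hη]
  rfl

theorem locallyIntegrable_prodMk {u v : Eucl d → ℝ}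
    (hu : LocallyIntegrable u volume) (hv : LocallyIntegrable v volume) :
    LocallyIntegrable (fun x => (u x, v x)) volume := by
  rw [locallyIntegrable_iff] at *
  exact fun K hK => (hu K hK).prodMk (hv K hK)

/-- The weak derivative of `w (w + δ) ^ r T(F / (w + δ))`, where `T` is the truncation: the chain
rule for the pair `(F, w)` and a function on the half plane `{w ≥ 0}` whose derivative is
bounded there, as `-1 ≤ r ≤ 0`. -/
theorem HasWeakDeriv.trunc_div {c δ r : ℝ} (hc : 0 < c) (hc1 : c ≤ 1) (hδ : 0 < δ) (hr : r ≤ 0)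
    (hr1 : -1 ≤ r) {e : Eucl d} {F F' w w' : Eucl d → ℝ} (hF : LocallyIntegrable F volume)
    (hF' : LocallyIntegrable F' volume) (hw : LocallyIntegrable w volume)
    (hw' : LocallyIntegrable w' volume) (hFm : Measurable F) (hFm' : Measurable F')
    (hwm : Measurable w) (hwm' : Measurable w') (hw0 : ∀ x, 0 ≤ w x) (h : HasWeakDeriv e F F')
    (h' : HasWeakDeriv e w w') :
    HasWeakDeriv e (fun x => w x * (w x + δ) ^ r * trunc c (F x / (w x + δ)))
      (fun x => w x * (w x + δ) ^ r * (truncDeriv c (F x / (w x + δ)) * (w x + δ)⁻¹) * F' x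
        + (((w x + δ) ^ r + w x * (r * (w x + δ) ^ (r - 1))) * trunc c (F x / (w x + δ))
          - w x * (w x + δ) ^ r *
            (F x / (w x + δ) * truncDeriv c (F x / (w x + δ)) * (w x + δ)⁻¹)) * w' x) := by
  set s : Set (ℝ × ℝ) := {y | 0 ≤ y.2} with hs
  have hpos : ∀ y ∈ s, 0 < y.2 + δ := fun y hy => add_pos_of_nonneg_of_pos hy hδ
  let cA : ℝ × ℝ → ℝ := fun y =>
    y.2 * (y.2 + δ) ^ r * (truncDeriv c (y.1 / (y.2 + δ)) * (y.2 + δ)⁻¹)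
  let cB : ℝ × ℝ → ℝ := fun y =>
    ((y.2 + δ) ^ r + y.2 * (r * (y.2 + δ) ^ (r - 1))) * trunc c (y.1 / (y.2 + δ))
      - y.2 * (y.2 + δ) ^ r *
        (y.1 / (y.2 + δ) * truncDeriv c (y.1 / (y.2 + δ)) * (y.2 + δ)⁻¹)
  have key := (h.prodMk hF hF' hw hw' h').comp (s := s) (B := δ ^ r + 3 * (δ ^ r * c⁻¹))
    (H := fun y => y.2 * (y.2 + δ) ^ r * trunc c (y.1 / (y.2 + δ)))
    (H' := fun y => cA y • ContinuousLinearMap.fst ℝ ℝ ℝ + cB y • ContinuousLinearMap.snd ℝ ℝ ℝ)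
    ?_ ?_ ?_ ?_ ?_ ?_ (locallyIntegrable_prodMk hF hw) (locallyIntegrable_prodMk hF' hw')
    (hFm.prodMk hwm) (hFm'.prodMk hwm') hw0
  · simpa [cA, cB] using key
  · intro y hy z hz a b ha hb _
    have h1 : 0 ≤ y.2 := hy
    have h2 : 0 ≤ z.2 := hz
    change 0 ≤ a * y.2 + b * z.2
    positivity
  · exact isClosed_le continuous_const continuous_snd
  · exact le_refl (0 : ℝ)
  · intro y hy
    have hD := hpos y hy
    have h2 : HasFDerivAt (fun y : ℝ × ℝ => y.2) (ContinuousLinearMap.snd ℝ ℝ ℝ) y :=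
      hasFDerivAt_snd
    have h1 : HasFDerivAt (fun y : ℝ × ℝ => y.1) (ContinuousLinearMap.fst ℝ ℝ ℝ) y :=
      hasFDerivAt_fst
    have h3 := h2.add_const δ
    have h4 := (Real.hasDerivAt_rpow_const (p := r) (Or.inl hD.ne')).comp_hasFDerivAt y h3
    have h5 := (hasDerivAt_inv hD.ne').comp_hasFDerivAt y h3
    have h6 := (hasDerivAt_trunc hc (y.1 * (y.2 + δ)⁻¹)).comp_hasFDerivAt y (h1.mul h5)
    refine (((h2.mul h4).mul h6).congr_fderiv ?_)
    ext
    · simp [cA, div_eq_mul_inv]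
    · simp [cB, div_eq_mul_inv]
      field_simp
      ring
  · have c1 : ContinuousOn (fun y : ℝ × ℝ => y.2 + δ) s := by fun_prop
    have c2 : ContinuousOn (fun y : ℝ × ℝ => y.1 / (y.2 + δ)) s :=
      continuous_fst.continuousOn.div c1 fun y hy => (hpos y hy).ne'
    have c3 : ∀ t : ℝ, ContinuousOn (fun y : ℝ × ℝ => (y.2 + δ) ^ t) s := fun t =>
      c1.rpow_const fun y hy => Or.inl (hpos y hy).ne'
    have c4 := (continuous_trunc hc).comp_continuousOn c2
    have c5 := (continuous_truncDeriv hc).comp_continuousOn c2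
    have c6 : ContinuousOn (fun y : ℝ × ℝ => (y.2 + δ)⁻¹) s :=
      c1.inv₀ fun y hy => (hpos y hy).ne'
    have c7 : ContinuousOn (fun y : ℝ × ℝ => y.2) s := continuous_snd.continuousOn
    have hA : ContinuousOn cA s := (c7.mul (c3 r)).mul (c5.mul c6)
    have hB : ContinuousOn cB s :=
      (((c3 r).add (c7.mul (continuousOn_const.mul (c3 (r - 1))))).mul c4).sub
        ((c7.mul (c3 r)).mul ((c2.mul c5).mul c6))
    exact (hA.smul continuousOn_const).add (hB.smul continuousOn_const)
  · intro y hy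
    have hD := hpos y hy
    have hy0 : 0 ≤ y.2 := hy
    have hq0 : 0 < (y.2 + δ) ^ r := Real.rpow_pos_of_pos hD r
    have hq : (y.2 + δ) ^ r ≤ δ ^ r :=
      Real.rpow_le_rpow_of_nonpos hδ (by linarith) hr
    have ht0 : 0 ≤ y.2 * (y.2 + δ)⁻¹ := by positivity
    have ht1 : y.2 * (y.2 + δ)⁻¹ ≤ 1 := by
      rw [← div_eq_mul_inv, div_le_one hD]
      linarith
    set t := y.2 * (y.2 + δ)⁻¹ with ht
    set q := (y.2 + δ) ^ r with hqdef
    set σ := y.1 / (y.2 + δ) with hσ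
    have eA : cA y = q * t * truncDeriv c σ := by
      simp only [cA, ht, ← hqdef, ← hσ]
      ring
    have eB : cB y = q * ((1 + r * t) * trunc c σ) - q * (t * (σ * truncDeriv c σ)) := by
      simp only [cB, ht, ← hqdef, ← hσ, Real.rpow_sub_one hD.ne']
      ring
    have bA : |cA y| ≤ δ ^ r := by
      rw [eA, abs_mul, abs_mul, abs_of_pos hq0, abs_of_nonneg ht0]
      calc q * t * |truncDeriv c σ| ≤ q * 1 * 1 := by
            gcongr
            exact abs_truncDeriv_le_one hc σ
        _ ≤ δ ^ r := by simpa using hq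
    have hci : 0 < c⁻¹ := inv_pos.2 hc
    have bB : |cB y| ≤ 2 * (δ ^ r * c⁻¹) := by
      have h1 : |1 + r * t| ≤ 1 := by
        rw [abs_le]
        constructor <;> nlinarith
      have h2 : |q * ((1 + r * t) * trunc c σ)| ≤ δ ^ r * c⁻¹ := by
        rw [abs_mul, abs_mul, abs_of_pos hq0]
        refine mul_le_mul hq ?_ (by positivity) (by positivity)
        exact (mul_le_of_le_one_left (abs_nonneg _) h1).trans (abs_trunc_le_inv hc hc1 σ)
      have h3 : |q * (t * (σ * truncDeriv c σ))| ≤ δ ^ r * c⁻¹ := by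
        rw [abs_mul, abs_mul, abs_of_pos hq0, abs_of_nonneg ht0]
        refine mul_le_mul hq ?_ (by positivity) (by positivity)
        exact (mul_le_of_le_one_left (abs_nonneg _) ht1).trans (abs_mul_truncDeriv_le hc hc1 σ)
      rw [eB]
      refine (abs_sub _ _).trans ?_
      linarith
    refine (norm_add_le _ _).trans ?_
    rw [norm_smul, norm_smul, Real.norm_eq_abs, Real.norm_eq_abs]
    have n1 := mul_le_of_le_one_right (abs_nonneg (cA y)) (ContinuousLinearMap.norm_fst_le ℝ ℝ ℝ)
    have n2 := mul_le_of_le_one_right (abs_nonneg (cB y)) (ContinuousLinearMap.norm_snd_le ℝ ℝ ℝ)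
    have : 0 < δ ^ r * c⁻¹ := by positivity
    linarith

end Quotient

/-- `g` is the gradient of `f` in the sense of integration by parts against the measure `μ` with
logarithmic derivative `β`. -/
def HasWeightedGradient {d : ℕ} (μ : Measure (Eucl d)) (β : Eucl d → Eucl d) (f : Eucl d → ℝ)
    (g : Eucl d → Eucl d) : Prop :=
  ∀ (i : Fin d) (η : Eucl d → ℝ), IsTest η →
    ∫ x, g x i * η x ∂μ = - (∫ x, f x * partialD i η x ∂μ) - ∫ x, f x * η x * β x i ∂μ

namespace IsWeight

variable {d : ℕ} {p : ℝ≥0∞} {w : Eucl d → ℝ} {gφ : Eucl d → Eucl d}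

theorem locallyIntegrable_smul_logGrad (hw : IsWeight p w gφ) {f : Eucl d → ℝ}
    (hf : MemLp f p (weightMeasure w)) :
    LocallyIntegrable (fun x => f x • logGrad p w gφ x) (weightMeasure w) := by
  have : Fact (1 ≤ p) := ⟨hw.one_le⟩
  have := hw.isLocallyFiniteMeasure
  rw [locallyIntegrable_iff]
  intro K hK
  have h := (hw.diff.logGrad_mem K hK).smul (hf.restrict K) (r := 1)
  exact memLp_one_iff_integrable.1 h

theorem integrable_mul_test (hw : IsWeight p w gφ) {h : Eucl d → ℝ}
    (hh : LocallyIntegrable h (weightMeasure w)) {η : Eucl d → ℝ} (hη : Continuous η)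
    (hη' : HasCompactSupport η) : Integrable (fun x => h x * η x) (weightMeasure w) := by
  have := hw.isLocallyFiniteMeasure
  simpa [mul_comm] using hh.integrable_smul_left_of_hasCompactSupport hη hη'

/-- If `g` is the weighted gradient of `f`, then `w f` has the weak gradient `w (g + f β)`. -/
theorem isWeakGradient_weight_mul (hw : IsWeight p w gφ) {f : Eucl d → ℝ} {g : Eucl d → Eucl d}
    (hf : MemLp f p (weightMeasure w)) (hg : MemLp g p (weightMeasure w))
    (h : HasWeightedGradient (weightMeasure w) (logGrad p w gφ) f g) :
    IsWeakGradient (fun x => w x * f x) (fun x => w x • (g x + f x • logGrad p w gφ x)) := by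
  have := hw.isLocallyFiniteMeasure
  intro i η hη
  have i1 := hw.integrable_mul_test (locallyIntegrable_apply
    (hg.locallyIntegrable hw.one_le) i) hη.1.continuous hη.2
  have i2 := hw.integrable_mul_test (locallyIntegrable_apply
    (hw.locallyIntegrable_smul_logGrad hf) i) hη.1.continuous hη.2
  have h1 := h i η hη
  have e1 : ∫ x, (w x • (g x + f x • logGrad p w gφ x)) i * η x
      = (∫ x, g x i * η x ∂(weightMeasure w))
        + ∫ x, (f x • logGrad p w gφ x) i * η x ∂(weightMeasure w) := by
    rw [← integral_add i1 i2, hw.integral_weightMeasure]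
    refine integral_congr_ae (Eventually.of_forall fun x => ?_)
    simp
    ring
  have e2 : ∫ x, w x * f x * partialD i η x = ∫ x, f x * partialD i η x ∂(weightMeasure w) := by
    rw [hw.integral_weightMeasure]
    refine integral_congr_ae (Eventually.of_forall fun x => ?_)
    simp [mul_assoc]
  have e3 : ∫ x, f x * η x * logGrad p w gφ x i ∂(weightMeasure w)
      = ∫ x, (f x • logGrad p w gφ x) i * η x ∂(weightMeasure w) := by
    refine integral_congr_ae (Eventually.of_forall fun x => ?_)
    simp
    ring
  rw [e1, e2, h1, e3]
  ring

/-- Truncations of a function `f` with weighted gradient `g`, multiplied by `φ`, are weakly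
differentiable; the formula is the one expected from the chain and product rules. -/
theorem isWeakGradient_trunc_mul_phi (hw : IsWeight p w gφ) {f : Eucl d → ℝ}
    {g : Eucl d → Eucl d} (hfm : Measurable f) (hgm : Measurable g)
    (hf : MemLp f p (weightMeasure w)) (hg : MemLp g p (weightMeasure w))
    (h : HasWeightedGradient (weightMeasure w) (logGrad p w gφ) f g) {c : ℝ} (hc : 0 < c)
    (hc1 : c ≤ 1) :
    IsWeakGradient (fun x => trunc c (f x) * phi p w x)
      (fun x => truncDeriv c (f x) • (phi p w x • g x) + trunc c (f x) • posGrad w gφ x) := by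
  have := hw.isLocallyFiniteMeasure
  rw [isWeakGradient_iff]
  intro i
  have hP := hw.one_le_toReal
  have hP0 := hw.toReal_pos
  -- `φ = w * w ^ r` where `w` is positive
  set r : ℝ := 1 / p.toReal - 1 with hr
  have hr0 : r ≤ 0 := by
    have : 1 / p.toReal ≤ 1 := by rw [div_le_one hP0]; exact hP
    linarith
  have hr1 : -1 ≤ r := by
    have : 0 ≤ 1 / p.toReal := by positivity
    linarith
  set β := logGrad p w gφ with hβ
  have hwm := hw.measurable
  have hβm : Measurable fun x => β x i := by
    have := hw.measurable_logGrad
    fun_prop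
  have hgi : Measurable fun x => g x i := by fun_prop
  have hφm := hw.measurable_phi
  have hci : 0 < c⁻¹ := inv_pos.2 hc
  -- local integrability of the functions entering the chain rule
  have lF : LocallyIntegrable (fun x => w x * f x) volume :=
    hw.locallyIntegrable_weight_smul (hf.locallyIntegrable hw.one_le)
  have lF' : LocallyIntegrable (fun x => w x * (g x i + f x * β x i)) volume := by
    have h1 := locallyIntegrable_apply (hw.locallyIntegrable_weight_smul
      ((hg.locallyIntegrable hw.one_le).add (hw.locallyIntegrable_smul_logGrad hf))) i
    simpa [mul_add] using h1
  have lw' : LocallyIntegrable (fun x => w x * β x i) volume := by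
    have h1 := locallyIntegrable_apply
      (hw.locallyIntegrable_weight_smul hw.locallyIntegrable_logGrad) i
    simpa using h1
  have hF : HasWeakDeriv (EuclideanSpace.single i (1 : ℝ)) (fun x => w x * f x)
      (fun x => w x * (g x i + f x * β x i)) := by
    simpa [mul_add] using isWeakGradient_iff.1 (hw.isWeakGradient_weight_mul hf hg h) i
  have hW : HasWeakDeriv (EuclideanSpace.single i (1 : ℝ)) w (fun x => w x * β x i) := by
    simpa using isWeakGradient_iff.1 hw.isWeakGradient_weight i
  let δ : ℕ → ℝ := fun n => ((n : ℝ) + 1)⁻¹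
  have hδ : ∀ n, 0 < δ n := fun n => by positivity
  have hδlim : Tendsto δ atTop (𝓝 0) := tendsto_nat_add_one_inv
  have hD : ∀ n x, 0 < w x + δ n := fun n x => add_pos_of_nonneg_of_pos (hw.nonneg x) (hδ n)
  -- as `δ → 0`, `a → φ` everywhere, and `t → 1`, `s → f` where `w` is positive
  let a : ℕ → Eucl d → ℝ := fun n x => w x * (w x + δ n) ^ r
  let t : ℕ → Eucl d → ℝ := fun n x => w x / (w x + δ n)
  let s : ℕ → Eucl d → ℝ := fun n x => w x * f x / (w x + δ n)
  have ha0 : ∀ n x, 0 ≤ a n x := fun n x =>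
    mul_nonneg (hw.nonneg x) (Real.rpow_nonneg (hD n x).le _)
  have hφ : ∀ x, w x ≠ 0 → phi p w x = w x * w x ^ r := fun x hx => by
    have hx' : 0 < w x := lt_of_le_of_ne (hw.nonneg x) (Ne.symm hx)
    rw [phi, mul_comm, ← Real.rpow_add_one hx, hr, sub_add_cancel]
  have haφ : ∀ n x, a n x ≤ phi p w x := fun n x => by
    by_cases hx : w x = 0
    · simp only [a, hx, zero_mul]
      exact hw.phi_nonneg x
    · have hx' : 0 < w x := lt_of_le_of_ne (hw.nonneg x) (Ne.symm hx)
      rw [hφ x hx]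
      exact mul_le_mul_of_nonneg_left
        (Real.rpow_le_rpow_of_nonpos hx' (by linarith [hδ n]) hr0) hx'.le
  have ht0 : ∀ n x, 0 ≤ t n x := fun n x => div_nonneg (hw.nonneg x) (hD n x).le
  have ht1 : ∀ n x, t n x ≤ 1 := fun n x => by
    simp only [t]
    rw [div_le_one (hD n x)]
    linarith [hδ n]
  have hδw : ∀ x, Tendsto (fun n => w x + δ n) atTop (𝓝 (w x)) := fun x => by
    simpa using hδlim.const_add (w x)
  have halim : ∀ x, Tendsto (fun n => a n x) atTop (𝓝 (phi p w x)) := fun x => by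
    by_cases hx : w x = 0
    · simp [a, hx, (hw.phi_eq_zero_iff x).2 hx]
    · rw [hφ x hx]
      exact ((hδw x).rpow_const (Or.inl hx)).const_mul (w x)
  have htlim : ∀ x, w x ≠ 0 → Tendsto (fun n => t n x) atTop (𝓝 1) := fun x hx => by
    have h1 := (tendsto_const_nhds (x := w x)).div (hδw x) hx
    rwa [div_self hx] at h1
  have hst : ∀ n x, s n x = t n x * f x := fun n x => by
    simp only [s, t]
    ring
  have hslim : ∀ x, w x ≠ 0 → Tendsto (fun n => s n x) atTop (𝓝 (f x)) := fun x hx => by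
    simp_rw [hst]
    simpa using (htlim x hx).mul_const (f x)
  let un : ℕ → Eucl d → ℝ := fun n x => a n x * trunc c (s n x)
  let vn : ℕ → Eucl d → ℝ := fun n x => a n x * (t n x * truncDeriv c (s n x) * g x i
    + ((s n x * truncDeriv c (s n x)) * (1 - t n x) + (1 + r * t n x) * trunc c (s n x)) * β x i)
  have hdn : ∀ n, HasWeakDeriv (EuclideanSpace.single i (1 : ℝ)) (un n) (vn n) := by
    intro n
    have h1 := hF.trunc_div hc hc1 (hδ n) hr0 hr1 lF lF' hw.locallyIntegrable lw'
      (hwm.mul hfm) (hwm.mul (hgi.add (hfm.mul hβm))) hwm (hwm.mul hβm) hw.nonneg hW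
    convert! h1 using 2 with x
    have hDx := (hD n x).ne'
    have e1 : w x * f x = s n x * (w x + δ n) := by
      simp only [s]
      field_simp
    simp only [vn, a, t, Real.rpow_sub_one hDx]
    change _ = w x * (w x + δ n) ^ r * (truncDeriv c (s n x) * (w x + δ n)⁻¹) *
      (w x * (g x i + f x * β x i)) + (((w x + δ n) ^ r + w x * (r * ((w x + δ n) ^ r /
        (w x + δ n)))) * trunc c (s n x) - w x * (w x + δ n) ^ r *
        (s n x * truncDeriv c (s n x) * (w x + δ n)⁻¹)) * (w x * β x i)
    have e2 : w x * (g x i + f x * β x i) = w x * g x i + s n x * (w x + δ n) * β x i := by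
      rw [← e1]
      ring
    rw [e2]
    field_simp
    ring
  have ham : ∀ n, Measurable (a n) := fun n => hwm.mul ((hwm.add_const _).pow_const _)
  have htm : ∀ n, Measurable (t n) := fun n => hwm.div (hwm.add_const _)
  have hsm : ∀ n, Measurable (s n) := fun n => (hwm.mul hfm).div (hwm.add_const _)
  have hTm : ∀ n, Measurable fun x => trunc c (s n x) := fun n =>
    (continuous_trunc hc).measurable.comp (hsm n)
  have hT'm : ∀ n, Measurable fun x => truncDeriv c (s n x) := fun n =>
    (continuous_truncDeriv hc).measurable.comp (hsm n)
  -- the dominating functions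
  have lU : LocallyIntegrable (fun x => c⁻¹ * phi p w x) volume :=
    hw.locallyIntegrable_phi.smul c⁻¹
  have lV : LocallyIntegrable (fun x => ‖phi p w x * g x i‖
      + (2 * c⁻¹ * p.toReal) * ‖posGrad w gφ x i‖) volume := by
    have h1 : LocallyIntegrable (fun x => phi p w x • g x) volume :=
      ((hw.memLp_weightMeasure_iff hgm).1 hg).locallyIntegrable hw.one_le
    have h2 := locallyIntegrable_norm (locallyIntegrable_apply h1 i)
    have h3 := locallyIntegrable_norm (locallyIntegrable_apply hw.locallyIntegrable_posGrad i)
    exact h2.add (h3.smul (2 * c⁻¹ * p.toReal))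
  have hφβ : ∀ x, phi p w x * β x i = p.toReal * posGrad w gφ x i := fun x => by
    have h1 := congrArg (fun y : Eucl d => y i) (hw.phi_smul_logGrad x)
    simpa using h1
  refine HasWeakDeriv.of_tendsto (un := un) (vn := vn) lU lV
    (fun n => ((ham n).mul (hTm n)).aestronglyMeasurable)
    (fun n => (Measurable.mul (ham n) (Measurable.add (((htm n).mul (hT'm n)).mul hgi)
      (Measurable.mul (Measurable.add (((hsm n).mul (hT'm n)).mul ((htm n).const_sub 1))
        ((((htm n).const_mul r).const_add 1).mul (hTm n))) hβm))).aestronglyMeasurable)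
    (fun n => Eventually.of_forall fun x => ?_) (fun n => Eventually.of_forall fun x => ?_)
    (Eventually.of_forall fun x => ?_) (Eventually.of_forall fun x => ?_) hdn
  · simp only [un]
    rw [norm_mul, Real.norm_of_nonneg (ha0 n x), mul_comm c⁻¹]
    exact mul_le_mul (haφ n x) (abs_trunc_le_inv hc hc1 _) (abs_nonneg _) (hw.phi_nonneg x)
  · have b1 : |t n x * truncDeriv c (s n x) * g x i| ≤ |g x i| := by
      rw [abs_mul, abs_mul, abs_of_nonneg (ht0 n x)]
      refine mul_le_of_le_one_left (abs_nonneg _) ?_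
      exact mul_le_one₀ (ht1 n x) (abs_nonneg _) (abs_truncDeriv_le_one hc _)
    have b2 : |(s n x * truncDeriv c (s n x)) * (1 - t n x) + (1 + r * t n x) * trunc c (s n x)|
        ≤ 2 * c⁻¹ := by
      refine (abs_add_le _ _).trans ?_
      have h1 : |1 - t n x| ≤ 1 := by
        rw [abs_le]
        constructor <;> linarith [ht0 n x, ht1 n x]
      have h2 : |1 + r * t n x| ≤ 1 := by
        rw [abs_le]
        constructor <;> nlinarith [ht0 n x, ht1 n x]
      rw [abs_mul (s n x * truncDeriv c (s n x)), abs_mul (1 + r * t n x), two_mul]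
      refine add_le_add ?_ ?_
      · exact (mul_le_of_le_one_right (abs_nonneg _) h1).trans (abs_mul_truncDeriv_le hc hc1 _)
      · exact (mul_le_of_le_one_left (abs_nonneg _) h2).trans (abs_trunc_le_inv hc hc1 _)
    simp only [vn]
    rw [norm_mul, Real.norm_of_nonneg (ha0 n x)]
    calc a n x * ‖t n x * truncDeriv c (s n x) * g x i + ((s n x * truncDeriv c (s n x)) *
          (1 - t n x) + (1 + r * t n x) * trunc c (s n x)) * β x i‖
        ≤ phi p w x * (|g x i| + 2 * c⁻¹ * |β x i|) := by
          refine mul_le_mul (haφ n x) ?_ (norm_nonneg _) (hw.phi_nonneg x)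
          refine (norm_add_le _ _).trans (add_le_add b1 ?_)
          rw [norm_mul]
          exact mul_le_mul_of_nonneg_right b2 (abs_nonneg _)
      _ = |phi p w x * g x i| + 2 * c⁻¹ * |phi p w x * β x i| := by
          rw [abs_mul, abs_mul, abs_of_nonneg (hw.phi_nonneg x)]
          ring
      _ = _ := by
          rw [hφβ, abs_mul p.toReal, abs_of_pos hP0]
          simp only [Real.norm_eq_abs]
          ring
  · by_cases hx : w x = 0
    · simp [un, a, hx, (hw.phi_eq_zero_iff x).2 hx]
    · rw [mul_comm]
      exact (halim x).mul (((continuous_trunc hc).tendsto _).comp (hslim x hx))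
  · by_cases hx : w x = 0
    · simp [vn, a, hx, (hw.phi_eq_zero_iff x).2 hx, posGrad]
    · have l1 := ((continuous_trunc hc).tendsto _).comp (hslim x hx)
      have l2 := ((continuous_truncDeriv hc).tendsto _).comp (hslim x hx)
      have l3 := htlim x hx
      have l4 := (halim x).mul ((((l3.mul l2).mul_const (g x i))).add
        (((((hslim x hx).mul l2).mul (l3.const_sub 1)).add
          (((l3.const_mul r).const_add 1).mul l1)).mul_const (β x i)))
      have e : (truncDeriv c (f x) • phi p w x • g x + trunc c (f x) • posGrad w gφ x) i
          = phi p w x * (1 * truncDeriv c (f x) * g x i + (f x * truncDeriv c (f x) * (1 - 1)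
            + (1 + r * 1) * trunc c (f x)) * β x i) := by
        have e1 : posGrad w gφ x i = (1 + r) * (phi p w x * β x i) := by
          rw [hφβ, hr]
          field_simp
          ring
        simp only [PiLp.add_apply, PiLp.smul_apply, smul_eq_mul, e1]
        ring
      rw [e]
      exact l4

end IsWeight

/-! ### Approximation by test functions -/

section Approx

variable {d : ℕ}

theorem IsWeakGradient.smooth_mul {u χ : Eucl d → ℝ} {G : Eucl d → Eucl d}
    (h : IsWeakGradient u G) (hχ : ContDiff ℝ ∞ χ) (hu : LocallyIntegrable u volume)
    (hG : LocallyIntegrable G volume) :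
    IsWeakGradient (fun x => χ x * u x) (fun x => χ x • G x + u x • ∇ χ x) := by
  rw [isWeakGradient_iff] at h ⊢
  intro i
  convert! (h i).smooth_smul hχ hu (locallyIntegrable_apply hG i) using 2 with x
  simp [gradient_apply, mul_comm]

theorem MemLpLoc.memLp_indicator {F : Type*} [NormedAddCommGroup F] {q : ℝ≥0∞} {u : Eucl d → F}
    (hu : MemLpLoc u q volume) {K : Set (Eucl d)} (hK : IsCompact K) :
    MemLp (K.indicator u) q volume :=
  (memLp_indicator_iff_restrict hK.measurableSet).2 (hu K hK)

theorem MemLpLoc.memLp_smul_left {F : Type*} [NormedAddCommGroup F] [NormedSpace ℝ F] {q : ℝ≥0∞}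
    {u : Eucl d → F} (hu : MemLpLoc u q volume) {χ : Eucl d → ℝ} (hχ : Continuous χ)
    (hχ' : HasCompactSupport χ) : MemLp (fun x => χ x • u x) q volume := by
  obtain ⟨M, hM⟩ := hχ.bounded_above_of_compact_support hχ'
  have h : MemLp (fun x => χ x • (tsupport χ).indicator u x) q volume :=
    (hu.memLp_indicator hχ').smul (memLp_top_of_bound hχ.aestronglyMeasurable M
      (Eventually.of_forall hM))
  convert h using 2 with x
  by_cases hx : x ∈ tsupport χ
  · rw [indicator_of_mem hx]
  · simp [image_eq_zero_of_notMem_tsupport hx]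

theorem MemLpLoc.memLp_smul_right {F : Type*} [NormedAddCommGroup F] [NormedSpace ℝ F] {q : ℝ≥0∞}
    {u : Eucl d → ℝ} (hu : MemLpLoc u q volume) {v : Eucl d → F} (hv : Continuous v)
    (hv' : HasCompactSupport v) : MemLp (fun x => u x • v x) q volume := by
  obtain ⟨M, hM⟩ := hv.bounded_above_of_compact_support hv'
  have h : MemLp (fun x => (tsupport v).indicator u x • v x) q volume :=
    (memLp_top_of_bound hv.aestronglyMeasurable M (Eventually.of_forall hM)).smul
      (hu.memLp_indicator hv')
  convert h using 2 with x
  by_cases hx : x ∈ tsupport v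
  · rw [indicator_of_mem hx]
  · simp [image_eq_zero_of_notMem_tsupport hx]

theorem tendsto_eLpNorm_zero_of_dominated {α F : Type*} [MeasurableSpace α] {μ : Measure α}
    [NormedAddCommGroup F] {p : ℝ≥0∞} (hp0 : p ≠ 0) (hp : p ≠ ⊤) {f : ℕ → α → F} {b : α → ℝ}
    (hf : ∀ n, AEStronglyMeasurable (f n) μ) (hb : MemLp b p μ)
    (hfb : ∀ n, ∀ᵐ x ∂μ, ‖f n x‖ ≤ b x) (hlim : ∀ᵐ x ∂μ, Tendsto (fun n => f n x) atTop (𝓝 0)) :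
    Tendsto (fun n => eLpNorm (f n) p μ) atTop (𝓝 0) := by
  have hP : 0 < p.toReal := ENNReal.toReal_pos hp0 hp
  have h1 : Tendsto (fun n => ∫⁻ x, ‖f n x‖ₑ ^ p.toReal ∂μ) atTop (𝓝 (∫⁻ _, 0 ∂μ)) := by
    refine tendsto_lintegral_of_dominated_convergence' (fun x => ‖b x‖ₑ ^ p.toReal)
      (fun n => (hf n).enorm.pow_const _) (fun n => ?_)
      (lintegral_rpow_enorm_lt_top_of_eLpNorm_lt_top hp0 hp hb.2).ne ?_
    · filter_upwards [hfb n] with x hx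
      gcongr
      rw [enorm_le_iff_norm_le]
      exact hx.trans (le_abs_self _)
    · filter_upwards [hlim] with x hx
      have h2 := (ENNReal.continuous_rpow_const (y := p.toReal)).tendsto _ |>.comp hx.enorm
      simpa [ENNReal.zero_rpow_of_pos hP, Function.comp_def] using h2
  have h3 := (ENNReal.continuous_rpow_const (y := 1 / p.toReal)).tendsto _ |>.comp h1
  rw [lintegral_zero, ENNReal.zero_rpow_of_pos (by positivity)] at h3
  refine h3.congr fun n => ?_
  rw [eLpNorm_eq_lintegral_rpow_enorm_toReal hp0 hp]
  rfl

end Approx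

namespace IsWeight

variable {d : ℕ} {p : ℝ≥0∞} {w : Eucl d → ℝ} {gφ : Eucl d → Eucl d}

/-- A bounded function `f` of compact support is the limit of its mollifications in the weighted
Sobolev norm, if `f φ` is weakly differentiable with gradient `φ g + f ∇φ`. -/
theorem exists_test_approx_of_bounded (hw : IsWeight p w gφ) {f : Eucl d → ℝ}
    {g : Eucl d → Eucl d} (hfm : Measurable f) (hgm : Measurable g) {M : ℝ≥0}
    (hfM : ∀ x, ‖f x‖ ≤ M) (hg : MemLp g p (weightMeasure w)) {R : ℝ} (hR : 0 < R)
    (hfR : ∀ x, R ≤ ‖x‖ → f x = 0)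
    (hfA : IsWeakGradient (fun x => f x * phi p w x)
      (fun x => phi p w x • g x + f x • posGrad w gφ x)) {σ : ℝ≥0∞} (hσ : σ ≠ 0) :
    ∃ u : Eucl d → ℝ, IsTest u ∧ eLpNorm (fun x => u x - f x) p (weightMeasure w) ≤ σ ∧
      eLpNorm (fun x => ∇ u x - g x) p (weightMeasure w) ≤ σ := by
  have hp1 := hw.one_le
  have hp := hw.ne_top
  obtain ⟨C, hC, hmoll⟩ := exists_isMollifier d
  obtain ⟨χ, hχ, -, -, hχR, hχR'⟩ := exists_cutoff d (R := R + 2) (by linarith)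
  have hφm := hw.measurable_phi
  have hpm := hw.measurable_posGrad
  have hχg := hχ.continuous_gradient
  -- cut off `φ`, so that everything is globally `p`-integrable
  set Ψ : Eucl d → ℝ := fun x => χ x * phi p w x with hΨdef
  set G : Eucl d → Eucl d := fun x => χ x • posGrad w gφ x + phi p w x • ∇ χ x with hGdef
  set A : Eucl d → Eucl d := fun x => phi p w x • g x + f x • posGrad w gφ x with hAdef
  have hΨ : MemLp Ψ p volume := hw.diff.phi_mem.1.memLp_smul_left hχ.1.continuous hχ.2
  have hG : MemLp G p volume := (hw.memLpLoc_posGrad.memLp_smul_left hχ.1.continuous hχ.2).add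
    (hw.diff.phi_mem.1.memLp_smul_right hχg hχ.hasCompactSupport_gradient)
  have hΨm : Measurable Ψ := hχ.1.continuous.measurable.mul hφm
  have hGm : Measurable G :=
    (hχ.1.continuous.measurable.smul hpm).add (hφm.smul hχg.measurable)
  have hΨG : IsWeakGradient Ψ G := hw.isWeakGradient_posGrad.smooth_mul hχ.1
    hw.locallyIntegrable_phi hw.locallyIntegrable_posGrad
  have hχ1 : ∀ x, ‖x‖ < R + 2 → χ x = 1 := fun x hx => hχR x (mem_ball_zero_iff.2 hx)
  have hχ2 : ∀ x, ‖x‖ < R + 2 → ∇ χ x = 0 := fun x hx => by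
    simp [gradient, hχR' x (mem_ball_zero_iff.2 hx)]
  have hfG : ∀ x, f x • G x = f x • posGrad w gφ x := fun x => by
    rcases lt_or_ge ‖x‖ (R + 2) with hx | hx
    · simp [hGdef, hχ1 x hx, hχ2 x hx]
    · simp [hfR x (by linarith)]
  have hfΨ : ∀ x, f x * Ψ x = f x * phi p w x := fun x => by
    rcases lt_or_ge ‖x‖ (R + 2) with hx | hx
    · simp [hΨdef, hχ1 x hx]
    · simp [hfR x (by linarith)]
  have hftop : MemLp f ⊤ volume :=
    memLp_top_of_bound hfm.aestronglyMeasurable M (Eventually.of_forall hfM)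
  have hfl : LocallyIntegrable f volume := hftop.locallyIntegrable le_top
  have hfGp : MemLp (fun x => f x • G x) p volume := hG.smul hftop
  have hfΨp : MemLp (fun x => f x * Ψ x) p volume := hΨ.mul hftop
  have hA : MemLp A p volume := by
    refine ((hw.memLp_weightMeasure_iff hgm).1 hg).add ?_
    simpa only [hfG] using hfGp
  have hAm : Measurable A := (hφm.smul hgm).add (hfm.smul hpm)
  have hfA' : IsWeakGradient (fun x => f x * Ψ x) A := by
    simpa only [hfΨ] using hfA
  -- the constant in the estimates below
  set κ : ℝ≥0∞ := 1 + M + C * (M + (1 + M)) with hκ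
  have hκtop : κ ≠ ⊤ := by
    simp only [hκ]
    finiteness
  have hκ0 : κ ≠ 0 := by simp [hκ]
  set S := σ / κ with hS
  have hS0 : S ≠ 0 := by simp [hS, hσ, hκtop]
  have hSκ : S * κ ≤ σ := (ENNReal.div_mul_cancel hκ0 hκtop).le
  obtain ⟨δ₁, hδ₁, h₁⟩ := exists_forall_eLpNorm_translate_sub_le hp1 hp hG hS0
  obtain ⟨δ₂, hδ₂, h₂⟩ := exists_forall_eLpNorm_translate_sub_le hp1 hp hA hS0
  obtain ⟨δ₃, hδ₃, h₃⟩ := exists_forall_eLpNorm_translate_sub_le hp1 hp hfGp hS0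
  obtain ⟨δ₄, hδ₄, h₄⟩ := exists_forall_eLpNorm_translate_sub_le hp1 hp hΨ hS0
  obtain ⟨δ₅, hδ₅, h₅⟩ := exists_forall_eLpNorm_translate_sub_le hp1 hp hfΨp hS0
  obtain ⟨ε, hε, hε1, hε₁, hε₂, hε₃, hε₄, hε₅⟩ : ∃ ε : ℝ, 0 < ε ∧ ε ≤ 1 ∧ ε ≤ δ₁ ∧ ε ≤ δ₂ ∧
      ε ≤ δ₃ ∧ ε ≤ δ₄ ∧ ε ≤ δ₅ :=
    ⟨min 1 (min δ₁ (min δ₂ (min δ₃ (min δ₄ δ₅)))), by positivity, by simp, by simp, by simp,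
      by simp, by simp, by simp⟩
  obtain ⟨ρ, hρ⟩ := hmoll ε hε
  have hfc : HasCompactSupport f :=
    HasCompactSupport.intro (isCompact_closedBall (0 : Eucl d) R) fun x hx => by
      refine hfR x ?_
      rw [mem_closedBall_zero_iff, not_le] at hx
      exact hx.le
  have hu : IsTest (mollify ρ f) :=
    ⟨hρ.isTest.contDiff_mollify hfl, hρ.isTest.2.convolution _ hfc⟩
  have hu0 : ∀ x, R + 2 ≤ ‖x‖ → mollify ρ f x = 0 ∧ ∇ (mollify ρ f) x = 0 := by
    intro x hx
    have hz : ∀ z : Eucl d, ‖z‖ ≤ ε → f (x - z) = 0 := fun z hz => by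
      refine hfR _ ?_
      linarith [norm_sub_norm_le x z]
    constructor
    · rw [mollify_apply]
      refine integral_eq_zero_of_ae (Eventually.of_forall fun z => ?_)
      by_cases h0 : ρ z = 0
      · simp [h0]
      · simp [hz z (hρ.norm_le h0)]
    · rw [hρ.isTest.gradient_mollify_eq_integral hfl]
      refine integral_eq_zero_of_ae (Eventually.of_forall fun z => ?_)
      by_cases h0 : z ∈ tsupport ρ
      · simp [hz z (mem_closedBall_zero_iff.1 (hρ.tsupport_subset h0))]
      · have : fderiv ℝ ρ z = 0 := by
          by_contra hne
          exact h0 (support_fderiv_subset ℝ hne)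
        simp [gradient, this]
  have hum := hu.1.continuous.measurable
  have hgum := hu.continuous_gradient.measurable
  refine ⟨mollify ρ f, hu, ?_, ?_⟩
  · have hm : Measurable fun x => mollify ρ f x - f x := hum.sub hfm
    rw [hw.eLpNorm_weightMeasure hm]
    have e : (fun x => phi p w x • (mollify ρ f x - f x))
        = fun x => Ψ x * (mollify ρ f x - f x) := by
      funext x
      rcases lt_or_ge ‖x‖ (R + 2) with hx | hx
      · simp [hΨdef, hχ1 x hx]
      · simp [hfR x (by linarith), (hu0 x hx).1]
    rw [e]
    refine (hρ.eLpNorm_mul_mollify_sub_le hp1 hp hfm hΨm hfM (fun z hz => h₄ z (hz.trans hε₄))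
      (fun z hz => h₅ z (hz.trans hε₅))).trans (le_trans ?_ hSκ)
    calc S + M * S = S * (1 + M) := by ring
      _ ≤ S * κ := by gcongr; exact le_self_add
  · have hm : Measurable fun x => ∇ (mollify ρ f) x - g x := hgum.sub hgm
    rw [hw.eLpNorm_weightMeasure hm]
    have e : (fun x => phi p w x • (∇ (mollify ρ f) x - g x))
        = fun x => Ψ x • ∇ (mollify ρ f) x - (A x - f x • G x) := by
      funext x
      rw [hfG]
      rcases lt_or_ge ‖x‖ (R + 2) with hx | hx
      · simp [hΨdef, hAdef, hχ1 x hx, smul_sub]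
      · simp [hAdef, hfR x (by linarith), (hu0 x hx).2]
    rw [e]
    refine (hρ.eLpNorm_smul_gradient_mollify_sub_le hp1 hp hC hfm hΨm hGm hAm hfM hΨ hG hA hΨG hfA'
      (fun z hz => h₁ z (hz.trans hε₁)) (fun z hz => h₂ z (hz.trans hε₂))
      (fun z hz => h₃ z (hz.trans hε₃))).trans (le_trans ?_ hSκ)
    calc S + C * (M * S + (S + M * S)) = S * (1 + C * (M + (1 + M))) := by ring
      _ ≤ S * κ := by
        gcongr
        rw [hκ, add_assoc]
        gcongr
        exact le_add_self

/-- Every function with a weighted gradient is a limit of test functions in the weighted Sobolev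
norm: mollify its products with truncations and cutoffs. -/
theorem exists_test_approx (hw : IsWeight p w gφ) {f : Eucl d → ℝ} {g : Eucl d → Eucl d}
    (hfm : Measurable f) (hgm : Measurable g) (hf : MemLp f p (weightMeasure w))
    (hg : MemLp g p (weightMeasure w))
    (h : HasWeightedGradient (weightMeasure w) (logGrad p w gφ) f g) {σ : ℝ≥0∞} (hσ : σ ≠ 0) :
    ∃ u : Eucl d → ℝ, IsTest u ∧ eLpNorm (fun x => u x - f x) p (weightMeasure w) ≤ σ ∧
      eLpNorm (fun x => ∇ u x - g x) p (weightMeasure w) ≤ σ := by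
  have hp0 : p ≠ 0 := (zero_lt_one.trans_le hw.one_le).ne'
  obtain ⟨χ, hχ, hχ0, hχ1, hχR, -⟩ := exists_cutoff d (R := 1) one_pos
  obtain ⟨L, hL⟩ := hχ.continuous_gradient.bounded_above_of_compact_support
    hχ.hasCompactSupport_gradient
  have hL0 : 0 ≤ L := (norm_nonneg _).trans (hL 0)
  let δ : ℕ → ℝ := fun n => ((n : ℝ) + 1)⁻¹
  have hδ : ∀ n, 0 < δ n := fun n => by positivity
  have hδ1 : ∀ n, δ n ≤ 1 := fun n =>
    inv_le_one_of_one_le₀ (by linarith [n.cast_nonneg (α := ℝ)])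
  have hδlim : Tendsto δ atTop (𝓝 0) := tendsto_nat_add_one_inv
  let χn : ℕ → Eucl d → ℝ := fun n x => χ (δ n • x)
  have hχn : ∀ n, IsTest (χn n) := fun n =>
    ⟨hχ.1.comp (contDiff_const_smul _), hχ.2.comp_smul (hδ n).ne'⟩
  have hχng : ∀ n x, ∇ (χn n) x = δ n • ∇ χ (δ n • x) := fun n x => by
    simp [gradient, χn, fderiv_comp_smul]
  have hχnL : ∀ n x, ‖∇ (χn n) x‖ ≤ δ n * L := fun n x => by
    rw [hχng, norm_smul, Real.norm_of_nonneg (hδ n).le]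
    exact mul_le_mul_of_nonneg_left (hL _) (hδ n).le
  have hχnlim : ∀ x, Tendsto (fun n => χn n x) atTop (𝓝 1) := fun x => by
    have h1 : Tendsto (fun n => δ n • x) atTop (𝓝 0) := by
      simpa using hδlim.smul_const x
    have h2 := (hχ.1.continuous.tendsto 0).comp h1
    rwa [hχR 0 (by simp)] at h2
  let fn : ℕ → Eucl d → ℝ := fun n x => χn n x * trunc (δ n) (f x)
  let gn : ℕ → Eucl d → Eucl d := fun n x =>
    χn n x • truncDeriv (δ n) (f x) • g x + trunc (δ n) (f x) • ∇ (χn n) x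
  have hTm : ∀ n, Measurable fun x => trunc (δ n) (f x) := fun n =>
    (continuous_trunc (hδ n)).measurable.comp hfm
  have hT'm : ∀ n, Measurable fun x => truncDeriv (δ n) (f x) := fun n =>
    (continuous_truncDeriv (hδ n)).measurable.comp hfm
  have hfnm : ∀ n, Measurable (fn n) := fun n => (hχn n).1.continuous.measurable.mul (hTm n)
  have hgnm : ∀ n, Measurable (gn n) := fun n =>
    ((hχn n).1.continuous.measurable.smul ((hT'm n).smul hgm)).add
      ((hTm n).smul (hχn n).continuous_gradient.measurable)
  have hχnT' : ∀ n x, |χn n x * truncDeriv (δ n) (f x)| ≤ 1 := fun n x => by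
    rw [abs_mul, abs_of_nonneg (hχ0 _)]
    exact mul_le_one₀ (hχ1 _) (abs_nonneg _) (abs_truncDeriv_le_one (hδ n) _)
  have hgn_le : ∀ n x, ‖gn n x‖ ≤ ‖g x‖ + L * ‖f x‖ := fun n x => by
    refine (norm_add_le _ _).trans (add_le_add ?_ ?_)
    · rw [smul_smul, norm_smul]
      exact mul_le_of_le_one_left (norm_nonneg _) (hχnT' n x)
    · rw [norm_smul, mul_comm]
      refine mul_le_mul ((hχnL n x).trans (mul_le_of_le_one_left hL0 (hδ1 n)))
        (abs_trunc_le_abs (hδ n) _) (norm_nonneg _) hL0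
  have hb : MemLp (fun x => ‖g x‖ + L * ‖f x‖) p (weightMeasure w) :=
    hg.norm.add (hf.norm.const_mul L)
  have hgn : ∀ n, MemLp (gn n) p (weightMeasure w) := fun n =>
    hb.mono' (hgnm n).aestronglyMeasurable (Eventually.of_forall (hgn_le n))
  -- the truncated and cut off functions can be mollified
  have happ : ∀ n, ∀ τ : ℝ≥0∞, τ ≠ 0 → ∃ u : Eucl d → ℝ, IsTest u ∧
      eLpNorm (fun x => u x - fn n x) p (weightMeasure w) ≤ τ ∧
      eLpNorm (fun x => ∇ u x - gn n x) p (weightMeasure w) ≤ τ := by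
    intro n τ hτ
    have hδn : 0 ≤ (δ n)⁻¹ := (inv_pos.2 (hδ n)).le
    obtain ⟨R, hR, hχR⟩ : ∃ R : ℝ, 0 < R ∧ tsupport (χn n) ⊆ Metric.ball 0 R := by
      obtain ⟨R, hR, h⟩ := (hχn n).2.isCompact.isBounded.subset_ball_lt 0 0
      exact ⟨R, hR, h⟩
    refine hw.exists_test_approx_of_bounded (hfnm n) (hgnm n) (M := ⟨(δ n)⁻¹, hδn⟩)
      (fun x => ?_) (hgn n) hR (fun x hx => ?_) ?_ hτ
    · rw [norm_mul, Real.norm_of_nonneg (hχ0 _)]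
      exact (mul_le_of_le_one_left (abs_nonneg _) (hχ1 _)).trans
        (abs_trunc_le_inv (hδ n) (hδ1 n) _)
    · have : x ∉ tsupport (χn n) := fun h => by
        have := mem_ball_zero_iff.1 (hχR h)
        linarith
      simp [fn, image_eq_zero_of_notMem_tsupport this]
    · have h1 := hw.isWeakGradient_trunc_mul_phi hfm hgm hf hg h (hδ n) (hδ1 n)
      have l1 : LocallyIntegrable (fun x => trunc (δ n) (f x) * phi p w x) volume := by
        refine hw.locallyIntegrable_phi.smul ((δ n)⁻¹) |>.mono
          ((hTm n).mul hw.measurable_phi).aestronglyMeasurable (Eventually.of_forall fun x => ?_)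
        rw [norm_mul, Pi.smul_apply, norm_smul]
        gcongr
        exact (abs_trunc_le_inv (hδ n) (hδ1 n) _).trans (le_abs_self _)
      have l2 : LocallyIntegrable (fun x => truncDeriv (δ n) (f x) • (phi p w x • g x)) volume := by
        refine (((hw.memLp_weightMeasure_iff hgm).1 hg).locallyIntegrable hw.one_le).mono
          ((hT'm n).smul (hw.measurable_phi.smul hgm)).aestronglyMeasurable
          (Eventually.of_forall fun x => ?_)
        rw [norm_smul]
        exact mul_le_of_le_one_left (norm_nonneg _) (abs_truncDeriv_le_one (hδ n) _)
      have l3 : LocallyIntegrable (fun x => trunc (δ n) (f x) • posGrad w gφ x) volume := by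
        refine hw.locallyIntegrable_posGrad.smul ((δ n)⁻¹) |>.mono
          ((hTm n).smul hw.measurable_posGrad).aestronglyMeasurable
          (Eventually.of_forall fun x => ?_)
        rw [norm_smul, Pi.smul_apply, norm_smul]
        gcongr
        exact (abs_trunc_le_inv (hδ n) (hδ1 n) _).trans (le_abs_self _)
      have h2 := h1.smooth_mul (hχn n).1 l1 (l2.add l3)
      convert! h2 using 2 with x x
      · simp only [fn]
        ring
      · simp only [fn, gn]
        module
  have hfnlim : Tendsto (fun n => eLpNorm (fun x => fn n x - f x) p (weightMeasure w)) atTop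
      (𝓝 0) := by
    refine tendsto_eLpNorm_zero_of_dominated hp0 hw.ne_top
      (fun n => ((hfnm n).sub hfm).aestronglyMeasurable) (hf.norm.add hf.norm)
      (fun n => Eventually.of_forall fun x => ?_) (Eventually.of_forall fun x => ?_)
    · refine (norm_sub_le _ _).trans (add_le_add ?_ le_rfl)
      rw [norm_mul, Real.norm_of_nonneg (hχ0 _)]
      exact (mul_le_of_le_one_left (abs_nonneg _) (hχ1 _)).trans (abs_trunc_le_abs (hδ n) _)
    · simpa using ((hχnlim x).mul (tendsto_trunc hδlim (f x))).sub_const (f x)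
  have hgnlim : Tendsto (fun n => eLpNorm (fun x => gn n x - g x) p (weightMeasure w)) atTop
      (𝓝 0) := by
    refine tendsto_eLpNorm_zero_of_dominated hp0 hw.ne_top
      (fun n => ((hgnm n).sub hgm).aestronglyMeasurable) (hb.add hg.norm)
      (fun n => Eventually.of_forall fun x => ?_) (Eventually.of_forall fun x => ?_)
    · exact (norm_sub_le _ _).trans (add_le_add (hgn_le n x) le_rfl)
    · have h1 : Tendsto (fun n => ∇ (χn n) x) atTop (𝓝 0) := by
        refine squeeze_zero_norm (fun n => hχnL n x) ?_
        simpa using hδlim.mul_const L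
      have h2 := (((hχnlim x).smul ((tendsto_truncDeriv hδlim (f x)).smul_const (g x))).add
        ((tendsto_trunc hδlim (f x)).smul h1)).sub_const (g x)
      simpa using h2
  have hσ2 : 0 < σ / 2 := ENNReal.half_pos hσ
  obtain ⟨n, hn1, hn2⟩ := ((hfnlim.eventually (ge_mem_nhds hσ2)).and
    (hgnlim.eventually (ge_mem_nhds hσ2))).exists
  obtain ⟨u, hu, hu1, hu2⟩ := happ n (σ / 2) hσ2.ne'
  have hum := hu.1.continuous.measurable
  have hgum := hu.continuous_gradient.measurable
  refine ⟨u, hu, ?_, ?_⟩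
  · have e : (fun x => u x - f x) = (fun x => u x - fn n x) + fun x => fn n x - f x := by
      funext x
      simp
    rw [e, ← ENNReal.add_halves σ]
    exact (eLpNorm_add_le (hum.sub (hfnm n)).aestronglyMeasurable
      ((hfnm n).sub hfm).aestronglyMeasurable hw.one_le).trans (add_le_add hu1 hn1)
  · have e : (fun x => ∇ u x - g x) = (fun x => ∇ u x - gn n x) + fun x => gn n x - g x := by
      funext x
      simp
    rw [e, ← ENNReal.add_halves σ]
    exact (eLpNorm_add_le (hgum.sub (hgnm n)).aestronglyMeasurable
      ((hgnm n).sub hgm).aestronglyMeasurable hw.one_le).trans (add_le_add hu2 hn2)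

end IsWeight

/-! ### The space `V` and its identification with the completion -/

section

variable {α E : Type*} [MeasurableSpace α] [NormedAddCommGroup E] [NormedSpace ℝ E]

/-- Hölder's inequality: integration against a function in `L^q` is continuous on `L^p`. -/
theorem continuous_integral_mul_of_memLp {μ : Measure α} {p : ℝ≥0∞} [Fact (1 ≤ p)]
    (T : E →L[ℝ] ℝ) {h : α → ℝ} (hh : MemLp h p.conjExponent μ) :
    Continuous fun F : Lp E p μ => ∫ x, T (F x) * h x ∂μ := by
  have : Fact (1 ≤ p.conjExponent) := ⟨by rw [ENNReal.conjExponent]; exact le_self_add⟩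
  have hc : Continuous fun F : Lp E p μ => ContinuousLinearMap.lpPairing μ p p.conjExponent
      ((ContinuousLinearMap.mul ℝ ℝ).comp T) F (hh.toLp h) :=
    (ContinuousLinearMap.continuous _).clm_apply continuous_const
  refine hc.congr fun F => ?_
  rw [ContinuousLinearMap.lpPairing_eq_integral]
  refine integral_congr_ae ?_
  filter_upwards [hh.coeFn_toLp] with x hx
  simp [hx]

end

theorem HasWeightedGradient.congr_ae {d : ℕ} {μ : Measure (Eucl d)} {β : Eucl d → Eucl d}
    {f f' : Eucl d → ℝ} {g g' : Eucl d → Eucl d} (h : HasWeightedGradient μ β f g)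
    (hf : f =ᵐ[μ] f') (hg : g =ᵐ[μ] g') : HasWeightedGradient μ β f' g' := by
  intro i η hη
  have e1 : ∫ x, g' x i * η x ∂μ = ∫ x, g x i * η x ∂μ := by
    refine integral_congr_ae ?_
    filter_upwards [hg] with x hx
    rw [hx]
  have e2 : ∫ x, f' x * partialD i η x ∂μ = ∫ x, f x * partialD i η x ∂μ := by
    refine integral_congr_ae ?_
    filter_upwards [hf] with x hx
    rw [hx]
  have e3 : ∫ x, f' x * η x * β x i ∂μ = ∫ x, f x * η x * β x i ∂μ := by
    refine integral_congr_ae ?_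
    filter_upwards [hf] with x hx
    rw [hx]
  rw [e1, e2, e3, h i η hη]

namespace IsWeight

variable {d : ℕ} {p : ℝ≥0∞} {w : Eucl d → ℝ} {gφ : Eucl d → Eucl d}

theorem memLp_test_mul_logGrad (hw : IsWeight p w gφ) {η : Eucl d → ℝ} (hη : IsTest η)
    (i : Fin d) : MemLp (fun x => η x * logGrad p w gφ x i) p.conjExponent (weightMeasure w) := by
  have := hw.isLocallyFiniteMeasure
  have h1 : MemLp (fun x => logGrad p w gφ x i) p.conjExponent
      ((weightMeasure w).restrict (tsupport η)) :=
    (hw.diff.logGrad_mem _ hη.2).continuousLinearMap_comp (EuclideanSpace.proj i : Eucl d →L[ℝ] ℝ)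
  have h2 : MemLp η ∞ ((weightMeasure w).restrict (tsupport η)) :=
    (hη.1.continuous.memLp_of_hasCompactSupport hη.2).restrict _
  have h3 : MemLp (fun x => η x * logGrad p w gφ x i) p.conjExponent
      ((weightMeasure w).restrict (tsupport η)) := h1.mul h2
  rw [← memLp_indicator_iff_restrict (isClosed_tsupport η).measurableSet] at h3
  refine h3.ae_eq (Eventually.of_forall fun x => ?_)
  by_cases hx : x ∈ tsupport η
  · rw [indicator_of_mem hx]
  · simp [indicator_of_notMem hx, image_eq_zero_of_notMem_tsupport hx]

theorem isClosed_V1p [Fact (1 ≤ p)] (hw : IsWeight p w gφ) :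
    IsClosed (V1p p (weightMeasure w) (logGrad p w gφ)) := by
  have := hw.isLocallyFiniteMeasure
  simp only [V1p, ofPred_forall]
  refine isClosed_iInter fun i => isClosed_iInter fun η => isClosed_iInter fun hη => ?_
  have c : Continuous fun F : SobPair p (weightMeasure w) => WithLp.ofLp F :=
    WithLp.prod_continuous_ofLp p _ _
  have c1 := (continuous_integral_mul_of_memLp (μ := weightMeasure w) (p := p)
    (EuclideanSpace.proj i : Eucl d →L[ℝ] ℝ)
    (hη.1.continuous.memLp_of_hasCompactSupport hη.2)).comp c.snd
  have c2 := (continuous_integral_mul_of_memLp (μ := weightMeasure w) (p := p)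
    (ContinuousLinearMap.id ℝ ℝ) ((hη.continuous_fderiv_apply
      (EuclideanSpace.single i 1)).memLp_of_hasCompactSupport
        (hη.hasCompactSupport_fderiv_apply (EuclideanSpace.single i 1)))).comp c.fst
  have c3 := (continuous_integral_mul_of_memLp (μ := weightMeasure w) (p := p)
    (ContinuousLinearMap.id ℝ ℝ) (hw.memLp_test_mul_logGrad hη i)).comp c.fst
  refine isClosed_eq c1 (c2.neg.sub (c3.congr fun F => ?_))
  exact integral_congr_ae (Eventually.of_forall fun x => (mul_assoc _ _ _).symm)

/-- The weighted gradient of a function is unique. -/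
theorem ae_eq_of_hasWeightedGradient (hw : IsWeight p w gφ) {f : Eucl d → ℝ}
    {g g' : Eucl d → Eucl d} (hg : MemLp g p (weightMeasure w))
    (hg' : MemLp g' p (weightMeasure w))
    (h : HasWeightedGradient (weightMeasure w) (logGrad p w gφ) f g)
    (h' : HasWeightedGradient (weightMeasure w) (logGrad p w gφ) f g') :
    g =ᵐ[weightMeasure w] g' := by
  have := hw.isLocallyFiniteMeasure
  have key : ∀ i : Fin d, ∀ᵐ x ∂(weightMeasure w), g x i = g' x i := by
    intro i
    refine ae_eq_of_integral_contDiff_smul_eq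
      (locallyIntegrable_apply (hg.locallyIntegrable hw.one_le) i)
      (locallyIntegrable_apply (hg'.locallyIntegrable hw.one_le) i)
      fun η h1 h2 => ?_
    simp only [smul_eq_mul, mul_comm (η _)]
    rw [h i η ⟨h1, h2⟩, h' i η ⟨h1, h2⟩]
  filter_upwards [ae_all_iff.2 key] with x hx
  ext i
  exact hx i

/-- The weighted gradient of a smooth function is its classical gradient: test the weak
derivative of the weight with `u η`. -/
theorem hasWeightedGradient_of_contDiff (hw : IsWeight p w gφ) {u : Eucl d → ℝ}
    (hu : ContDiff ℝ ∞ u) :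
    HasWeightedGradient (weightMeasure w) (logGrad p w gφ) u (∇ u) := by
  have := hw.isLocallyFiniteMeasure
  intro i η hη
  have hcu : Continuous fun x => fderiv ℝ u x (EuclideanSpace.single i 1) :=
    (hu.continuous_fderiv (by simp)).clm_apply continuous_const
  have hcη := hη.continuous_fderiv_apply (EuclideanSpace.single i (1 : ℝ))
  have h := hw.isWeakGradient_weight i _ (hη.mul_left hu)
  have e1 : ∫ x, u x * η x * logGrad p w gφ x i ∂(weightMeasure w)
      = ∫ x, (w x • logGrad p w gφ x) i * (u x * η x) := by
    rw [hw.integral_weightMeasure]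
    refine integral_congr_ae (Eventually.of_forall fun x => ?_)
    simp
    ring
  have i1 : Integrable (fun x => ∇ u x i * η x) (weightMeasure w) := by
    simp only [gradient_apply]
    exact (hcu.mul hη.1.continuous).integrable_of_hasCompactSupport hη.2.mul_left
  have i2 : Integrable (fun x => u x * partialD i η x) (weightMeasure w) :=
    (hu.continuous.mul hcη).integrable_of_hasCompactSupport
      (hη.hasCompactSupport_fderiv_apply _).mul_left
  have e2 : ∫ x, w x * partialD i (fun x => u x * η x) x
      = ∫ x, ∇ u x i * η x ∂(weightMeasure w) + ∫ x, u x * partialD i η x ∂(weightMeasure w) := by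
    rw [← integral_add i1 i2, hw.integral_weightMeasure]
    refine integral_congr_ae (Eventually.of_forall fun x => ?_)
    simp only [partialD, gradient_apply, smul_eq_mul]
    rw [fderiv_fun_mul ((hu.differentiable (by simp)) x) ((hη.1.differentiable (by simp)) x)]
    simp only [add_apply, smul_apply, smul_eq_mul]
    ring
  rw [e1, h, e2]
  ring

theorem memLp_of_isTest (hw : IsWeight p w gφ) {u : Eucl d → ℝ} (hu : IsTest u) :
    MemLp u p (weightMeasure w) ∧ MemLp (∇ u) p (weightMeasure w) := by
  have := hw.isLocallyFiniteMeasure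
  exact ⟨hu.1.continuous.memLp_of_hasCompactSupport hu.2,
    hu.continuous_gradient.memLp_of_hasCompactSupport hu.hasCompactSupport_gradient⟩

theorem toPair_mem_V1p [Fact (1 ≤ p)] (hw : IsWeight p w gφ) (u : X p (weightMeasure w)) :
    X.toPair u ∈ V1p p (weightMeasure w) (logGrad p w gφ) := by
  have h1 : (X.toPair u).fst =ᵐ[weightMeasure w] u.1 := u.2.2.1.coeFn_toLp
  have h2 : (X.toPair u).snd =ᵐ[weightMeasure w] ∇ u.1 := u.2.2.2.coeFn_toLp
  exact (hw.hasWeightedGradient_of_contDiff u.2.1).congr_ae h1.symm h2.symm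

/-- Test functions are dense in `V`. -/
theorem mem_closure_of_mem_V1p [Fact (1 ≤ p)] (hw : IsWeight p w gφ)
    {F : SobPair p (weightMeasure w)} (hF : F ∈ V1p p (weightMeasure w) (logGrad p w gφ)) :
    F ∈ closure (X.toPair '' {u : X p (weightMeasure w) | IsTest u.fn}) := by
  have hcl : WithLp.ofLp F ∈ closure ((fun u : X p (weightMeasure w) =>
      (u.2.2.1.toLp u.1, u.2.2.2.toLp (∇ u.1))) '' {u | IsTest u.fn}) := by
    rw [EMetric.mem_closure_iff]
    intro ε hε
    obtain ⟨σ, hσ, hσε⟩ := exists_between hε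
    obtain ⟨u, hu, h1, h2⟩ := hw.exists_test_approx (Lp.stronglyMeasurable F.fst).measurable
      (Lp.stronglyMeasurable F.snd).measurable (Lp.memLp F.fst) (Lp.memLp F.snd) hF hσ.ne'
    obtain ⟨m1, m2⟩ := hw.memLp_of_isTest hu
    let U : X p (weightMeasure w) := ⟨u, hu.1, m1, m2⟩
    refine ⟨_, mem_image_of_mem _ (show U ∈ {u : X p (weightMeasure w) | IsTest u.fn} from hu), ?_⟩
    rw [edist_comm, Prod.edist_eq]
    refine (max_le ?_ ?_).trans_lt hσε
    · rw [Lp.edist_def]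
      refine (eLpNorm_congr_ae ?_).trans_le h1
      filter_upwards [m1.coeFn_toLp] with x hx
      exact congrArg (· - F.fst x) hx
    · rw [Lp.edist_def]
      refine (eLpNorm_congr_ae ?_).trans_le h2
      filter_upwards [m2.coeFn_toLp] with x hx
      exact congrArg (· - F.snd x) hx
  refine map_mem_closure (WithLp.prod_continuous_toLp p _ _) hcl ?_
  rintro _ ⟨u, hu, rfl⟩
  exact ⟨u, hu, rfl⟩

/-- The isometry `X → SobPair` extends to the completion, and its range is the closed space `V`. -/
theorem exists_linearIsometry_range_eq_V1p [Fact (1 ≤ p)] (hw : IsWeight p w gφ) :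
    ∃ Φ : H1p p (weightMeasure w) →ₗᵢ[ℝ] SobPair p (weightMeasure w),
      (∀ u : X p (weightMeasure w), Φ (u : H1p p (weightMeasure w)) = X.toPair u) ∧
      range Φ = V1p p (weightMeasure w) (logGrad p w gφ) := by
  let T : X p (weightMeasure w) →ₗᵢ[ℝ] SobPair p (weightMeasure w) :=
    { toLinearMap := X.toPair, norm_map' := fun _ => rfl }
  let e : X p (weightMeasure w) →L[ℝ] H1p p (weightMeasure w) := UniformSpace.Completion.toComplL
  let L := T.toContinuousLinearMap.extend e
  have hL : ∀ u : X p (weightMeasure w), L (u : H1p p (weightMeasure w)) = X.toPair u := fun u =>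
    ContinuousLinearMap.extend_eq _ UniformSpace.Completion.denseRange_coe
      (UniformSpace.Completion.isUniformInducing_coe _) u
  let Φ : H1p p (weightMeasure w) →ₗᵢ[ℝ] SobPair p (weightMeasure w) :=
    { toLinearMap := L.toLinearMap
      norm_map' := fun y => by
        refine UniformSpace.Completion.induction_on y
          (isClosed_eq L.continuous.norm continuous_norm) fun u => ?_
        change ‖L u‖ = _
        rw [hL, UniformSpace.Completion.norm_coe]
        rfl }
  refine ⟨Φ, hL, Subset.antisymm ?_ fun F hF => ?_⟩
  · rintro _ ⟨y, rfl⟩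
    refine UniformSpace.Completion.induction_on y (hw.isClosed_V1p.preimage Φ.continuous)
      fun u => ?_
    change L u ∈ _
    rw [hL]
    exact hw.toPair_mem_V1p u
  · have hcl : IsClosed (range Φ) := Φ.isometry.isClosedEmbedding.isClosed_range
    refine hcl.closure_subset_iff.2 ?_ (hw.mem_closure_of_mem_V1p hF)
    rintro _ ⟨u, -, rfl⟩
    exact ⟨u, hL u⟩

end IsWeight

/-! ### Measurable representatives of the weight and of the gradient -/

theorem exists_isWeight_ae_eq {d : ℕ} {p : ℝ≥0∞} (hp1 : 1 ≤ p) (hp : p ≠ ⊤) {w : Eucl d → ℝ}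
    (hw : LocallyIntegrable w volume) (hw0 : ∀ᵐ x, 0 ≤ w x) {gφ : Eucl d → Eucl d}
    (hDiff : CondDiff p w gφ) :
    ∃ (w' : Eucl d → ℝ) (gφ' : Eucl d → Eucl d), IsWeight p w' gφ' ∧
      weightMeasure w = weightMeasure w' ∧
      logGrad p w gφ =ᵐ[weightMeasure w] logGrad p w' gφ' := by
  have hwm : AEMeasurable w volume := hw.aestronglyMeasurable.aemeasurable
  have hgm : AEMeasurable gφ volume :=
    (hDiff.phi_mem.2.1.locallyIntegrable hp1).aestronglyMeasurable.aemeasurable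
  set w' : Eucl d → ℝ := fun x => max (hwm.mk w x) 0 with hw'
  set gφ' := hgm.mk gφ
  have ew : w =ᵐ[volume] w' := by
    filter_upwards [hwm.ae_eq_mk, hw0] with x h1 h2
    rw [hw']
    simp only [← h1, max_eq_left h2]
  have eg : gφ =ᵐ[volume] gφ' := hgm.ae_eq_mk
  have eφ : phi p w =ᵐ[volume] phi p w' := by
    filter_upwards [ew] with x hx
    rw [phi, phi, hx]
  have eμ : weightMeasure w = weightMeasure w' := withDensity_congr_ae <| by
    filter_upwards [ew] with x hx
    rw [hx]
  have eβ : logGrad p w gφ =ᵐ[weightMeasure w] logGrad p w' gφ' := by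
    refine (withDensity_absolutelyContinuous volume _).ae_eq ?_
    filter_upwards [eφ, eg] with x h1 h2
    rw [logGrad, logGrad, h1, h2]
  refine ⟨w', gφ', ⟨hp1, hp, hwm.measurable_mk.max measurable_const, fun x => le_max_right _ _,
    hw.congr ew, hgm.measurable_mk, ⟨⟨fun K hK => ?_, fun K hK => ?_, fun i η hη => ?_⟩,
      fun K hK => ?_⟩⟩, eμ, eβ⟩
  · exact (hDiff.phi_mem.1 K hK).ae_eq (ae_restrict_of_ae eφ)
  · exact (hDiff.phi_mem.2.1 K hK).ae_eq (ae_restrict_of_ae eg)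
  · refine Eq.trans (integral_congr_ae ?_) ((hDiff.phi_mem.2.2 i η hη).trans
      (congrArg Neg.neg (integral_congr_ae ?_)))
    · filter_upwards [eg] with x hx
      rw [hx]
    · filter_upwards [eφ] with x hx
      rw [hx]
  · rw [← eμ]
    exact (hDiff.logGrad_mem K hK).ae_eq (ae_restrict_of_ae eβ)

theorem V1p_congr_ae {d : ℕ} {p : ℝ≥0∞} {μ : Measure (Eucl d)} {β β' : Eucl d → Eucl d}
    (h : β =ᵐ[μ] β') : V1p p μ β = V1p p μ β' := by
  ext F
  refine forall_congr' fun i => forall_congr' fun η => forall_congr' fun _ => ?_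
  have e : ∫ x, F.fst x * η x * β x i ∂μ = ∫ x, F.fst x * η x * β' x i ∂μ := by
    refine integral_congr_ae ?_
    filter_upwards [h] with x hx
    rw [hx]
  rw [e]

end WeightedSobolev

end

open WeightedSobolev
theorem theorem1p1 {d : ℕ} (hd : 1 ≤ d) (p : ℝ≥0∞) [Fact (1 ≤ p)] (hp : p ≠ ⊤)
    (w : Eucl d → ℝ) (hw : LocallyIntegrable w volume) (hw0 : ∀ᵐ x, 0 ≤ w x)
    (gφ : Eucl d → Eucl d) (hDiff : CondDiff p w gφ)
    (hLip : p = 1 → MemLpLoc gφ ⊤ volume)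
    (μ : Measure (Eucl d)) (hμ : μ = weightMeasure w)
    (β : Eucl d → Eucl d) (hβ : β = logGrad p w gφ) :
    -- an element of `V^{1,p}(μ)` is a `μ`-class of functions: its gradient is unique
    (Set.InjOn (fun F : SobPair p μ => F.fst) (V1p p μ β)) ∧
    -- `C_0^∞` is contained in `V^{1,p}(μ)`, with the classical gradient
    (∀ u : Eucl d → ℝ, IsTest u → ∃ F ∈ V1p p μ β, F.fst =ᵐ[μ] u ∧ F.snd =ᵐ[μ] ∇ u) ∧
    -- `C_0^∞` is dense in `V^{1,p}(μ)` with respect to the Sobolev norm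
    Dense {F : V1p p μ β | ∃ u : Eucl d → ℝ, IsTest u ∧ F.1.fst =ᵐ[μ] u} ∧
    -- `H^{1,p}(μ) = V^{1,p}(μ)`, with the same norm and gradient
    (∃ Φ : H1p p μ →ₗᵢ[ℝ] SobPair p μ,
      (∀ u : X p μ, Φ (u : H1p p μ) = X.toPair u) ∧ Set.range Φ = V1p p μ β) := by
  obtain ⟨w', gφ', hw', eμ, eβ⟩ := exists_isWeight_ae_eq Fact.out hp hw hw0 hDiff
  have hV : V1p p μ β = V1p p μ (logGrad p w' gφ') := by
    rw [hβ]
    refine V1p_congr_ae ?_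
    rw [hμ]
    exact eβ
  rw [hV]
  clear hV hβ
  obtain rfl : μ = weightMeasure w' := hμ.trans eμ
  refine ⟨fun F hF G hG h => ?_, fun u hu => ?_, ?_, hw'.exists_linearIsometry_range_eq_V1p⟩
  · have h' : F.fst = G.fst := h
    have hs : F.snd = G.snd := Lp.ext (hw'.ae_eq_of_hasWeightedGradient (Lp.memLp F.snd)
      (Lp.memLp G.snd) hF (HasWeightedGradient.congr_ae hG (by rw [h']) ae_eq_rfl))
    exact WithLp.ofLp_injective p (Prod.ext h' hs)
  · obtain ⟨m1, m2⟩ := hw'.memLp_of_isTest hu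
    exact ⟨_, hw'.toPair_mem_V1p ⟨u, hu.1, m1, m2⟩, m1.coeFn_toLp, m2.coeFn_toLp⟩
  · rw [Subtype.dense_iff]
    intro F hF
    refine closure_mono ?_ (hw'.mem_closure_of_mem_V1p hF)
    rintro _ ⟨u, hu, rfl⟩
    exact ⟨⟨_, hw'.toPair_mem_V1p u⟩, ⟨u.fn, hu, u.2.2.1.coeFn_toLp⟩, rfl⟩
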